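/- **Setting.** Let $N\ge 1$, let $\Lambda=(\mathbb Z/N)^4$ be the periodic hypercubic lattice, $\hat s=\hat1+\hat2+\hat3+\hat4$, and let $\tilde\Lambda=\Lambda+\tfrac12\hat s$ be the dual lattice, $F(x)=x+\tfrac12\hat s$, $\tilde F(x)=x-\tfrac12\hat s$. Lattice forms are antisymmetric functions on oriented cells $(x,\mu_1\cdots\mu_r)$, with $$(d\alpha)_{x,\mu_1\cdots\mu_{r+1}}=\sum_j(-1)^{j+1}\bigl(\alpha_{x+\hat\mu_j,\cdots\mathring\mu_j\cdots}-\alpha_{x,\cdots\mathring\mu_j\cdots}\bigr),\qquad (\partial\alpha)_{x,\mu_1\cdots\mu_r}=\sum_\nu\bigl(\alpha_{x,\mu_1\cdots\mu_r\nu}-\alpha_{x-\hat\nu,\mu_1\cdots\mu_r\nu}\bigr),$$ $\alpha\cdot\beta=\sum_x\sum_{\mu_1<\cdots<\mu_r}\alpha_{x,\mu_1\cdots\mu_r}\beta_{x,\mu_1\cdots\mu_r}$, $\alpha^2=\alpha\cdot\alpha$, the cup product of a $p$-form and a $q$-form $$(\alpha\cup\beta)_{x,\mu_1\cdots\mu_{p+q}}=\tfrac1{p!\,q!}\sum_{\sigma\in\mathfrak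 S_{p+q}}\epsilon_\sigma\,\alpha_{x,\mu_{\sigma(1)}\cdots\mu_{\sigma(p)}}\,\beta_{x+\sum_{i\le p}\hat\mu_{\sigma(i)},\,\mu_{\sigma(p+1)}\cdots\mu_{\sigma(p+q)}},$$ and $$(\alpha\cup_1\beta)_{x,\mu_1\cdots\mu_{p+q-1}}=(-1)^q\sum_{a}(-1)^aP_{\mu_a}\bigl(P_{\mu_a}\iota_{\mu_a}\alpha\cup P_{\mu_a}\iota_{\mu_a}\beta\bigr)_{x,\mu_1\cdots\mathring\mu_a\cdots\mu_{p+q-1}}\quad(\mu_1<\cdots<\mu_{p+q-1}),$$ where $\iota_\mu$ inserts $\mu$ as first index and $P_\mu$ is the pull-back by the reflection of the coordinates $x_\mu,\dots,x_4$, i.e. $(P_\mu\alpha)_{x,\mu_1\cdots\mu_r}=(-1)^{\#\{i:\mu_i\ge\mu\}}\alpha_{P_\mu x-\sum_{\mu_i\ge\mu}\hat\mu_i,\,\mu_1\cdots\mu_r}$ for $\mu_1<\cdots<\mu_r$. Sums $\sum_x$ of $4$-forms are over the component $1234$. Let $P_\partial$ be the orthogonal projection of real $2$-forms onto $\operatorname{Im}\partial$.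 Let $\beta>0$, $\theta\in\mathbb R$ and $p,q_e,q_m\in\mathbb Z$. For a real $1$-form $A^e$, a real $3$-form $A^m$ and an integer $2$-form $n$ put $F^e=dA^e+2\pi n$, $\mathfrak P(n)=\sum_x(n\cup n+n\cup_1dn)$, $$Q=\sum_x\Bigl(\tfrac1{8\pi^2}F^e\cup F^e+\tfrac1{4\pi}F^e\cup_1dn\Bigr),\quad \tilde Q=\sum_x\Bigl(\tfrac1{8\pi^2}F^e\cup F^e-\tfrac1{4\pi}F^e\cup_1dn\Bigr),\quad Q_0=\tfrac1{8\pi^2}\sum_xF^e\cup F^e .$$ Define $\tilde A^m$ on the links of the dual lattice by $A^m_{x,\mu\nu\rho}=\sum_\sigma\epsilon_{\mu\nu\rho\sigma}\tilde A^m_{F(x)-\hat\sigma,\sigma}$. A contour $\gamma$ is a finite list of oriented links, $\dot\gamma_{x,\mu}$ is the net number of times that it runs through the link from $x$ to $x+\hat\mu$, $W_e^{q}(\gamma)=\prod_{l\in\gamma}e^{iqA^e_l}$ and $W_m^{q}(\tilde\gamma)=\prod_{l\in\tilde\gamma}e^{iq\tilde A^m_l}$ (with $A_{x,-\mu}=-A_{x-\hat\mu,\mu}$).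 The dyonic loop and the dual dyonic loop (opposite framing) are $$W_d^{(q_e,q_m)}(\gamma)=W_e^{q_e}(\gamma)\,W_m^{q_m}(F\gamma),\qquad \tilde W_d^{(q_e,q_m)}(\gamma)=W_e^{q_e}(\gamma)\,W_m^{q_m}(\tilde F\gamma).$$ With $DA=\prod\frac{dA}{2\pi}$ over components in $[-\pi,\pi)$ and $Z[\beta,\theta]=\int DA^e\sum_n e^{-\frac\beta2(F^e)^2-i\theta Q_0}\,\delta_{dn,0}$, set $$\langle W_d^{(q_e,q_m)}(\gamma)\rangle^p_{\beta,\theta}=\frac1{Z[\beta,\theta]}\int DA^e\int DA^m\sum_n e^{-\frac\beta2(F^e)^2-i\theta Q+\frac i{2\pi}\partial A^m\cdot F^e-ip\pi\mathfrak P(n)}\,W_d^{(q_e,q_m)}(\gamma),$$ and define $\langle\tilde W_d^{(q_e,q_m)}(\gamma)\rangle^p_{\beta,\theta}$ in the same way, with $\tilde Q$ in place of $Q$. For the contour $F\gamma$ on $\tilde\Lambda$ the theory is the same theory placed on $\tilde\Lambda$. Let $\gamma$ be a contour on $\Lambda$ and let $l$ be an integer $2$-form with $\sum_{\nu<\rho<\sigma}\epsilon_{\mu\nu\rho\sigma}(dl)_{x+\hat\mu,\nu\rho\sigma}=-\dot\gamma_{x,\mu}$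 for all $x,\mu$ (so $\gamma$ is closed and bounds a surface, to which $l$ is dual). Put $u=\sum_xP_\partial l\cup_1dP_\partial l\in\mathbb R$ and $v=\mathfrak P(l)\in\mathbb Z$. **Lemma (Flipping framings).** (1) $$\langle\tilde W_d^{(q_e,q_m)}(F\gamma)\rangle^p_{\beta,\theta}=\langle W_d^{(q_e,q_m)}(\gamma)\rangle^p_{\beta,\theta}\;\exp\Bigl(2\pi iu\bigl(q_e+\tfrac{\theta}{2\pi}q_m\bigr)q_m\Bigr).$$ (2) This relation is described by alternating Poisson summation $\mathcal P$ and $\mathcal T$ three times, in the following sense. Consider expressions $c\,\langle W_d^{(q_e,q_m)}(\gamma)\rangle^p_{\beta,\theta}$ and $c\,\langle\tilde W_d^{(q_e,q_m)}(F\gamma)\rangle^p_{\beta,\theta}$ with $c\in\mathbb C$. Put $\tilde\beta=\beta/((2\pi\beta)^2+(\frac\theta{2\pi})^2)$, $\tilde\theta=-\theta/((2\pi\beta)^2+(\frac\theta{2\pi})^2)$. Let $\mathcal P$ exchange $W_d(\gamma)$ and $\tilde W_d(F\gamma)$, replace $(q_e,q_m)$ by $(q_m,-q_e)$ and $(\beta,\theta)$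 by $(\tilde\beta,\tilde\theta)$, and multiply $c$ by $\exp(\mp\frac i2\theta uq_m^2\mp\frac i2\tilde\theta uq_e^2-ip\pi v(q_m^2+q_e^2))$ (upper sign if the expression it is applied to contains $W_d$, lower sign if it contains $\tilde W_d$). Let $\mathcal T$ keep the type of the loop and $\beta$, replace $(q_e,q_m)$ by $(q_e-q_m,q_m)$ and $\theta$ by $\theta+2\pi$, and multiply $c$ by $(-1)^{q_m^2v}$. Then, starting from $\langle W_d^{(q_e,q_m)}(\gamma)\rangle^p_{\beta,\theta}$ and applying $\mathcal P,\mathcal T,\mathcal P,\mathcal T,\mathcal P,\mathcal T$ in this order, none of the six steps changes the value of the expression; the result is $\exp\bigl(-2\pi iu(q_e+\frac\theta{2\pi}q_m)q_m\bigr)\,\langle\tilde W_d^{(-q_e,-q_m)}(F\gamma)\rangle^p_{\beta,\theta}$; and $\langle\tilde W_d^{(-q_e,-q_m)}(F\gamma)\rangle^p_{\beta,\theta}=\langle\tilde W_d^{(q_e,q_m)}(F\gamma)\rangle^p_{\beta,\theta}$. -/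

import Mathlib

/-!
# Lattice Maxwell theory in the modified Villain formulation, with dyonic Wilson loops

The primal lattice `Λ` is the periodic hypercubic lattice `(ℤ/N)⁴`; the dual lattice is
`Λ̃ = Λ + ŝ/2` with `ŝ = 1̂ + 2̂ + 3̂ + 4̂`.  Directions are `0, 1, 2, 3 : Fin 4`.
-/

open MeasureTheory

noncomputable section

namespace LatticeMaxwell

/-! ### Lattices and sites -/

/-- The two lattices: the primal lattice `Λ` and the dual lattice `Λ̃ = Λ + ŝ/2`. -/
inductive Lattice where
  | primal
  | dual

/-- Passing to the dual lattice. (The dual of `Λ̃` is `Λ̃ + ŝ/2 = Λ`.) -/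
def Lattice.flip : Lattice → Lattice
  | .primal => .dual
  | .dual => .primal

/-- A site of a lattice. On the primal lattice the site with coordinates `c` is the point `c`,
on the dual lattice it is the point `c + ŝ/2`. -/
@[ext] structure Site (N : ℕ) (L : Lattice) where
  coord : Fin 4 → ZMod N

instance (N : ℕ) (L : Lattice) : DecidableEq (Site N L) := fun x y =>
  decidable_of_iff (x.coord = y.coord) (Site.ext_iff).symm

/-- Sites are described by their coordinates. -/
def Site.equivCoord (N : ℕ) (L : Lattice) : Site N L ≃ (Fin 4 → ZMod N) where
  toFun x := x.coord
  invFun c := ⟨c⟩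
  left_inv _ := rfl
  right_inv _ := rfl

instance (N : ℕ) [NeZero N] (L : Lattice) : Fintype (Site N L) :=
  Fintype.ofEquiv _ (Site.equivCoord N L).symm

/-- The translate `x + v` of a site by an integer vector. -/
def Site.shift {N : ℕ} {L : Lattice} (x : Site N L) (v : Fin 4 → ZMod N) : Site N L :=
  ⟨x.coord + v⟩

/-- The vector `∑_{μ ∈ S} μ̂`. In particular `vec {μ} = μ̂` and `vec univ = ŝ`. -/
def vec {N : ℕ} (S : Finset (Fin 4)) : Fin 4 → ZMod N := fun μ => if μ ∈ S then 1 else 0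

/-- The carry in the coordinates when `ŝ/2` is added to a site: the point `c + ŝ/2` of the dual
lattice has coordinates `c`, and `(c + ŝ/2) + ŝ/2` is the point `c + ŝ` of the primal lattice. -/
def halfCarry (N : ℕ) : Lattice → (Fin 4 → ZMod N)
  | .primal => 0
  | .dual => vec Finset.univ

/-- The map `F x = x + ŝ/2` from a lattice onto its dual lattice. -/
def Site.F {N : ℕ} {L : Lattice} : Site N L ≃ Site N L.flip where
  toFun x := ⟨x.coord + halfCarry N L⟩
  invFun y := ⟨y.coord - halfCarry N L⟩
  left_inv x := by ext; simp
  right_inv y := by ext; simp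

/-- The map `F̃ x = x - ŝ/2 = F (x - ŝ)`. -/
def Site.Ft {N : ℕ} {L : Lattice} (x : Site N L) : Site N L.flip :=
  Site.F (x.shift (-vec Finset.univ))

/-! ### Differential forms -/

/-- An `r`-cell `(x, μ₁ < ⋯ < μᵣ)`; the increasing sequence of directions is given by the set
of its terms. -/
abbrev Cell (N : ℕ) (L : Lattice) (r : ℕ) : Type :=
  Site N L × {S : Finset (Fin 4) // S.card = r}

/-- `K`-valued `r`-forms, given by their independent components `α_{x, μ₁ ⋯ μᵣ}`,
`μ₁ < ⋯ < μᵣ`. -/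
abbrev Form (N : ℕ) (L : Lattice) (r : ℕ) (K : Type) : Type := Cell N L r → K

/-- The sign `ε` of the permutation that sorts the sequence which lists first `S` in increasing
order and then `T` in increasing order (for disjoint `S` and `T`). -/
def shuffleSign (K : Type) [CommRing K] (S T : Finset (Fin 4)) : K :=
  (-1) ^ ((S ×ˢ T).filter fun ab => ab.2 < ab.1).card

section Forms

variable {N : ℕ} {L : Lattice} {r : ℕ} {K : Type} [CommRing K]

/-- The component `α_{x, μ₁ ⋯ μᵣ}` with `S = {μ₁ < ⋯ < μᵣ}` (zero if `S` does not have `r`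
elements). -/
def Form.coeff (α : Form N L r K) (x : Site N L) (S : Finset (Fin 4)) : K :=
  if h : S.card = r then α (x, ⟨S, h⟩) else 0

/-- The exterior derivative
`(dα)_{x, μ₁⋯μᵣ₊₁} = ∑ⱼ (-1)^{j+1} (α_{x+μ̂ⱼ, ⋯μ̊ⱼ⋯} - α_{x, ⋯μ̊ⱼ⋯})`. -/
def extDeriv (α : Form N L r K) : Form N L (r + 1) K := fun c =>
  ∑ μ ∈ c.2.1, shuffleSign K {μ} (c.2.1.erase μ) *
    (α.coeff (c.1.shift (vec {μ})) (c.2.1.erase μ) - α.coeff c.1 (c.2.1.erase μ))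

/-- The boundary operator
`(∂α)_{x, μ₁⋯μᵣ} = ∑_ν (α_{x, μ₁⋯μᵣν} - α_{x-ν̂, μ₁⋯μᵣν})`. -/
def bdry (α : Form N L (r + 1) K) : Form N L r K := fun c =>
  ∑ ν ∈ c.2.1ᶜ, shuffleSign K c.2.1 {ν} *
    (α.coeff c.1 (insert ν c.2.1) - α.coeff (c.1.shift (-vec {ν})) (insert ν c.2.1))

/-- The cup product. The antisymmetrized sum over all permutations, divided by `p! q!`, is the
sum over the ways to split the set of directions into a set `T` of `p` directions (for `α`) and
its complement (for `β`). -/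
def cup {p q : ℕ} (α : Form N L p K) (β : Form N L q K) : Form N L (p + q) K := fun c =>
  ∑ T ∈ c.2.1.powersetCard p, shuffleSign K T (c.2.1 \ T) *
    (α.coeff c.1 T * β.coeff (c.1.shift (vec T)) (c.2.1 \ T))

/-- The interior product `(ι_a α)_{x, μ₁⋯μᵣ} = α_{x, a μ₁⋯μᵣ}` (zero if `a` is one of the
`μᵢ`). -/
def interiorProd (a : Fin 4) (α : Form N L (r + 1) K) : Form N L r K := fun c =>
  shuffleSign K {a} c.2.1 * α.coeff c.1 (insert a c.2.1)

/-- The reflection `x ↦ (x₁, …, x_{a-1}, -x_a, …, -x₄)` of the sites, about the origin of the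
lattice under consideration. -/
def Site.reflect (a : Fin 4) (x : Site N L) : Site N L :=
  ⟨fun μ => if μ < a then x.coord μ else -x.coord μ⟩

/-- The parity transformation `P_a` of forms,
`(P_a α)_{x, μ₁⋯μᵣ} = (-1)^{#{i | a ≤ μᵢ}} α_{P_a x - ∑_{a ≤ μᵢ} μ̂ᵢ, μ₁⋯μᵣ}`. -/
def parity (a : Fin 4) (α : Form N L r K) : Form N L r K := fun c =>
  (-1) ^ (c.2.1.filter fun b => a ≤ b).card *
    α.coeff ((c.1.reflect a).shift (-vec (c.2.1.filter fun b => a ≤ b))) c.2.1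

/-- The higher cup product `∪₁` of a `(p+1)`-form and a `(q+1)`-form:
`(α ∪₁ β)_{x, μ₁⋯} = (-1)^{q+1} ∑ₐ (-1)^a P_{μₐ}(P_{μₐ} ι_{μₐ} α ∪ P_{μₐ} ι_{μₐ} β)_{x, ⋯μ̊ₐ⋯}`,
where `a = 1, 2, …` is the position of `μₐ` among the directions of the cell. -/
def cupOne {p q : ℕ} (α : Form N L (p + 1) K) (β : Form N L (q + 1) K) :
    Form N L (p + q + 1) K := fun c =>
  (-1) ^ (q + 1) * ∑ μ ∈ c.2.1, (-1) ^ ((c.2.1.filter fun b => b < μ).card + 1) *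
    (parity μ (cup (parity μ (interiorProd μ α)) (parity μ (interiorProd μ β)))).coeff c.1
      (c.2.1.erase μ)

variable [NeZero N]

/-- The sum `∑ₓ αₓ` of a `4`-form over the lattice. -/
def total (α : Form N L 4 K) : K := ∑ c, α c

/-- The inner product `α · β` of two `r`-forms. -/
def dot (α β : Form N L r K) : K := ∑ c, α c * β c

/-- The Pontryagin square `𝔓(n) = ∑ₓ (n ∪ n + n ∪₁ dn)`. -/
def pontryagin (n : Form N L 2 K) : K := total (cup n n) + total (cupOne n (extDeriv n))

end Forms

/-- The real form underlying an integer form. -/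
def Form.toReal {N : ℕ} {L : Lattice} {r : ℕ} (n : Form N L r ℤ) : Form N L r ℝ :=
  fun c => (n c : ℝ)

section Theory

variable {N : ℕ} [NeZero N] {L : Lattice}

/-- The projection `P_∂` of real `2`-forms onto `Im ∂⁽³⁾`, orthogonal for the inner product
`α · β`. -/
def projBdry (α : Form N L 2 ℝ) : Form N L 2 ℝ :=
  WithLp.ofLp ((Submodule.span ℝ (Set.range fun β : Form N L 3 ℝ =>
    (WithLp.toLp 2 (bdry β) : EuclideanSpace ℝ (Cell N L 2)))).starProjection (WithLp.toLp 2 α))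

/-- `u = ∑ₓ P_∂ l ∪₁ d P_∂ l`. -/
def uOf (l : Form N L 2 ℤ) : ℝ :=
  total (cupOne (projBdry l.toReal) (extDeriv (projBdry l.toReal)))

/-- `v = 𝔓(l)`. -/
def vOf (l : Form N L 2 ℤ) : ℤ := pontryagin l

/-! ### Action, measures and partition function -/

/-- The field strength `Fᵉ = dAᵉ + 2π n`. -/
def fieldStrength (A : Form N L 1 ℝ) (n : Form N L 2 ℤ) : Form N L 2 ℝ :=
  fun c => extDeriv A c + 2 * Real.pi * n c

/-- `Q₀ = (1/8π²) ∑ₓ F ∪ F`. -/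
def chargeZero (F : Form N L 2 ℝ) : ℝ := 1 / (8 * Real.pi ^ 2) * total (cup F F)

/-- The topological charge `Q = ∑ₓ ((1/8π²) Fᵉ ∪ Fᵉ + (1/4π) Fᵉ ∪₁ dn)`. -/
def charge (A : Form N L 1 ℝ) (n : Form N L 2 ℤ) : ℝ :=
  1 / (8 * Real.pi ^ 2) * total (cup (fieldStrength A n) (fieldStrength A n)) +
    1 / (4 * Real.pi) * total (cupOne (fieldStrength A n) (extDeriv n.toReal))

/-- The topological charge `Q̃ = ∑ₓ ((1/8π²) Fᵉ ∪ Fᵉ - (1/4π) Fᵉ ∪₁ dn)`. -/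
def chargeTilde (A : Form N L 1 ℝ) (n : Form N L 2 ℤ) : ℝ :=
  1 / (8 * Real.pi ^ 2) * total (cup (fieldStrength A n) (fieldStrength A n)) -
    1 / (4 * Real.pi) * total (cupOne (fieldStrength A n) (extDeriv n.toReal))

/-- The measure `DA = ∏ dA_c / 2π` on compact `r`-forms, each component in `[-π, π)`. -/
def gaugeMeasure (N : ℕ) [NeZero N] (L : Lattice) (r : ℕ) : Measure (Form N L r ℝ) :=
  Measure.pi fun _ => (2 * NNReal.pi)⁻¹ • volume.restrict (Set.Ico (-Real.pi) Real.pi)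

open Classical in
/-- The partition function
`Z[β, θ] = ∫ DAᵉ ∑ₙ exp(-(β/2)(Fᵉ)² - iθ Q₀[Fᵉ]) ∏ δ(dn)`. -/
def partitionFunction (N : ℕ) [NeZero N] (L : Lattice) (β θ : ℝ) : ℂ :=
  ∫ A, ∑' n : Form N L 2 ℤ,
    (if extDeriv n = 0 then
      Complex.exp (-(β / 2 : ℝ) * (dot (fieldStrength A n) (fieldStrength A n) : ℝ)
        - Complex.I * θ * (chargeZero (fieldStrength A n) : ℝ))
    else 0) ∂(gaugeMeasure N L 1)

/-- The weight `exp(-(β/2)(Fᵉ)² - iθ Q + (i/2π) ∂Aᵐ·Fᵉ - ipπ 𝔓(n))`, where `Q` is the value of the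
topological charge that is used. -/
def boltzmann (β θ : ℝ) (p : ℤ) (Q : ℝ) (Ae : Form N L 1 ℝ) (Am : Form N L 3 ℝ)
    (n : Form N L 2 ℤ) : ℂ :=
  Complex.exp (-(β / 2 : ℝ) * (dot (fieldStrength Ae n) (fieldStrength Ae n) : ℝ)
    - Complex.I * θ * Q
    + Complex.I / (2 * Real.pi) * (dot (bdry Am) (fieldStrength Ae n) : ℝ)
    - Complex.I * p * Real.pi * (pontryagin n : ℤ))

/-! ### Wilson loops -/

/-- An oriented link: `(x, +μ)` from `x` to `x + μ̂`, or (`positive = false`) `(x, -μ)` from `x`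
to `x - μ̂`. -/
structure OrientedLink (N : ℕ) (L : Lattice) where
  site : Site N L
  dir : Fin 4
  positive : Bool
deriving DecidableEq

/-- A contour, given by the oriented links it consists of. -/
abbrev Contour (N : ℕ) (L : Lattice) : Type := List (OrientedLink N L)

/-- The image `F(γ)` of a contour under `F x = x + ŝ/2`. -/
def Contour.F (γ : Contour N L) : Contour N L.flip :=
  γ.map fun b => ⟨b.site.F, b.dir, b.positive⟩

/-- The image `F̃(γ)` of a contour under `F̃ x = x - ŝ/2`. -/
def Contour.Ft (γ : Contour N L) : Contour N L.flip :=
  γ.map fun b => ⟨b.site.Ft, b.dir, b.positive⟩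

/-- The tangent `γ̇`: the number of times that `γ` runs through the link from `x` to `x + μ̂` in
the positive direction minus the number of times in the negative direction. -/
def Contour.tangent (γ : Contour N L) (x : Site N L) (μ : Fin 4) : ℤ :=
  (γ.count ⟨x, μ, true⟩ : ℤ) - (γ.count ⟨x.shift (vec {μ}), μ, false⟩ : ℤ)

/-- The value of a gauge field on an oriented link; `A_{x,-μ} = -A_{x-μ̂,μ}`. -/
def linkValue (A : Form N L 1 ℝ) (b : OrientedLink N L) : ℝ :=
  if b.positive then A.coeff b.site {b.dir} else -A.coeff (b.site.shift (-vec {b.dir})) {b.dir}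

/-- The Wilson loop `∏_{l ∈ γ} exp(i q A_l)` of charge `q`. -/
def wilson (q : ℤ) (A : Form N L 1 ℝ) (γ : Contour N L) : ℂ :=
  (γ.map fun b => Complex.exp (Complex.I * q * (linkValue A b : ℝ))).prod

/-- The magnetic gauge field `Ãᵐ` on the links of the dual lattice, which is determined by
`Aᵐ_{x, μνρ} = ∑_σ ε_{μνρσ} Ãᵐ_{F(x)-σ̂, σ}`. -/
def magneticField (Am : Form N L 3 ℝ) : Form N L.flip 1 ℝ := fun c =>
  ∑ σ ∈ c.2.1, shuffleSign ℝ {σ}ᶜ {σ} * Am.coeff ((Site.F.symm c.1).shift (vec {σ})) {σ}ᶜ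

/-- The dyonic Wilson loop `W_d(γ) = W_e(γ) W_m(F(γ))`. -/
def dyonicLoop (qe qm : ℤ) (γ : Contour N L) (Ae : Form N L 1 ℝ) (Am : Form N L 3 ℝ) : ℂ :=
  wilson qe Ae γ * wilson qm (magneticField Am) γ.F

/-- The dual dyonic Wilson loop `W̃_d(γ) = W_e(γ) W_m(F̃(γ))`. -/
def dualDyonicLoop (qe qm : ℤ) (γ : Contour N L) (Ae : Form N L 1 ℝ) (Am : Form N L 3 ℝ) : ℂ :=
  wilson qe Ae γ * wilson qm (magneticField Am) γ.Ft

/-- The expectation value `⟨W_d^{(q_e,q_m)}(γ)⟩_{β,θ}^p`, in the theory with the topological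
charge `Q` on the lattice on which `γ` lies. -/
def evDyonic (β θ : ℝ) (p qe qm : ℤ) (γ : Contour N L) : ℂ :=
  (∫ Ae, ∫ Am, ∑' n : Form N L 2 ℤ,
    boltzmann β θ p (charge Ae n) Ae Am n * dyonicLoop qe qm γ Ae Am
      ∂(gaugeMeasure N L 3) ∂(gaugeMeasure N L 1)) / partitionFunction N L β θ

/-- The expectation value `⟨W̃_d^{(q_e,q_m)}(γ)⟩_{β,θ}^p`, in the theory with the topological
charge `Q̃` on the lattice on which `γ` lies. -/
def evDualDyonic (β θ : ℝ) (p qe qm : ℤ) (γ : Contour N L) : ℂ :=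
  (∫ Ae, ∫ Am, ∑' n : Form N L 2 ℤ,
    boltzmann β θ p (chargeTilde Ae n) Ae Am n * dualDyonicLoop qe qm γ Ae Am
      ∂(gaugeMeasure N L 3) ∂(gaugeMeasure N L 1)) / partitionFunction N L β θ

/-- `l` solves the monopole equation `∑_{ν<ρ<σ} ε_{μνρσ} (dl)_{x+μ̂, νρσ} = -γ̇_{x,μ}` for the
contour `γ`, i.e. `l` is dual to a surface with boundary `γ`. -/
def IsSeifert (l : Form N L 2 ℤ) (γ : Contour N L) : Prop :=
  ∀ (x : Site N L) (μ : Fin 4),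
    shuffleSign ℤ {μ} {μ}ᶜ * (extDeriv l).coeff (x.shift (vec {μ})) {μ}ᶜ = -γ.tangent x μ

/-! ### The transformations `𝒫` (Poisson summation) and `𝒯` -/

end Theory

/-- An expression `c · ⟨W_d^{(q_e,q_m)}(γ)⟩_{β,θ}^p` (`framed = true`) or
`c · ⟨W̃_d^{(q_e,q_m)}(Fγ)⟩_{β,θ}^p` (`framed = false`), for fixed `γ` and `p`. -/
@[ext] structure LoopExpr where
  framed : Bool
  qe : ℤ
  qm : ℤ
  β : ℝ
  θ : ℝ
  c : ℂ

/-- The value of an expression; `W̃_d(Fγ)` lives in the theory on the dual lattice. -/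
def LoopExpr.value {N : ℕ} [NeZero N] (γ : Contour N .primal) (p : ℤ) (s : LoopExpr) : ℂ :=
  if s.framed then s.c * evDyonic s.β s.θ p s.qe s.qm γ
  else s.c * evDualDyonic s.β s.θ p s.qe s.qm γ.F

/-- `β̃ = β / ((2πβ)² + (θ/2π)²)`. -/
def dualBeta (β θ : ℝ) : ℝ := β / ((2 * Real.pi * β) ^ 2 + (θ / (2 * Real.pi)) ^ 2)

/-- `θ̃ = -θ / ((2πβ)² + (θ/2π)²)`. -/
def dualTheta (β θ : ℝ) : ℝ := -θ / ((2 * Real.pi * β) ^ 2 + (θ / (2 * Real.pi)) ^ 2)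

/-- The rewriting `𝒫` by Poisson summation: it exchanges `W_d(γ)` and `W̃_d(Fγ)`, replaces
`(q_e, q_m)` by `(q_m, -q_e)` and `(β, θ)` by `(β̃, θ̃)`, and produces the factor
`exp(∓iθu q_m²/2 ∓ iθ̃u q_e²/2 - ipπv(q_m² + q_e²))`, with `-` for `W_d` and `+` for `W̃_d`. -/
def LoopExpr.poisson (u : ℝ) (v p : ℤ) (s : LoopExpr) : LoopExpr where
  framed := !s.framed
  qe := s.qm
  qm := -s.qe
  β := dualBeta s.β s.θ
  θ := dualTheta s.β s.θ
  c := s.c * Complex.exp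
    ((if s.framed then -1 else 1) *
        (Complex.I * s.θ * u * s.qm ^ 2 / 2 + Complex.I * dualTheta s.β s.θ * u * s.qe ^ 2 / 2)
      - Complex.I * p * Real.pi * v * (s.qm ^ 2 + s.qe ^ 2))

/-- The rewriting `𝒯`: it replaces `θ` by `θ + 2π` and `(q_e, q_m)` by `(q_e - q_m, q_m)`, and
produces the sign `(-1)^{q_m² v}`. -/
def LoopExpr.shiftTheta (v : ℤ) (s : LoopExpr) : LoopExpr where
  framed := s.framed
  qe := s.qe - s.qm
  qm := s.qm
  β := s.β
  θ := s.θ + 2 * Real.pi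
  c := s.c * (-1) ^ (s.qm ^ 2 * v)

end LatticeMaxwell

end

open LatticeMaxwell

/-! Both expectation values can be evaluated in closed form (`loopFormula`), and the claims then
become identities of that formula.

Integrating over the magnetic field imposes dn = q_m dl (`integral_magnetic`), and Stokes' theorem
turns the electric loop into exp(-i q_e ∑ dA ∪ l), with the two factors interchanged for the
opposite framing. Split l into P_∂ l and a closed rest. Then F = 2π q_m P_∂ l + f with f closed. By
Hodge theory f is a constant form with fluxes 2π(m + q_m λ), where m is integral and λ is the flux
of l, plus an exact form. The ∪₁ term in Q or Q̃ selects exactly the order of factors that the loop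
uses (`framedCharge_field`). Hence, up to integer multiples of 2πi in the exponent, the weight
factorizes (`electricWeight_monopoleConfig`) into a prefactor, a term of a theta series in m, and a
Gaussian in the exact part with an imaginary source of strength q_e + θ q_m/2π. The source is itself
exact and has the norm of P_∂ l. The Gaussian integral is therefore explicit
(`integral_gaussWeight_imag`), up to a constant that cancels against Z (`electricIntegral_eq`).

With τ = θ/2π + 2πiβ the resulting real exponent is -|P_∂ l|² |q_e + τ q_m|²/2β, which is invariant
under the modular group; the theta series transforms by Poisson summation and by a termwise shift
(`thetaSix_duality`, `thetaSix_shift`). The framing enters only through the prefactor: through the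
sign of u, and through the order in the pairing of P_∂ l with the closed part of l. The two orders
differ by u modulo integers, because ∑ l ∪₁ dl is an integer (`exists_int_crossPairing`); this is
part (1), `loopFormula_false`. The relation of v to u, the cross pairing and λ∧λ (`vOf_eq`) matches
the remaining phases under 𝒫 and 𝒯.

The contour Fγ carries the opposite framing with respect to the translated form
(`IsSeifert.bounds_F`), and all data are translation invariant, so both loops are expressed through
the same l. Finally, 𝒫 followed by 𝒯 acts as τ ↦ 1 - 1/τ, which has order three; its cube is -1 on
the charges, and the odd number of 𝒫's flips the framing. -/

noncomputable section
set_option linter.unusedSimpArgs false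
set_option linter.unusedSectionVars false
namespace LatticeMaxwell

/-! ### Shifts and components -/

section Components

variable {N : ℕ} {L : Lattice}

/-- The integer vector `(a, b, c, d)`. -/
def svec (a b c d : ℤ) : Fin 4 → ZMod N := ![(a : ZMod N), b, c, d]

@[simp] lemma svec_add (a b c d a' b' c' d' : ℤ) :
    (svec a b c d : Fin 4 → ZMod N) + svec a' b' c' d' =
      svec (a + a') (b + b') (c + c') (d + d') := by
  funext i; fin_cases i <;> simp [svec]

@[simp] lemma neg_svec (a b c d : ℤ) :
    -(svec a b c d : Fin 4 → ZMod N) = svec (-a) (-b) (-c) (-d) := by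
  funext i; fin_cases i <;> simp [svec]

lemma svec_zero : (svec 0 0 0 0 : Fin 4 → ZMod N) = 0 := by
  funext i; fin_cases i <;> simp [svec]

lemma vec_eq_svec (S : Finset (Fin 4)) : (vec S : Fin 4 → ZMod N) =
    svec (if 0 ∈ S then 1 else 0) (if 1 ∈ S then 1 else 0) (if 2 ∈ S then 1 else 0)
      (if 3 ∈ S then 1 else 0) := by
  funext i; fin_cases i <;> simp [svec, vec]

@[simp] lemma Site.shift_shift (x : Site N L) (v w : Fin 4 → ZMod N) :
    (x.shift v).shift w = x.shift (v + w) := by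
  ext; simp [Site.shift, add_assoc]

@[simp] lemma Site.shift_zero (x : Site N L) : x.shift 0 = x := by
  ext; simp [Site.shift]

/-- Translation by a vector as a permutation of the sites. -/
def Site.shiftEquiv (v : Fin 4 → ZMod N) : Site N L ≃ Site N L where
  toFun x := x.shift v
  invFun y := Site.shift y (-v)
  left_inv x := by simp
  right_inv x := by simp

lemma sum_shift [NeZero N] {M : Type*} [AddCommMonoid M] (g : Site N L → M)
    (v : Fin 4 → ZMod N) : ∑ x : Site N L, g (x.shift v) = ∑ x, g x :=
  (Site.shiftEquiv (L := L) v).sum_comp g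

variable {r : ℕ} {K : Type} [CommRing K]

lemma Form.coeff_of_card (α : Form N L r K) (x : Site N L) (S : Finset (Fin 4))
    (h : S.card = r) : α.coeff x S = α (x, ⟨S, h⟩) := dif_pos h

lemma Form.coeff_of_card_ne (α : Form N L r K) (x : Site N L) (S : Finset (Fin 4))
    (h : S.card ≠ r) : α.coeff x S = 0 := dif_neg h

lemma Form.apply_eq_coeff (α : Form N L r K) (c : Cell N L r) : α c = α.coeff c.1 c.2.1 :=
  (α.coeff_of_card c.1 c.2.1 c.2.2).symm

lemma Form.ext_coeff {α β : Form N L r K}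
    (h : ∀ x S, S.card = r → α.coeff x S = β.coeff x S) : α = β := by
  funext c
  rw [α.apply_eq_coeff, β.apply_eq_coeff, h _ _ c.2.2]

@[simp] lemma Form.coeff_add (α β : Form N L r K) (x : Site N L) (S : Finset (Fin 4)) :
    (α + β : Form N L r K).coeff x S = α.coeff x S + β.coeff x S := by
  unfold Form.coeff; split_ifs <;> simp

@[simp] lemma Form.coeff_sub (α β : Form N L r K) (x : Site N L) (S : Finset (Fin 4)) :
    (α - β : Form N L r K).coeff x S = α.coeff x S - β.coeff x S := by
  unfold Form.coeff; split_ifs <;> simp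

@[simp] lemma Form.coeff_smul (a : K) (α : Form N L r K) (x : Site N L) (S : Finset (Fin 4)) :
    (a • α : Form N L r K).coeff x S = a * α.coeff x S := by
  unfold Form.coeff; split_ifs <;> simp

@[simp] lemma Form.coeff_zero (x : Site N L) (S : Finset (Fin 4)) :
    (0 : Form N L r K).coeff x S = 0 := by
  unfold Form.coeff; split_ifs <;> simp

lemma Form.coeff_toReal (n : Form N L r ℤ) (x : Site N L) (S : Finset (Fin 4)) :
    n.toReal.coeff x S = (n.coeff x S : ℝ) := by
  unfold Form.coeff Form.toReal; split_ifs <;> simp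

lemma coeff_extDeriv (α : Form N L r K) (x : Site N L) (S : Finset (Fin 4))
    (h : S.card = r + 1) : (extDeriv α).coeff x S =
      ∑ μ ∈ S, shuffleSign K {μ} (S.erase μ) *
        (α.coeff (x.shift (vec {μ})) (S.erase μ) - α.coeff x (S.erase μ)) := by
  rw [Form.coeff_of_card _ _ _ h]; rfl

lemma coeff_bdry (α : Form N L (r + 1) K) (x : Site N L) (S : Finset (Fin 4))
    (h : S.card = r) : (bdry α).coeff x S =
      ∑ ν ∈ Sᶜ, shuffleSign K S {ν} *
        (α.coeff x (insert ν S) - α.coeff (x.shift (-vec {ν})) (insert ν S)) := by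
  rw [Form.coeff_of_card _ _ _ h]; rfl

lemma coeff_cup {p q : ℕ} (α : Form N L p K) (β : Form N L q K) (x : Site N L)
    (S : Finset (Fin 4)) (h : S.card = p + q) : (cup α β).coeff x S =
      ∑ T ∈ S.powersetCard p, shuffleSign K T (S \ T) *
        (α.coeff x T * β.coeff (x.shift (vec T)) (S \ T)) := by
  rw [Form.coeff_of_card _ _ _ h]; rfl

lemma coeff_interiorProd (a : Fin 4) (α : Form N L (r + 1) K) (x : Site N L)
    (S : Finset (Fin 4)) (h : S.card = r) : (interiorProd a α).coeff x S =
      shuffleSign K {a} S * α.coeff x (insert a S) := by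
  rw [Form.coeff_of_card _ _ _ h]; rfl

lemma coeff_parity (a : Fin 4) (α : Form N L r K) (x : Site N L) (S : Finset (Fin 4))
    (h : S.card = r) : (parity a α).coeff x S =
      (-1) ^ (S.filter fun b => a ≤ b).card *
        α.coeff ((x.reflect a).shift (-vec (S.filter fun b => a ≤ b))) S := by
  rw [Form.coeff_of_card _ _ _ h]; rfl

/-- The reflections in the definition of `∪₁` combine to translations. -/
lemma coeff_parity_cup_parity {p q : ℕ} (a : Fin 4) (α : Form N L p K) (β : Form N L q K)
    (x : Site N L) (S : Finset (Fin 4)) (h : S.card = p + q) :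
    (parity a (cup (parity a α) (parity a β))).coeff x S =
      ∑ T ∈ S.powersetCard p, shuffleSign K T (S \ T) *
        (α.coeff (x.shift (vec ((S \ T).filter fun b => a ≤ b))) T *
          β.coeff (x.shift (vec (T.filter fun b => b < a))) (S \ T)) := by
  rw [coeff_parity _ _ _ _ h, coeff_cup _ _ _ _ h, Finset.mul_sum]
  refine Finset.sum_congr rfl fun T hT => ?_
  obtain ⟨hTS, hTp⟩ := Finset.mem_powersetCard.mp hT
  have hq : (S \ T).card = q := by rw [Finset.card_sdiff_of_subset hTS]; omega
  rw [coeff_parity _ _ _ _ hTp, coeff_parity _ _ _ _ hq]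
  -- Reflecting twice restores the coordinates and turns the translation along `S` around; the
  -- parity of the inner factor then removes its part along `T`.
  have h1 : (((x.reflect a).shift (-vec (S.filter fun b => a ≤ b))).reflect a).shift
      (-vec (T.filter fun b => a ≤ b)) = x.shift (vec ((S \ T).filter fun b => a ≤ b)) := by
    ext μ
    have hT := @hTS μ
    rcases lt_or_ge μ a with h1 | h1 <;> by_cases h2 : μ ∈ T <;> by_cases h3 : μ ∈ S <;>
      first
      | exact absurd (hT h2) h3
      | simp [Site.shift, Site.reflect, vec, not_le.mpr, not_lt.mpr, h1, h2, h3, add_comm]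
  have h2 : ((((x.reflect a).shift (-vec (S.filter fun b => a ≤ b))).shift (vec T)).reflect a).shift
      (-vec ((S \ T).filter fun b => a ≤ b)) = x.shift (vec (T.filter fun b => b < a)) := by
    ext μ
    have hT := @hTS μ
    rcases lt_or_ge μ a with h1 | h1 <;> by_cases h2 : μ ∈ T <;> by_cases h3 : μ ∈ S <;>
      first
      | exact absurd (hT h2) h3
      | simp [Site.shift, Site.reflect, vec, not_le.mpr, not_lt.mpr, h1, h2, h3, add_comm]
  rw [h1, h2]
  have h3 : (S.filter fun b => a ≤ b).card =
      (T.filter fun b => a ≤ b).card + ((S \ T).filter fun b => a ≤ b).card := by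
    rw [← Finset.card_union_of_disjoint, ← Finset.filter_union, Finset.union_sdiff_of_subset hTS]
    exact Finset.disjoint_filter_filter Finset.disjoint_sdiff
  rw [h3, pow_add]
  -- Each reflection sign occurs once outside and once in a factor, so it squares away.
  have e1 : ((-1 : K) ^ (T.filter fun b => a ≤ b).card) ^ 2 = 1 := by rw [← pow_mul]; simp
  have e2 : ((-1 : K) ^ ((S \ T).filter fun b => a ≤ b).card) ^ 2 = 1 := by
    rw [← pow_mul]; simp
  generalize (-1 : K) ^ (T.filter fun b => a ≤ b).card = s at *
  generalize (-1 : K) ^ ((S \ T).filter fun b => a ≤ b).card = t at *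
  generalize α.coeff _ _ = A
  generalize β.coeff _ _ = B
  linear_combination (shuffleSign K T (S \ T) * A * B) * (t ^ 2 * e1 + e2)

/-- With the reflections gone, only relative translations of the two factors remain. This makes `∪₁`
translation invariant and its sums expressible through correlations. -/
lemma coeff_cupOne {p q : ℕ} (α : Form N L (p + 1) K) (β : Form N L (q + 1) K) (x : Site N L)
    (S : Finset (Fin 4)) (h : S.card = p + q + 1) : (cupOne α β).coeff x S =
      (-1) ^ (q + 1) * ∑ μ ∈ S, (-1) ^ ((S.filter fun b => b < μ).card + 1) *
        ∑ T ∈ (S.erase μ).powersetCard p, shuffleSign K T (S.erase μ \ T) *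
          ((shuffleSign K {μ} T *
            α.coeff (x.shift (vec ((S.erase μ \ T).filter fun b => μ ≤ b))) (insert μ T)) *
          (shuffleSign K {μ} (S.erase μ \ T) *
            β.coeff (x.shift (vec (T.filter fun b => b < μ))) (insert μ (S.erase μ \ T)))) := by
  rw [Form.coeff_of_card _ _ _ h]
  simp only [cupOne]
  congr 1
  refine Finset.sum_congr rfl fun μ hμ => ?_
  have hc : (S.erase μ).card = p + q := by rw [Finset.card_erase_of_mem hμ]; omega
  rw [coeff_parity_cup_parity _ _ _ _ _ hc]
  congr 1
  refine Finset.sum_congr rfl fun T hT => ?_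
  obtain ⟨hTS, hTp⟩ := Finset.mem_powersetCard.mp hT
  have hq : (S.erase μ \ T).card = q := by rw [Finset.card_sdiff_of_subset hTS]; omega
  rw [coeff_interiorProd _ _ _ _ hTp, coeff_interiorProd _ _ _ _ hq]

variable [NeZero N]

lemma sum_cell {M : Type*} [AddCommMonoid M] (g : Site N L → Finset (Fin 4) → M) :
    ∑ c : Cell N L r, g c.1 c.2.1 = ∑ x, ∑ S ∈ Finset.powersetCard r Finset.univ, g x S := by
  rw [Fintype.sum_prod_type]
  refine Finset.sum_congr rfl fun x _ => ?_
  exact (Finset.sum_subtype _ (fun S => by simp [Finset.mem_powersetCard]) (g x)).symm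

lemma total_eq (α : Form N L 4 K) : total α = ∑ x, α.coeff x Finset.univ := by
  have h := sum_cell (r := 4) (fun (x : Site N L) S => α.coeff x S)
  simp only [total, Form.apply_eq_coeff α, h]
  refine Finset.sum_congr rfl fun x _ => ?_
  have : Finset.powersetCard 4 (Finset.univ : Finset (Fin 4)) = {Finset.univ} := by decide
  simp [this]

lemma dot_eq (α β : Form N L r K) : dot α β =
    ∑ x, ∑ S ∈ Finset.powersetCard r Finset.univ, α.coeff x S * β.coeff x S := by
  rw [← sum_cell (r := r) (fun (x : Site N L) S => α.coeff x S * β.coeff x S)]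
  simp only [dot, Form.apply_eq_coeff]

end Components
/-! ### Explicit components -/

/-- The set of directions with the given indicator function. -/
def cset (a b c d : Bool) : Finset (Fin 4) :=
  Finset.univ.filter fun i => ![a, b, c, d] i

-- Coding subsets of the four directions by booleans lets `simp` evaluate all set operations, shifts
-- and signs in the explicit computations below.
@[simp] lemma mem_cset_zero (a b c d : Bool) : 0 ∈ cset a b c d ↔ a := by simp [cset]
@[simp] lemma mem_cset_one (a b c d : Bool) : 1 ∈ cset a b c d ↔ b := by simp [cset]
@[simp] lemma mem_cset_two (a b c d : Bool) : 2 ∈ cset a b c d ↔ c := by simp [cset]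
@[simp] lemma mem_cset_three (a b c d : Bool) : 3 ∈ cset a b c d ↔ d := by simp [cset]

lemma univ_eq_cset : (Finset.univ : Finset (Fin 4)) = cset true true true true := by decide
@[simp] lemma singleton_zero_eq : ({0} : Finset (Fin 4)) = cset true false false false := by decide
@[simp] lemma singleton_one_eq : ({1} : Finset (Fin 4)) = cset false true false false := by decide
@[simp] lemma singleton_two_eq : ({2} : Finset (Fin 4)) = cset false false true false := by decide
@[simp] lemma singleton_three_eq : ({3} : Finset (Fin 4)) = cset false false false true := by
  decide
@[simp] lemma insert_zero_cset : ∀ a b c d, insert 0 (cset a b c d) = cset true b c d := by decide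
@[simp] lemma insert_one_cset : ∀ a b c d, insert 1 (cset a b c d) = cset a true c d := by decide
@[simp] lemma insert_two_cset : ∀ a b c d, insert 2 (cset a b c d) = cset a b true d := by decide
@[simp] lemma insert_three_cset : ∀ a b c d, insert 3 (cset a b c d) = cset a b c true := by decide
@[simp] lemma erase_zero_cset : ∀ a b c d, (cset a b c d).erase 0 = cset false b c d := by decide
@[simp] lemma erase_one_cset : ∀ a b c d, (cset a b c d).erase 1 = cset a false c d := by decide
@[simp] lemma erase_two_cset : ∀ a b c d, (cset a b c d).erase 2 = cset a b false d := by decide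
@[simp] lemma erase_three_cset : ∀ a b c d, (cset a b c d).erase 3 = cset a b c false := by decide
@[simp] lemma compl_cset : ∀ a b c d, (cset a b c d)ᶜ = cset (!a) (!b) (!c) (!d) := by decide

@[simp] lemma sdiff_cset (a b c d a' b' c' d' : Bool) : cset a b c d \ cset a' b' c' d' =
    cset (a && !a') (b && !b') (c && !c') (d && !d') := by
  ext i; fin_cases i <;> simp [cset]

@[simp] lemma filter_lt_zero_cset : ∀ a b c d, (cset a b c d).filter (fun i => i < 0) =
    cset false false false false := by decide
@[simp] lemma filter_lt_one_cset : ∀ a b c d, (cset a b c d).filter (fun i => i < 1) =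
    cset a false false false := by decide
@[simp] lemma filter_lt_two_cset : ∀ a b c d, (cset a b c d).filter (fun i => i < 2) =
    cset a b false false := by decide
@[simp] lemma filter_lt_three_cset : ∀ a b c d, (cset a b c d).filter (fun i => i < 3) =
    cset a b c false := by decide
@[simp] lemma filter_zero_le_cset : ∀ a b c d, (cset a b c d).filter (fun i => 0 ≤ i) =
    cset a b c d := by decide
@[simp] lemma filter_one_le_cset : ∀ a b c d, (cset a b c d).filter (fun i => 1 ≤ i) =
    cset false b c d := by decide
@[simp] lemma filter_two_le_cset : ∀ a b c d, (cset a b c d).filter (fun i => 2 ≤ i) =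
    cset false false c d := by decide
@[simp] lemma filter_three_le_cset : ∀ a b c d, (cset a b c d).filter (fun i => 3 ≤ i) =
    cset false false false d := by decide

lemma card_cset : ∀ a b c d,
    (cset a b c d).card = a.toNat + b.toNat + c.toNat + d.toNat := by decide

lemma sum_cset {M : Type*} [AddCommMonoid M] (g : Fin 4 → M) (a b c d : Bool) :
    ∑ i ∈ cset a b c d, g i = (if a then g 0 else 0) + (if b then g 1 else 0) +
      (if c then g 2 else 0) + (if d then g 3 else 0) := by
  cases a <;> cases b <;> cases c <;> cases d <;>
    simp [cset, Finset.sum_filter, Fin.sum_univ_four]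

lemma sum_powersetCard_one_cset {M : Type*} [AddCommMonoid M] (g : Finset (Fin 4) → M)
    (a b c d : Bool) : ∑ T ∈ (cset a b c d).powersetCard 1, g T =
      (if a then g (cset true false false false) else 0) +
      (if b then g (cset false true false false) else 0) +
      (if c then g (cset false false true false) else 0) +
      (if d then g (cset false false false true) else 0) := by
  rw [Finset.powersetCard_one, Finset.sum_map, sum_cset]
  simp

lemma sum_powersetCard_two_cset {M : Type*} [AddCommMonoid M] (g : Finset (Fin 4) → M)
    (a b c d : Bool) : ∑ T ∈ (cset a b c d).powersetCard 2, g T =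
      (if a && b then g (cset true true false false) else 0) +
      (if a && c then g (cset true false true false) else 0) +
      (if a && d then g (cset true false false true) else 0) +
      (if b && c then g (cset false true true false) else 0) +
      (if b && d then g (cset false true false true) else 0) +
      (if c && d then g (cset false false true true) else 0) := by
  have h : ∀ a b c d, (cset a b c d).powersetCard 2 =
      ({cset true true false false, cset true false true false, cset true false false true,
        cset false true true false, cset false true false true, cset false false true true} :
        Finset (Finset (Fin 4))).filter (· ⊆ cset a b c d) := by decide
  rw [h, Finset.sum_filter]
  iterate 5 rw [Finset.sum_insert (by decide)]
  rw [Finset.sum_singleton]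
  revert a b c d
  have h2 : ∀ a b c d a' b' c' d' : Bool, cset a b c d ⊆ cset a' b' c' d' ↔
      (a → a') ∧ (b → b') ∧ (c → c') ∧ (d → d') := by decide
  intro a b c d
  simp [h2, add_assoc]

lemma sum_powersetCard_three_cset {M : Type*} [AddCommMonoid M] (g : Finset (Fin 4) → M) :
    ∑ T ∈ (cset true true true true).powersetCard 3, g T =
      g (cset true true true false) + g (cset true true false true) +
      g (cset true false true true) + g (cset false true true true) := by
  have h : (cset true true true true).powersetCard 3 =
      {cset true true true false, cset true true false true, cset true false true true,
        cset false true true true} := by decide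
  rw [h]
  iterate 3 rw [Finset.sum_insert (by decide)]
  rw [Finset.sum_singleton]
  simp [add_assoc]

lemma shuffleSign_cset (K : Type) [CommRing K] : ∀ a b c d a' b' c' d' : Bool,
    shuffleSign K (cset a b c d) (cset a' b' c' d') =
      (-1) ^ (b.toNat * a'.toNat + c.toNat * (a'.toNat + b'.toNat) +
        d.toNat * (a'.toNat + b'.toNat + c'.toNat)) := by
  intro a b c d a' b' c' d'
  unfold shuffleSign
  congr 1
  revert a b c d a' b' c' d'
  decide

section

variable {N : ℕ} {L : Lattice} {r : ℕ} {K : Type} [CommRing K]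

lemma vec_cset (a b c d : Bool) : (vec (cset a b c d) : Fin 4 → ZMod N) =
    svec (if a then 1 else 0) (if b then 1 else 0) (if c then 1 else 0) (if d then 1 else 0) := by
  simp [vec_eq_svec]

variable [NeZero N]

/-- The cast along `h` is needed only for variable degrees; for numerals `h` is `rfl` and the cast
disappears. -/
lemma total_cup_eq {p q : ℕ} (h : p + q = 4) (α : Form N L p K) (β : Form N L q K) :
    total (h ▸ cup α β : Form N L 4 K) = ∑ x, ∑ T ∈ (cset true true true true).powersetCard p,
      shuffleSign K T (cset true true true true \ T) *
        (α.coeff x T * β.coeff (x.shift (vec T)) (cset true true true true \ T)) := by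
  have key : ∀ (k : ℕ) (hk : k = 4) (ω : Form N L k K),
      total (hk ▸ ω : Form N L 4 K) = ∑ x, ω.coeff x (cset true true true true) := by
    rintro k rfl ω
    rw [total_eq, univ_eq_cset]
  rw [key]
  exact Finset.sum_congr rfl fun x _ => coeff_cup α β x _ (by simp [card_cset, h])

lemma total_cupOne_eq {p q : ℕ} (h : p + q + 1 = 4) (α : Form N L (p + 1) K)
    (β : Form N L (q + 1) K) : total (h ▸ cupOne α β : Form N L 4 K) =
      ∑ x : Site N L, (-1) ^ (q + 1) * ∑ μ ∈ cset true true true true,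
        (-1) ^ (((cset true true true true).filter fun b => b < μ).card + 1) *
        ∑ T ∈ ((cset true true true true).erase μ).powersetCard p,
          shuffleSign K T ((cset true true true true).erase μ \ T) *
          ((shuffleSign K {μ} T * α.coeff (x.shift (vec
            (((cset true true true true).erase μ \ T).filter fun b => μ ≤ b))) (insert μ T)) *
          (shuffleSign K {μ} ((cset true true true true).erase μ \ T) *
            β.coeff (x.shift (vec (T.filter fun b => b < μ)))
              (insert μ ((cset true true true true).erase μ \ T)))) := by
  have key : ∀ (k : ℕ) (hk : k = 4) (ω : Form N L k K),
      total (hk ▸ ω : Form N L 4 K) = ∑ x, ω.coeff x (cset true true true true) := by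
    rintro k rfl ω
    rw [total_eq, univ_eq_cset]
  rw [key]
  exact Finset.sum_congr rfl fun x _ => coeff_cupOne α β x (cset true true true true)
    (by simp [card_cset, h])

/-- The components of a form as functions on the sites. -/
def comp (α : Form N L r K) (a b c d : Bool) (x : Site N L) : K := α.coeff x (cset a b c d)

omit [NeZero N] in
lemma coeff_eq_comp (α : Form N L r K) (x : Site N L) (a b c d : Bool) :
    α.coeff x (cset a b c d) = comp α a b c d x := rfl

/-- The correlation of two functions on the sites at a given distance. -/
def corr (φ ψ : Site N L → K) (a b c d : ℤ) : K := ∑ x, φ x * ψ (x.shift (svec a b c d))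

/-- Translation invariance of the sum over sites. It brings both orders of two factors to one normal
form. -/
lemma corr_symm (φ ψ : Site N L → K) (a b c d : ℤ) :
    corr φ ψ a b c d = corr ψ φ (-a) (-b) (-c) (-d) := by
  rw [corr, ← sum_shift _ (svec (-a) (-b) (-c) (-d))]
  simp [corr, svec_zero, mul_comm]

section Correlations

variable {r' : ℕ} (α : Form N L r K) (β : Form N L r' K) (i j k l i' j' k' l' : Bool)
  (a b c d a' b' c' d' : ℤ)

lemma sum_comp_shift_mul_comp_shift :
    ∑ x : Site N L, comp α i j k l (x.shift (svec a b c d)) *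
      comp β i' j' k' l' (x.shift (svec a' b' c' d')) =
      corr (comp α i j k l) (comp β i' j' k' l') (a' - a) (b' - b) (c' - c) (d' - d) := by
  rw [corr, ← sum_shift (fun x => comp α i j k l x * _) (svec a b c d)]
  simp only [Site.shift_shift, svec_add, add_sub_cancel]

lemma sum_comp_mul_comp_shift :
    ∑ x : Site N L, comp α i j k l x * comp β i' j' k' l' (x.shift (svec a b c d)) =
      corr (comp α i j k l) (comp β i' j' k' l') a b c d := rfl

lemma sum_comp_shift_mul_comp :
    ∑ x : Site N L, comp α i j k l (x.shift (svec a b c d)) * comp β i' j' k' l' x =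
      corr (comp α i j k l) (comp β i' j' k' l') (-a) (-b) (-c) (-d) := by
  simpa [svec_zero] using sum_comp_shift_mul_comp_shift α β i j k l i' j' k' l' a b c d 0 0 0 0

lemma sum_comp_mul_comp : ∑ x : Site N L, comp α i j k l x * comp β i' j' k' l' x =
    corr (comp α i j k l) (comp β i' j' k' l') 0 0 0 0 := by
  simp [corr, svec_zero]

end Correlations

/-! ### Summation by parts for `∪`, `∪₁` and `∂`. -/

lemma total_cup_extDeriv_left (A : Form N L 1 K) (g : Form N L 2 K) :
    total (cup (extDeriv A) g) = total (cup A (extDeriv g)) := by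
  have h1 := total_cup_eq (p := 2) (q := 2) rfl (extDeriv A) g
  have h2 := total_cup_eq (p := 1) (q := 3) rfl A (extDeriv g)
  simp only at h1 h2
  rw [h1, h2]
  simp [sum_powersetCard_two_cset, sum_powersetCard_one_cset, shuffleSign_cset, vec_cset,
    coeff_extDeriv, coeff_bdry, sum_cset, card_cset, pow_succ]
  -- Both sides become linear combinations of correlations of components at fixed distances, which
  -- `ring` can compare.
  simp [coeff_eq_comp, Finset.sum_neg_distrib, Finset.sum_add_distrib, Finset.sum_sub_distrib,
    sub_mul, mul_sub, mul_add, add_mul, sum_comp_shift_mul_comp_shift, sum_comp_mul_comp_shift,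
    sum_comp_shift_mul_comp, sum_comp_mul_comp]
  ring

lemma total_cup_extDeriv_right (A : Form N L 1 K) (g : Form N L 2 K) :
    total (cup g (extDeriv A)) = -total (cup (extDeriv g) A) := by
  have h1 := total_cup_eq (p := 2) (q := 2) rfl g (extDeriv A)
  have h2 := total_cup_eq (p := 3) (q := 1) rfl (extDeriv g) A
  simp only at h1 h2
  rw [h1, h2]
  simp only [sum_powersetCard_three_cset]
  simp [sum_powersetCard_two_cset, sum_powersetCard_one_cset, shuffleSign_cset, vec_cset,
    coeff_extDeriv, coeff_bdry, sum_cset, card_cset, pow_succ]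
  simp [coeff_eq_comp, Finset.sum_neg_distrib, Finset.sum_add_distrib, Finset.sum_sub_distrib,
    sub_mul, mul_sub, mul_add, add_mul, sum_comp_shift_mul_comp_shift, sum_comp_mul_comp_shift,
    sum_comp_shift_mul_comp, sum_comp_mul_comp]
  ring

/-- Up to a sign that depends on the degree, `∂` is the adjoint of `d`. -/
lemma dot_bdry_two (B : Form N L 3 K) (f : Form N L 2 K) :
    dot (bdry B) f = -dot B (extDeriv f) := by
  rw [dot_eq, dot_eq, univ_eq_cset]
  simp only [sum_powersetCard_three_cset]
  simp [sum_powersetCard_two_cset, sum_powersetCard_one_cset, shuffleSign_cset, vec_cset,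
    coeff_extDeriv, coeff_bdry, sum_cset, card_cset, pow_succ]
  simp [coeff_eq_comp, Finset.sum_neg_distrib, Finset.sum_add_distrib, Finset.sum_sub_distrib,
    sub_mul, mul_sub, mul_add, add_mul, sum_comp_shift_mul_comp_shift, sum_comp_mul_comp_shift,
    sum_comp_shift_mul_comp, sum_comp_mul_comp]
  ring

lemma dot_bdry_one (B : Form N L 2 K) (f : Form N L 1 K) :
    dot (bdry B) f = dot B (extDeriv f) := by
  rw [dot_eq, dot_eq, univ_eq_cset]
  simp [sum_powersetCard_two_cset, sum_powersetCard_one_cset, shuffleSign_cset, vec_cset,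
    coeff_extDeriv, coeff_bdry, sum_cset, card_cset, pow_succ]
  simp [coeff_eq_comp, Finset.sum_neg_distrib, Finset.sum_add_distrib, Finset.sum_sub_distrib,
    sub_mul, mul_sub, mul_add, add_mul, sum_comp_shift_mul_comp_shift, sum_comp_mul_comp_shift,
    sum_comp_shift_mul_comp, sum_comp_mul_comp]
  ring

/-- The integrated Steenrod identity: d(f ∪₁ g) sums to zero over the periodic lattice, so the `∪₁`
terms measure exactly the failure of `∪` to commute. The dependence on the framing originates here.
-/
lemma total_cupOne_extDeriv (f g : Form N L 2 K) :
    total (cupOne f (extDeriv g)) + total (cupOne (extDeriv f) g) =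
      total (cup f g) - total (cup g f) := by
  have h1 := total_cup_eq (p := 2) (q := 2) rfl f g
  have h2 := total_cup_eq (p := 2) (q := 2) rfl g f
  have h3 := total_cupOne_eq (p := 1) (q := 2) rfl f (extDeriv g)
  have h4 := total_cupOne_eq (p := 2) (q := 1) rfl (extDeriv f) g
  simp only at h1 h2 h3 h4
  rw [h1, h2, h3, h4]
  simp only [sum_cset, if_true, sum_powersetCard_one_cset, sum_powersetCard_two_cset,
    erase_zero_cset, erase_one_cset, erase_two_cset, erase_three_cset, sdiff_cset,
    filter_lt_zero_cset, filter_lt_one_cset, filter_lt_two_cset, filter_lt_three_cset,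
    filter_zero_le_cset, filter_one_le_cset, filter_two_le_cset, filter_three_le_cset]
  simp [sum_powersetCard_two_cset, sum_powersetCard_one_cset, shuffleSign_cset, vec_cset,
    coeff_extDeriv, coeff_bdry, sum_cset, card_cset, pow_succ]
  simp [coeff_eq_comp, Finset.sum_neg_distrib, Finset.sum_add_distrib, Finset.sum_sub_distrib,
    sub_mul, mul_sub, mul_add, add_mul, sum_comp_shift_mul_comp_shift, sum_comp_mul_comp_shift,
    sum_comp_shift_mul_comp, sum_comp_mul_comp]
  -- The product with `g` on the left produces correlations in the reverse order.
  simp only [corr_symm (comp g _ _ _ _)]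
  simp
  ring

end
/-! ### Linearity and change of coefficients -/

section Linearity

variable {N : ℕ} {L : Lattice} {r : ℕ} {K : Type} [CommRing K]

lemma extDeriv_add (α β : Form N L r K) : extDeriv (α + β) = extDeriv α + extDeriv β := by
  funext c
  simp only [extDeriv, Form.coeff_add, Pi.add_apply, ← Finset.sum_add_distrib]
  exact Finset.sum_congr rfl fun _ _ => by ring

lemma extDeriv_sub (α β : Form N L r K) : extDeriv (α - β) = extDeriv α - extDeriv β := by
  funext c
  simp only [extDeriv, Form.coeff_sub, Pi.sub_apply, ← Finset.sum_sub_distrib]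
  exact Finset.sum_congr rfl fun _ _ => by ring

lemma extDeriv_smul (a : K) (α : Form N L r K) : extDeriv (a • α) = a • extDeriv α := by
  funext c
  simp only [extDeriv, Form.coeff_smul, Pi.smul_apply, smul_eq_mul, Finset.mul_sum]
  exact Finset.sum_congr rfl fun _ _ => by ring

/-- The exterior derivative as a linear map. -/
def extDerivₗ (N : ℕ) (L : Lattice) (r : ℕ) (K : Type) [CommRing K] :
    Form N L r K →ₗ[K] Form N L (r + 1) K where
  toFun := extDeriv
  map_add' := extDeriv_add
  map_smul' := extDeriv_smul

lemma bdry_add (α β : Form N L (r + 1) K) : bdry (α + β) = bdry α + bdry β := by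
  funext c
  simp only [bdry, Form.coeff_add, Pi.add_apply, ← Finset.sum_add_distrib]
  exact Finset.sum_congr rfl fun _ _ => by ring

lemma bdry_smul (a : K) (α : Form N L (r + 1) K) : bdry (a • α) = a • bdry α := by
  funext c
  simp only [bdry, Form.coeff_smul, Pi.smul_apply, smul_eq_mul, Finset.mul_sum]
  exact Finset.sum_congr rfl fun _ _ => by ring

/-- The boundary operator as a linear map. -/
def bdryₗ (N : ℕ) (L : Lattice) (r : ℕ) (K : Type) [CommRing K] :
    Form N L (r + 1) K →ₗ[K] Form N L r K where
  toFun := bdry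
  map_add' := bdry_add
  map_smul' := bdry_smul

lemma toReal_add (n m : Form N L r ℤ) : (n + m : Form N L r ℤ).toReal = n.toReal + m.toReal := by
  funext c; simp [Form.toReal]

lemma toReal_smul (a : ℤ) (n : Form N L r ℤ) :
    (a • n : Form N L r ℤ).toReal = (a : ℝ) • n.toReal := by
  funext c; simp [Form.toReal]

lemma cast_shuffleSign (S T : Finset (Fin 4)) :
    ((shuffleSign ℤ S T : ℤ) : ℝ) = shuffleSign ℝ S T := by
  simp [shuffleSign]

lemma extDeriv_toReal (n : Form N L r ℤ) : extDeriv n.toReal = (extDeriv n).toReal := by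
  funext c
  simp [extDeriv, Form.coeff_toReal, Form.toReal, cast_shuffleSign]

variable {p q : ℕ}

lemma cup_add_left (α α' : Form N L p K) (β : Form N L q K) :
    cup (α + α') β = cup α β + cup α' β := by
  funext c
  simp only [cup, Form.coeff_add, Pi.add_apply, ← Finset.sum_add_distrib]
  exact Finset.sum_congr rfl fun _ _ => by ring

lemma cup_add_right (α : Form N L p K) (β β' : Form N L q K) :
    cup α (β + β') = cup α β + cup α β' := by
  funext c
  simp only [cup, Form.coeff_add, Pi.add_apply, ← Finset.sum_add_distrib]
  exact Finset.sum_congr rfl fun _ _ => by ring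

lemma cup_smul_left (a : K) (α : Form N L p K) (β : Form N L q K) :
    cup (a • α) β = a • cup α β := by
  funext c
  simp only [cup, Form.coeff_smul, Pi.smul_apply, smul_eq_mul, Finset.mul_sum]
  exact Finset.sum_congr rfl fun _ _ => by ring

lemma cup_smul_right (a : K) (α : Form N L p K) (β : Form N L q K) :
    cup α (a • β) = a • cup α β := by
  funext c
  simp only [cup, Form.coeff_smul, Pi.smul_apply, smul_eq_mul, Finset.mul_sum]
  exact Finset.sum_congr rfl fun _ _ => by ring

lemma parity_add (a : Fin 4) (α β : Form N L r K) :
    parity a (α + β) = parity a α + parity a β := by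
  funext c; simp [parity, mul_add]

lemma parity_smul (a : Fin 4) (k : K) (α : Form N L r K) :
    parity a (k • α) = k • parity a α := by
  funext c; simp [parity]; ring

lemma interiorProd_add (a : Fin 4) (α β : Form N L (r + 1) K) :
    interiorProd a (α + β) = interiorProd a α + interiorProd a β := by
  funext c; simp [interiorProd, mul_add]

lemma interiorProd_smul (a : Fin 4) (k : K) (α : Form N L (r + 1) K) :
    interiorProd a (k • α) = k • interiorProd a α := by
  funext c; simp [interiorProd]; ring

lemma cupOne_add_left (α α' : Form N L (p + 1) K) (β : Form N L (q + 1) K) :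
    cupOne (α + α') β = cupOne α β + cupOne α' β := by
  funext c
  simp only [cupOne, interiorProd_add, parity_add, cup_add_left, Form.coeff_add, Pi.add_apply,
    mul_add, Finset.sum_add_distrib]

lemma cupOne_smul_left (a : K) (α : Form N L (p + 1) K) (β : Form N L (q + 1) K) :
    cupOne (a • α) β = a • cupOne α β := by
  funext c
  simp only [cupOne, interiorProd_smul, parity_smul, cup_smul_left, Form.coeff_smul,
    Pi.smul_apply, smul_eq_mul, Finset.mul_sum]
  exact Finset.sum_congr rfl fun _ _ => by ring

lemma cupOne_smul_right (a : K) (α : Form N L (p + 1) K) (β : Form N L (q + 1) K) :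
    cupOne α (a • β) = a • cupOne α β := by
  funext c
  simp only [cupOne, interiorProd_smul, parity_smul, cup_smul_right, Form.coeff_smul,
    Pi.smul_apply, smul_eq_mul, Finset.mul_sum]
  exact Finset.sum_congr rfl fun _ _ => by ring

lemma cup_toReal (n : Form N L p ℤ) (m : Form N L q ℤ) :
    cup n.toReal m.toReal = (cup n m).toReal := by
  funext c
  simp [cup, Form.coeff_toReal, Form.toReal, cast_shuffleSign]

lemma parity_toReal (a : Fin 4) (n : Form N L r ℤ) :
    parity a n.toReal = (parity a n).toReal := by
  funext c; simp [parity, Form.coeff_toReal, Form.toReal]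

lemma interiorProd_toReal (a : Fin 4) (n : Form N L (r + 1) ℤ) :
    interiorProd a n.toReal = (interiorProd a n).toReal := by
  funext c; simp [interiorProd, Form.coeff_toReal, Form.toReal, cast_shuffleSign]

lemma cupOne_toReal (n : Form N L (p + 1) ℤ) (m : Form N L (q + 1) ℤ) :
    cupOne n.toReal m.toReal = (cupOne n m).toReal := by
  funext c
  simp only [cupOne, interiorProd_toReal, parity_toReal, cup_toReal, Form.coeff_toReal]
  simp only [Form.toReal, cupOne]
  push_cast
  rfl

variable [NeZero N]

lemma total_add (α β : Form N L 4 K) : total (α + β) = total α + total β := by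
  simp [total, Finset.sum_add_distrib]

lemma total_smul (a : K) (α : Form N L 4 K) : total (a • α) = a * total α := by
  simp [total, Finset.mul_sum]

lemma total_toReal (n : Form N L 4 ℤ) : total n.toReal = (total n : ℤ) := by
  simp [total, Form.toReal]

lemma dot_add_left (α α' β : Form N L r K) : dot (α + α') β = dot α β + dot α' β := by
  simp [dot, add_mul, Finset.sum_add_distrib]

lemma dot_comm (α β : Form N L r K) : dot α β = dot β α := by
  simp [dot, mul_comm]

lemma dot_add_right (α β β' : Form N L r K) : dot α (β + β') = dot α β + dot α β' := by
  simp [dot, mul_add, Finset.sum_add_distrib]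

lemma dot_smul_left (a : K) (α β : Form N L r K) : dot (a • α) β = a * dot α β := by
  simp [dot, mul_assoc, Finset.mul_sum]

lemma dot_smul_right (a : K) (α β : Form N L r K) : dot α (a • β) = a * dot α β := by
  simp [dot, mul_left_comm, Finset.mul_sum]

lemma eq_zero_of_dot_self {α : Form N L r ℝ} (h : dot α α = 0) : α = 0 := by
  funext c
  have := (Finset.sum_eq_zero_iff_of_nonneg (fun c _ => mul_self_nonneg (α c))).mp h c
    (Finset.mem_univ _)
  simpa using this

lemma dot_self_nonneg (α : Form N L r ℝ) : 0 ≤ dot α α :=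
  Finset.sum_nonneg fun c _ => mul_self_nonneg (α c)

lemma card_cset_two_cases : ∀ S : Finset (Fin 4), S.card = 2 →
    S = cset true true false false ∨ S = cset true false true false ∨
    S = cset true false false true ∨ S = cset false true true false ∨
    S = cset false true false true ∨ S = cset false false true true := by decide

lemma card_cset_three_cases : ∀ S : Finset (Fin 4), S.card = 3 →
    S = cset true true true false ∨ S = cset true true false true ∨
    S = cset true false true true ∨ S = cset false true true true := by decide

omit [NeZero N] in
lemma extDeriv_extDeriv (A : Form N L 1 K) : extDeriv (extDeriv A) = 0 := by
  refine Form.ext_coeff fun x S hS => ?_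
  rcases card_cset_three_cases S hS with rfl | rfl | rfl | rfl <;>
  · simp [coeff_extDeriv, card_cset, sum_cset, shuffleSign_cset, vec_cset]
    ring

omit [NeZero N] in
/-- The lattice Hodge Laplacian acts componentwise. -/
lemma extDeriv_bdry_add_bdry_extDeriv (f : Form N L 2 K) (x : Site N L) (S : Finset (Fin 4))
    (hS : S.card = 2) :
    (bdry (extDeriv f)).coeff x S - (extDeriv (bdry f)).coeff x S =
      ∑ μ : Fin 4, (f.coeff (x.shift (vec {μ})) S - 2 * f.coeff x S +
        f.coeff (x.shift (-vec {μ})) S) := by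
  rcases card_cset_two_cases S hS with rfl | rfl | rfl | rfl | rfl | rfl <;>
  · simp [coeff_extDeriv, coeff_bdry, card_cset, sum_cset, shuffleSign_cset, vec_cset,
      Fin.sum_univ_four, svec_zero]
    ring

end Linearity
/-! ### Hodge decomposition of closed two-forms -/

section Hodge

variable {N : ℕ} {L : Lattice} {r : ℕ} [NeZero N]

/-- The orthogonal projection of a form onto the image of a family of forms. -/
def projRange {ι : Type*} (T : ι → Form N L r ℝ) (f : Form N L r ℝ) : Form N L r ℝ :=
  WithLp.ofLp ((Submodule.span ℝ (Set.range fun b => 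
    (WithLp.toLp 2 (T b) : EuclideanSpace ℝ (Cell N L r)))).starProjection (WithLp.toLp 2 f))

/-- The range of a linear map is already a subspace, so taking the span adds nothing to it. -/
lemma projRange_mem {V : Type*} [AddCommGroup V] [Module ℝ V] (T : V →ₗ[ℝ] Form N L r ℝ)
    (f : Form N L r ℝ) : ∃ a, projRange T f = T a := by
  have h := Submodule.starProjection_apply_mem (Submodule.span ℝ (Set.range fun b => 
    (WithLp.toLp 2 (T b) : EuclideanSpace ℝ (Cell N L r)))) (WithLp.toLp 2 f)
  have h2 : Submodule.span ℝ (Set.range fun b => 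
      (WithLp.toLp 2 (T b) : EuclideanSpace ℝ (Cell N L r))) ≤
      LinearMap.range ((WithLp.linearEquiv 2 ℝ (Cell N L r → ℝ)).symm.toLinearMap ∘ₗ T) := by
    rw [Submodule.span_le]
    rintro _ ⟨b, rfl⟩
    exact ⟨b, rfl⟩
  obtain ⟨a, ha⟩ := h2 h
  exact ⟨a, congrArg WithLp.ofLp ha.symm⟩

lemma dot_sub_projRange {ι : Type*} (T : ι → Form N L r ℝ) (f : Form N L r ℝ) (b : ι) :
    dot (f - projRange T f) (T b) = 0 := by
  have h := Submodule.sub_starProjection_mem_orthogonal (K := Submodule.span ℝ (Set.range fun b => 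
    (WithLp.toLp 2 (T b) : EuclideanSpace ℝ (Cell N L r)))) (WithLp.toLp 2 f)
  have := (Submodule.mem_orthogonal _ _).mp h _ (Submodule.subset_span ⟨b, rfl⟩)
  simpa [PiLp.inner_apply, dot, projRange] using this

/-- Pairing a harmonic function with its own Laplacian and summing by parts gives minus the sum of
the squared differences along the links. All differences vanish, and the lattice is connected. -/
lemma eq_of_laplacian_eq_zero (φ : Site N L → ℝ) (h : ∀ x : Site N L, 
    ∑ μ : Fin 4, (φ (x.shift (vec {μ})) - 2 * φ x + φ (x.shift (-vec {μ}))) = 0)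
    (x y : Site N L) : φ x = φ y := by
  have h1 : ∑ x : Site N L, ∑ μ : Fin 4, (φ (x.shift (vec {μ})) - φ x) ^ 2 = 0 := by
    have h2 : ∑ x : Site N L, φ x * ∑ μ : Fin 4,
        (φ (x.shift (vec {μ})) - 2 * φ x + φ (x.shift (-vec {μ}))) = 0 := by simp [h]
    rw [Finset.sum_comm]
    simp only [Finset.mul_sum] at h2
    rw [Finset.sum_comm] at h2
    rw [← neg_eq_zero, ← h2, ← Finset.sum_neg_distrib]
    refine Finset.sum_congr rfl fun μ _ => ?_
    have e1 := sum_shift (fun x : Site N L => φ x ^ 2) (vec {μ})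
    have e2 := sum_shift (fun x : Site N L => φ x * φ (x.shift (-vec {μ}))) (vec {μ})
    simp only [Site.shift_shift, add_neg_cancel, Site.shift_zero] at e2
    have e3 : ∑ x : Site N L, (φ (x.shift (vec {μ})) - φ x) ^ 2 =
        ∑ x : Site N L, φ (x.shift (vec {μ})) ^ 2
          - 2 * ∑ x : Site N L, φ (x.shift (vec {μ})) * φ x + ∑ x : Site N L, φ x ^ 2 := by
      rw [Finset.mul_sum, ← Finset.sum_sub_distrib, ← Finset.sum_add_distrib]
      exact Finset.sum_congr rfl fun _ _ => by ring
    have e4 : ∑ x : Site N L, φ x * (φ (x.shift (vec {μ})) - 2 * φ x + φ (x.shift (-vec {μ}))) =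
        ∑ x : Site N L, φ (x.shift (vec {μ})) * φ x
          - 2 * ∑ x : Site N L, φ x ^ 2 + ∑ x : Site N L, φ x * φ (x.shift (-vec {μ})) := by
      rw [Finset.mul_sum, ← Finset.sum_sub_distrib, ← Finset.sum_add_distrib]
      exact Finset.sum_congr rfl fun _ _ => by ring
    rw [e3, e4, e1, ← e2]
    ring
  have h3 : ∀ (x : Site N L) (μ : Fin 4), φ (x.shift (vec {μ})) = φ x := by
    intro x μ
    have := (Finset.sum_eq_zero_iff_of_nonneg
      (fun x _ => Finset.sum_nonneg fun μ _ => sq_nonneg _)).mp h1 x (Finset.mem_univ _)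
    have := (Finset.sum_eq_zero_iff_of_nonneg
      (fun μ _ => sq_nonneg _)).mp this μ (Finset.mem_univ _)
    exact sub_eq_zero.mp (pow_eq_zero_iff two_ne_zero |>.mp this)
  -- The periods of `φ` form a submonoid that contains the unit vectors, hence every vector.
  let H : AddSubmonoid (Fin 4 → ZMod N) :=
    { carrier := {v | ∀ x : Site N L, φ (x.shift v) = φ x}
      zero_mem' := by simp
      add_mem' := fun {v w} hv hw x => by rw [← Site.shift_shift, hw, hv] }
  have h4 : ∀ v, v ∈ H := by
    intro v
    have : v = ∑ μ : Fin 4, (v μ).val • (vec {μ} : Fin 4 → ZMod N) := by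
      funext i
      rw [Finset.sum_apply]
      simp only [Pi.smul_apply, vec, Finset.mem_singleton, smul_ite, smul_zero, Finset.sum_ite_eq,
        Finset.mem_univ, if_true, nsmul_one, ZMod.natCast_val, ZMod.cast_id', id_eq]
    rw [this]
    exact H.sum_mem fun μ _ => H.nsmul_mem (fun x => h3 x μ) _
  have h5 := h4 (y.coord - x.coord) x
  rw [← h5]
  congr 1
  ext i
  simp [Site.shift]

/-- The mean values of a form, as a constant form. -/
def meanForm (f : Form N L r ℝ) : Form N L r ℝ :=
  fun c => ((N : ℝ) ^ 4)⁻¹ * ∑ x, f.coeff x c.2.1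

lemma card_site : (Fintype.card (Site N L) : ℝ) = (N : ℝ) ^ 4 := by
  rw [Fintype.card_congr (Site.equivCoord N L)]
  simp [ZMod.card]

lemma coeff_meanForm (f : Form N L r ℝ) (x : Site N L) (S : Finset (Fin 4)) :
    (meanForm f).coeff x S = ((N : ℝ) ^ 4)⁻¹ * ∑ y, f.coeff y S := by
  by_cases h : S.card = r
  · rw [Form.coeff_of_card _ _ _ h]; rfl
  · simp [Form.coeff_of_card_ne _ _ _ h]

lemma sum_coeff_extDeriv (f : Form N L r ℝ) (S : Finset (Fin 4)) :
    ∑ x, (extDeriv f).coeff x S = 0 := by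
  by_cases h : S.card = r + 1
  · simp only [coeff_extDeriv _ _ _ h]
    rw [Finset.sum_comm]
    refine Finset.sum_eq_zero fun μ _ => ?_
    rw [← Finset.mul_sum, Finset.sum_sub_distrib,
      sum_shift (fun x : Site N L => f.coeff x (S.erase μ)), sub_self, mul_zero]
  · simp [Form.coeff_of_card_ne _ _ _ h]

lemma sum_coeff_bdry (f : Form N L (r + 1) ℝ) (S : Finset (Fin 4)) :
    ∑ x, (bdry f).coeff x S = 0 := by
  by_cases h : S.card = r
  · simp only [coeff_bdry _ _ _ h]
    rw [Finset.sum_comm]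
    refine Finset.sum_eq_zero fun μ _ => ?_
    rw [← Finset.mul_sum, Finset.sum_sub_distrib,
      sum_shift (fun x : Site N L => f.coeff x (insert μ S)), sub_self, mul_zero]
  · simp [Form.coeff_of_card_ne _ _ _ h]

/-- Remove the orthogonal projection onto the exact forms. The remainder is closed, and it is
coclosed because it is orthogonal to d∂ of itself. The Laplacian acts componentwise, so the
remainder is constant, and its value is the mean because exact forms have mean zero. -/
lemma exists_eq_meanForm_add_extDeriv (f : Form N L 2 ℝ) (hf : extDeriv f = 0) :
    ∃ A : Form N L 1 ℝ, f = meanForm f + extDeriv A := by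
  obtain ⟨A, hA⟩ := projRange_mem (extDerivₗ N L 1 ℝ) f
  set g := f - projRange (extDerivₗ N L 1 ℝ) f with hg
  have hfg : f = g + extDeriv A := by
    rw [hg, hA]; simp [extDerivₗ]
  have hdg : extDeriv g = 0 := by
    rw [hg, hA, extDeriv_sub, hf, zero_sub, neg_eq_zero]
    exact extDeriv_extDeriv A
  have hbg : bdry g = 0 := by
    apply eq_zero_of_dot_self
    rw [dot_bdry_one]
    exact dot_sub_projRange (extDerivₗ N L 1 ℝ) f (bdry g)
  have hconst : ∀ (S : Finset (Fin 4)), S.card = 2 → ∀ x y : Site N L,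
      g.coeff x S = g.coeff y S := by
    intro S hS
    refine eq_of_laplacian_eq_zero (fun x => g.coeff x S) fun x => ?_
    have := extDeriv_bdry_add_bdry_extDeriv g x S hS
    rw [← this, hdg, hbg]
    have e1 : bdry (0 : Form N L 3 ℝ) = 0 := (bdryₗ N L 2 ℝ).map_zero
    have e2 : extDeriv (0 : Form N L 1 ℝ) = 0 := (extDerivₗ N L 1 ℝ).map_zero
    rw [e1, e2]
    simp
  have hgm : g = meanForm f := by
    refine Form.ext_coeff fun x S hS => ?_
    rw [coeff_meanForm, hfg]
    simp only [Form.coeff_add, Finset.sum_add_distrib, sum_coeff_extDeriv, add_zero]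
    rw [Finset.sum_congr rfl fun y _ => hconst S hS y x]
    have : (N : ℝ) ≠ 0 := Nat.cast_ne_zero.mpr (NeZero.ne N)
    simp [card_site]
    field_simp
  exact ⟨A, hgm ▸ hfg⟩

/-! ### Fluxes -/

/-- Fluxes through the coordinate planes, grouped in pairs of complementary planes. -/
abbrev Flux (K : Type) : Type := (K × K) × (K × K) × (K × K)

/-- The intersection pairing of fluxes. -/
def Flux.wedge {K : Type} [CommRing K] (y z : Flux K) : K :=
  (y.1.1 * z.1.2 + y.1.2 * z.1.1) + (y.2.1.1 * z.2.1.2 + y.2.1.2 * z.2.1.1) +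
    (y.2.2.1 * z.2.2.2 + y.2.2.2 * z.2.2.1)

/-- The euclidean pairing of fluxes. -/
def Flux.inner {K : Type} [CommRing K] (y z : Flux K) : K :=
  (y.1.1 * z.1.1 + y.1.2 * z.1.2) + (y.2.1.1 * z.2.1.1 + y.2.1.2 * z.2.1.2) +
    (y.2.2.1 * z.2.2.1 + y.2.2.2 * z.2.2.2)

/-- The total of a component of a form, normalized as the mean flux through a plane. -/
def planeFlux (f : Form N L 2 ℝ) (S : Finset (Fin 4)) : ℝ := ((N : ℝ) ^ 2)⁻¹ * ∑ x, f.coeff x S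

/-- The mean fluxes of a two-form through the coordinate planes. -/
def flux (f : Form N L 2 ℝ) : Flux ℝ :=
  ((planeFlux f (cset true true false false), planeFlux f (cset false false true true)),
    (planeFlux f (cset true false true false), -planeFlux f (cset false true false true)),
    (planeFlux f (cset true false false true), planeFlux f (cset false true true false)))

lemma planeFlux_add (f g : Form N L 2 ℝ) (S : Finset (Fin 4)) :
    planeFlux (f + g) S = planeFlux f S + planeFlux g S := by
  simp [planeFlux, Finset.sum_add_distrib, mul_add]

lemma planeFlux_smul (a : ℝ) (f : Form N L 2 ℝ) (S : Finset (Fin 4)) :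
    planeFlux (a • f) S = a * planeFlux f S := by
  simp [planeFlux, ← Finset.mul_sum]; ring

lemma flux_add (f g : Form N L 2 ℝ) : flux (f + g) = flux f + flux g := by
  simp only [flux, planeFlux_add]
  ext <;> simp; ring

lemma flux_smul (a : ℝ) (f : Form N L 2 ℝ) : flux (a • f) = a • flux f := by
  simp [flux, planeFlux_smul]

lemma flux_extDeriv (A : Form N L 1 ℝ) : flux (extDeriv A) = 0 := by
  simp [flux, planeFlux, sum_coeff_extDeriv]

lemma flux_bdry (B : Form N L 3 ℝ) : flux (bdry B) = 0 := by
  simp [flux, planeFlux, sum_coeff_bdry]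

lemma inv_mul_sum (f : Form N L 2 ℝ) (S : Finset (Fin 4)) :
    ((N : ℝ) ^ 4)⁻¹ * ∑ x, f.coeff x S = ((N : ℝ) ^ 2)⁻¹ * planeFlux f S := by
  rw [planeFlux, ← mul_assoc, ← mul_inv]; ring_nf

lemma sum_eq_planeFlux (f : Form N L 2 ℝ) (S : Finset (Fin 4)) :
    ∑ x, f.coeff x S = (N : ℝ) ^ 2 * planeFlux f S := by
  have : (N : ℝ) ≠ 0 := Nat.cast_ne_zero.mpr (NeZero.ne N)
  rw [planeFlux]; field_simp

/-- The minus sign in the definition of `flux` absorbs the odd shuffle sign of the second pair of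
planes, so `Flux.wedge` carries no signs. -/
lemma total_cup_meanForm_left (f g : Form N L 2 ℝ) :
    total (cup (meanForm f) g) = (flux f).wedge (flux g) := by
  have : (N : ℝ) ≠ 0 := Nat.cast_ne_zero.mpr (NeZero.ne N)
  have h1 := total_cup_eq (p := 2) (q := 2) rfl (meanForm f) g
  simp only at h1
  have h2 : ∀ S v, ∑ x : Site N L, g.coeff (x.shift v) S = (N : ℝ) ^ 2 * planeFlux g S :=
    fun S v => (sum_shift (fun x : Site N L => g.coeff x S) v).trans (sum_eq_planeFlux g S)
  rw [h1]
  simp only [coeff_meanForm, inv_mul_sum]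
  simp [sum_powersetCard_two_cset, shuffleSign_cset, pow_succ, Finset.sum_add_distrib,
    Finset.sum_neg_distrib, ← Finset.mul_sum, h2]
  simp only [flux, Flux.wedge]
  field_simp
  ring

lemma total_cup_meanForm_right (f g : Form N L 2 ℝ) :
    total (cup f (meanForm g)) = (flux f).wedge (flux g) := by
  have : (N : ℝ) ≠ 0 := Nat.cast_ne_zero.mpr (NeZero.ne N)
  have h1 := total_cup_eq (p := 2) (q := 2) rfl f (meanForm g)
  simp only at h1
  rw [h1]
  simp only [coeff_meanForm, inv_mul_sum]
  simp [sum_powersetCard_two_cset, shuffleSign_cset, pow_succ, Finset.sum_add_distrib,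
    Finset.sum_neg_distrib, ← Finset.sum_mul, sum_eq_planeFlux]
  simp only [flux, Flux.wedge]
  field_simp
  ring

lemma dot_meanForm_left (f g : Form N L 2 ℝ) :
    dot (meanForm f) g = (flux f).inner (flux g) := by
  have : (N : ℝ) ≠ 0 := Nat.cast_ne_zero.mpr (NeZero.ne N)
  rw [dot_eq, univ_eq_cset]
  simp only [coeff_meanForm, inv_mul_sum]
  simp [sum_powersetCard_two_cset, Finset.sum_add_distrib, ← Finset.mul_sum, sum_eq_planeFlux]
  simp only [flux, Flux.inner]
  field_simp
  ring

lemma flux_meanForm (f : Form N L 2 ℝ) : flux (meanForm f) = flux f := by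
  have : (N : ℝ) ≠ 0 := Nat.cast_ne_zero.mpr (NeZero.ne N)
  have h : ∀ S, planeFlux (meanForm f) S = planeFlux f S := by
    intro S
    rw [planeFlux]
    simp only [coeff_meanForm, inv_mul_sum]
    simp [card_site]
    field_simp
  simp [flux, h]

/-- Two closed forms have the cup product of their harmonic parts. -/
lemma total_cup_of_closed (f g : Form N L 2 ℝ) (hf : extDeriv f = 0) (hg : extDeriv g = 0) :
    total (cup f g) = (flux f).wedge (flux g) := by
  obtain ⟨A, hA⟩ := exists_eq_meanForm_add_extDeriv f hf
  have h0 : cup A (0 : Form N L 3 ℝ) = 0 := by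
    have := cup_smul_right (0 : ℝ) A (0 : Form N L 3 ℝ)
    simpa using this
  conv_lhs => rw [hA]
  rw [cup_add_left, total_add, total_cup_meanForm_left, total_cup_extDeriv_left, hg]
  erw [h0]
  simp [total]

end Hodge

/-! ### Duals of two-forms -/

section Star

variable {N : ℕ} {L : Lattice} {r : ℕ} [NeZero N]

/-- The two-form that represents `f ↦ ∑ f ∪ w`. -/
def rightStar (w : Form N L 2 ℝ) : Form N L 2 ℝ := fun c =>
  shuffleSign ℝ c.2.1 c.2.1ᶜ * w.coeff (c.1.shift (vec c.2.1)) c.2.1ᶜ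

/-- The two-form that represents `f ↦ ∑ w ∪ f`. -/
def leftStar (w : Form N L 2 ℝ) : Form N L 2 ℝ := fun c =>
  shuffleSign ℝ c.2.1ᶜ c.2.1 * w.coeff (c.1.shift (-vec c.2.1ᶜ)) c.2.1ᶜ

omit [NeZero N] in
lemma coeff_rightStar (w : Form N L 2 ℝ) (x : Site N L) (S : Finset (Fin 4)) (h : S.card = 2) :
    (rightStar w).coeff x S = shuffleSign ℝ S Sᶜ * w.coeff (x.shift (vec S)) Sᶜ := by
  rw [Form.coeff_of_card _ _ _ h]; rfl

omit [NeZero N] in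
lemma coeff_leftStar (w : Form N L 2 ℝ) (x : Site N L) (S : Finset (Fin 4)) (h : S.card = 2) :
    (leftStar w).coeff x S = shuffleSign ℝ Sᶜ S * w.coeff (x.shift (-vec Sᶜ)) Sᶜ := by
  rw [Form.coeff_of_card _ _ _ h]; rfl

lemma total_cup_eq_dot_rightStar (f w : Form N L 2 ℝ) :
    total (cup f w) = dot f (rightStar w) := by
  have h1 := total_cup_eq (p := 2) (q := 2) rfl f w
  simp only at h1
  rw [h1, dot_eq, univ_eq_cset]
  simp [sum_powersetCard_two_cset, shuffleSign_cset, vec_cset, card_cset, coeff_rightStar, pow_succ]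

lemma total_cup_eq_dot_leftStar (f w : Form N L 2 ℝ) :
    total (cup w f) = dot f (leftStar w) := by
  have h1 := total_cup_eq (p := 2) (q := 2) rfl w f
  simp only at h1
  rw [h1, dot_eq, univ_eq_cset]
  simp [sum_powersetCard_two_cset, shuffleSign_cset, vec_cset, card_cset, coeff_leftStar, pow_succ]
  simp [coeff_eq_comp, Finset.sum_neg_distrib, Finset.sum_add_distrib, sum_comp_mul_comp_shift]
  simp only [corr_symm (comp w _ _ _ _)]
  ring_nf

lemma dot_rightStar_self (w : Form N L 2 ℝ) : dot (rightStar w) (rightStar w) = dot w w := by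
  simp only [dot_eq, univ_eq_cset]
  simp [sum_powersetCard_two_cset, shuffleSign_cset, vec_cset, card_cset, coeff_rightStar, pow_succ]
  simp [coeff_eq_comp, Finset.sum_add_distrib, sum_comp_mul_comp, sum_comp_shift_mul_comp_shift]
  ring

lemma dot_leftStar_self (w : Form N L 2 ℝ) : dot (leftStar w) (leftStar w) = dot w w := by
  simp only [dot_eq, univ_eq_cset]
  simp [sum_powersetCard_two_cset, shuffleSign_cset, vec_cset, card_cset, coeff_leftStar, pow_succ]
  simp [coeff_eq_comp, Finset.sum_add_distrib, sum_comp_mul_comp, sum_comp_shift_mul_comp_shift]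
  ring

-- Duality exchanges `∂` and `d`: the potential is the dual one-form of `B`.
omit [NeZero N] in
lemma exists_rightStar_bdry (B : Form N L 3 ℝ) :
    ∃ A : Form N L 1 ℝ, rightStar (bdry B) = extDeriv A := by
  let A : Form N L 1 ℝ := fun c =>
    shuffleSign ℝ c.2.1ᶜ c.2.1 * B.coeff (c.1.shift (vec c.2.1)) c.2.1ᶜ
  have hA : ∀ x S, S.card = 1 → A.coeff x S =
      shuffleSign ℝ Sᶜ S * B.coeff (x.shift (vec S)) Sᶜ := by
    intro x S h
    rw [Form.coeff_of_card _ _ _ h]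
  refine ⟨A, Form.ext_coeff fun x S hS => ?_⟩
  rcases card_cset_two_cases S hS with rfl | rfl | rfl | rfl | rfl | rfl <;>
  · simp [coeff_rightStar, coeff_extDeriv, coeff_bdry, card_cset, sum_cset, shuffleSign_cset,
      vec_cset, hA, pow_succ]
    ring

omit [NeZero N] in
lemma exists_leftStar_bdry (B : Form N L 3 ℝ) :
    ∃ A : Form N L 1 ℝ, leftStar (bdry B) = extDeriv A := by
  let A : Form N L 1 ℝ := fun c =>
    shuffleSign ℝ c.2.1ᶜ c.2.1 * B.coeff (c.1.shift (-vec c.2.1ᶜ)) c.2.1ᶜ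
  have hA : ∀ x S, S.card = 1 → A.coeff x S =
      shuffleSign ℝ Sᶜ S * B.coeff (x.shift (-vec Sᶜ)) Sᶜ := by
    intro x S h
    rw [Form.coeff_of_card _ _ _ h]
  refine ⟨A, Form.ext_coeff fun x S hS => ?_⟩
  rcases card_cset_two_cases S hS with rfl | rfl | rfl | rfl | rfl | rfl <;>
  · simp [coeff_leftStar, coeff_extDeriv, coeff_bdry, card_cset, sum_cset, shuffleSign_cset,
      vec_cset, hA, pow_succ]
    ring

end Star
/-! ### Transport along translations between lattices -/

section Transport

variable {N : ℕ} {L L' : Lattice} {r : ℕ} {K : Type} [CommRing K] (v : Fin 4 → ZMod N)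

/-- The pull-back of a form under the translation by `v`, from a lattice to another one. -/
def transport (L' : Lattice) (α : Form N L r K) : Form N L' r K :=
  fun c => α (⟨c.1.coord + v⟩, c.2)

@[simp] lemma coeff_transport (α : Form N L r K) (x : Site N L') (S : Finset (Fin 4)) :
    (transport v L' α).coeff x S = α.coeff ⟨x.coord + v⟩ S := rfl

lemma shift_translate (x : Site N L) (a : Fin 4 → ZMod N) :
    (⟨(x.shift a).coord + v⟩ : Site N L') = Site.shift ⟨x.coord + v⟩ a := by
  ext; simp [Site.shift]; ring

lemma extDeriv_transport (α : Form N L r K) :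
    extDeriv (transport v L' α) = transport v L' (extDeriv α) := by
  funext c
  simp [extDeriv, transport, shift_translate]

lemma bdry_transport (α : Form N L (r + 1) K) :
    bdry (transport v L' α) = transport v L' (bdry α) := by
  funext c
  simp only [bdry, coeff_transport, shift_translate]
  rfl

lemma cup_transport {p q : ℕ} (α : Form N L p K) (β : Form N L q K) :
    cup (transport v L' α) (transport v L' β) = transport v L' (cup α β) := by
  funext c
  simp only [cup, coeff_transport, shift_translate]
  rfl

/-- A single reflection fixes the origin and is not translation covariant; the combined formula
`coeff_cupOne` is. -/
lemma cupOne_transport {p q : ℕ} (α : Form N L (p + 1) K) (β : Form N L (q + 1) K) :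
    cupOne (transport v L' α) (transport v L' β) = transport v L' (cupOne α β) := by
  refine Form.ext_coeff fun x S hS => ?_
  rw [coeff_transport, coeff_cupOne _ _ _ _ hS, coeff_cupOne _ _ _ _ hS]
  simp only [coeff_transport, shift_translate]

lemma toReal_transport (n : Form N L r ℤ) :
    (transport v L' n).toReal = transport v L' n.toReal := rfl

lemma transport_sub (α β : Form N L r K) :
    transport v L' (α - β) = transport v L' α - transport v L' β := rfl

variable [NeZero N]

lemma sum_translate {M : Type*} [AddCommMonoid M] (g : Site N L → M) :
    ∑ x : Site N L', g ⟨x.coord + v⟩ = ∑ x, g x := by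
  let e : Site N L' ≃ Site N L :=
    { toFun := fun x => ⟨x.coord + v⟩
      invFun := fun x => ⟨x.coord - v⟩
      left_inv := fun x => by ext; simp
      right_inv := fun x => by ext; simp }
  exact e.sum_comp g

lemma total_transport (α : Form N L 4 K) : total (transport v L' α) = total α := by
  simp only [total_eq, coeff_transport]
  exact sum_translate v fun x => α.coeff x Finset.univ

lemma dot_transport (α β : Form N L r K) :
    dot (transport v L' α) (transport v L' β) = dot α β := by
  simp only [dot_eq, coeff_transport]
  exact sum_translate v fun x => ∑ S ∈ Finset.powersetCard r Finset.univ,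
    α.coeff x S * β.coeff x S

lemma flux_transport (f : Form N L 2 ℝ) : flux (transport v L' f) = flux f := by
  have : ∀ S, planeFlux (transport v L' f) S = planeFlux f S := fun S => by
    simp only [planeFlux, coeff_transport]
    rw [sum_translate v fun x => f.coeff x S]
  simp [flux, this]

lemma projBdry_mem (α : Form N L 2 ℝ) : ∃ B, projBdry α = bdry B :=
  projRange_mem (bdryₗ N L 2 ℝ) α

lemma dot_sub_projBdry (α : Form N L 2 ℝ) (B : Form N L 3 ℝ) :
    dot (α - projBdry α) (bdry B) = 0 := dot_sub_projRange (bdryₗ N L 2 ℝ) α B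

/-- Two candidates differ by an element of Im ∂ that is orthogonal to Im ∂. This replaces the
definition of the projection when it is moved between lattices. -/
lemma projBdry_unique (α w : Form N L 2 ℝ) (B : Form N L 3 ℝ) (hw : w = bdry B)
    (h : ∀ B', dot (α - w) (bdry B') = 0) : projBdry α = w := by
  obtain ⟨B₀, hB₀⟩ := projBdry_mem α
  have hs : projBdry α - w = bdry (B₀ + (-1 : ℝ) • B) := by
    rw [bdry_add, bdry_smul, hw, hB₀]; simp [sub_eq_add_neg]
  rw [← sub_eq_zero]
  apply eq_zero_of_dot_self
  nth_rw 2 [hs]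
  have : projBdry α - w = (α - w) + (-1 : ℝ) • (α - projBdry α) := by
    funext c; simp
  rw [this, dot_add_left, dot_smul_left, h, dot_sub_projBdry]
  ring

lemma projBdry_transport (α : Form N L 2 ℝ) :
    projBdry (transport v L' α) = transport v L' (projBdry α) := by
  obtain ⟨B, hB⟩ := projBdry_mem α
  refine projBdry_unique _ _ (transport v L' B) (by rw [hB, bdry_transport]) fun B' => ?_
  have : B' = transport v L' (transport (-v) L B') := by
    funext c
    simp [transport]
  rw [this, bdry_transport, ← transport_sub, dot_transport, dot_sub_projBdry]

lemma uOf_transport (l : Form N L 2 ℤ) : uOf (transport v L' l) = uOf l := by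
  simp only [uOf, toReal_transport, projBdry_transport, extDeriv_transport]
  rw [cupOne_transport]
  exact total_transport v _

end Transport

/-! ### Decomposition of the field strength -/

section Decomposition

variable {N : ℕ} {L : Lattice} [NeZero N]

/-- The pairing `∑ f ∪ g` (`s = true`) or `∑ g ∪ f` (`s = false`). -/
def pairing {K : Type} [CommRing K] (s : Bool) (f g : Form N L 2 K) : K :=
  if s then total (cup f g) else total (cup g f)

/-- The sign of a framing. -/
def framingSign (s : Bool) : ℝ := if s then 1 else -1

section

variable {K : Type} [CommRing K] (s : Bool)

lemma pairing_add_left (f f' g : Form N L 2 K) :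
    pairing s (f + f') g = pairing s f g + pairing s f' g := by
  cases s <;> simp only [pairing, cup_add_left, cup_add_right] <;> exact total_add _ _

lemma pairing_add_right (f g g' : Form N L 2 K) :
    pairing s f (g + g') = pairing s f g + pairing s f g' := by
  cases s <;> simp only [pairing, cup_add_left, cup_add_right] <;> exact total_add _ _

lemma pairing_smul_left (a : K) (f g : Form N L 2 K) :
    pairing s (a • f) g = a * pairing s f g := by
  cases s <;> simp only [pairing, cup_smul_left, cup_smul_right] <;> exact total_smul _ _

lemma pairing_smul_right (a : K) (f g : Form N L 2 K) :
    pairing s f (a • g) = a * pairing s f g := by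
  cases s <;> simp only [pairing, cup_smul_left, cup_smul_right] <;> exact total_smul _ _

end

lemma pairing_toReal (s : Bool) (n m : Form N L 2 ℤ) :
    pairing s n.toReal m.toReal = (pairing s n m : ℤ) := by
  cases s <;> simp only [pairing, cup_toReal] <;> exact total_toReal _

/-- Only the fluxes matter, and their pairing is symmetric, so closed forms do not see the framing.
-/
lemma pairing_of_closed (s : Bool) (f g : Form N L 2 ℝ) (hf : extDeriv f = 0)
    (hg : extDeriv g = 0) : pairing s f g = (flux f).wedge (flux g) := by
  cases s
  · simp only [pairing]
    rw [if_neg (by simp), total_cup_of_closed _ _ hg hf]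
    simp only [Flux.wedge]; ring
  · simp only [pairing]
    rw [if_pos trivial, total_cup_of_closed _ _ hf hg]

lemma pairing_meanForm_left (s : Bool) (f g : Form N L 2 ℝ) :
    pairing s (meanForm f) g = (flux f).wedge (flux g) := by
  cases s
  · simp only [pairing]
    rw [if_neg (by simp), total_cup_meanForm_right]
    simp only [Flux.wedge]; ring
  · simp only [pairing]
    rw [if_pos trivial, total_cup_meanForm_left]

lemma pairing_eq_dot (s : Bool) (f w : Form N L 2 ℝ) :
    pairing s f w = dot f (if s then rightStar w else leftStar w) := by
  cases s
  · simp [pairing, total_cup_eq_dot_leftStar]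
  · simp [pairing, total_cup_eq_dot_rightStar]

/-- The source that represents the pairing with a form in the image of `∂`. -/
lemma exists_source (s : Bool) (B : Form N L 3 ℝ) : ∃ A : Form N L 1 ℝ,
    (∀ f, pairing s f (bdry B) = dot f (extDeriv A)) ∧
      dot (extDeriv A) (extDeriv A) = dot (bdry B) (bdry B) := by
  cases s
  · obtain ⟨A, hA⟩ := exists_leftStar_bdry B
    exact ⟨A, fun f => by simp [pairing_eq_dot, hA], by rw [← hA, dot_leftStar_self]⟩
  · obtain ⟨A, hA⟩ := exists_rightStar_bdry B
    exact ⟨A, fun f => by simp [pairing_eq_dot, hA], by rw [← hA, dot_rightStar_self]⟩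

lemma dot_bdry_of_closed (B : Form N L 3 ℝ) (f : Form N L 2 ℝ) (hf : extDeriv f = 0) :
    dot (bdry B) f = 0 := by
  rw [dot_bdry_two, hf]; simp [dot]

/-- Pairing with `∂B` is the inner product with an exact form, and Im ∂ is orthogonal to the closed
forms. -/
lemma pairing_bdry_bdry (s : Bool) (B : Form N L 3 ℝ) : pairing s (bdry B) (bdry B) = 0 := by
  obtain ⟨A, hA, -⟩ := exists_source s B
  rw [hA, dot_bdry_of_closed _ _ (extDeriv_extDeriv A)]

/-- For closed `f` the term with `df` drops out of `total_cupOne_extDeriv`. -/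
lemma pairing_true_sub_pairing_false (f g : Form N L 2 ℝ) (hf : extDeriv f = 0) :
    total (cupOne f (extDeriv g)) = pairing true f g - pairing false f g := by
  have h := total_cupOne_extDeriv f g
  have h0 : cupOne (extDeriv f) g = 0 := by
    have := cupOne_smul_left (0 : ℝ) (0 : Form N L 3 ℝ) g
    rw [hf]; simpa using this
  rw [h0] at h
  simpa [pairing, total] using h

/-- The topological charge for either framing. -/
def framedCharge (s : Bool) (A : Form N L 1 ℝ) (n : Form N L 2 ℤ) : ℝ :=
  if s then charge A n else chargeTilde A n

lemma framedCharge_eq (s : Bool) (A : Form N L 1 ℝ) (n : Form N L 2 ℤ) : framedCharge s A n =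
    1 / (8 * Real.pi ^ 2) * pairing true (fieldStrength A n) (fieldStrength A n) +
      framingSign s / (4 * Real.pi) *
        total (cupOne (fieldStrength A n) (extDeriv n.toReal)) := by
  cases s
  · simp only [framedCharge, chargeTilde, framingSign, pairing]; simp; ring
  · simp only [framedCharge, charge, framingSign, pairing]; simp

omit [NeZero N] in
lemma fieldStrength_eq (A : Form N L 1 ℝ) (n : Form N L 2 ℤ) :
    fieldStrength A n = extDeriv A + (2 * Real.pi) • n.toReal := rfl

variable (l : Form N L 2 ℤ)

/-- The closed part `l - P_∂ l`. -/
def closedPart : Form N L 2 ℝ := l.toReal - projBdry l.toReal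

lemma toReal_eq_add : l.toReal = projBdry l.toReal + closedPart l := by
  simp [closedPart]

/-- The orthogonal complement of Im ∂ is the kernel of the adjoint `d`: test orthogonality against ∂
of the derivative itself. -/
lemma extDeriv_closedPart : extDeriv (closedPart l) = 0 := by
  apply eq_zero_of_dot_self
  have h := dot_sub_projBdry l.toReal (extDeriv (closedPart l))
  rw [dot_comm, dot_bdry_two] at h
  exact neg_eq_zero.mp h

lemma extDeriv_projBdry : extDeriv (projBdry l.toReal) = extDeriv l.toReal := by
  conv_rhs => rw [toReal_eq_add, extDeriv_add, extDeriv_closedPart, add_zero]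

lemma flux_projBdry : flux (projBdry l.toReal) = 0 := by
  obtain ⟨B, hB⟩ := projBdry_mem l.toReal
  rw [hB, flux_bdry]

lemma flux_closedPart : flux (closedPart l) = flux l.toReal := by
  conv_rhs => rw [toReal_eq_add, flux_add, flux_projBdry, zero_add]

/-- The pairing of `P_∂ l` and `l - P_∂ l`. -/
def crossPairing (s : Bool) : ℝ := pairing s (projBdry l.toReal) (closedPart l)

/-- The square of the norm of `P_∂ l`. -/
def normSq : ℝ := dot (projBdry l.toReal) (projBdry l.toReal)

lemma pairing_projBdry_self (s : Bool) :
    pairing s (projBdry l.toReal) (projBdry l.toReal) = 0 := by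
  obtain ⟨B, hB⟩ := projBdry_mem l.toReal
  rw [hB, pairing_bdry_bdry]

lemma pairing_not (s : Bool) {K : Type} [CommRing K] (f g : Form N L 2 K) :
    pairing (!s) f g = pairing s g f := by
  cases s <;> simp [pairing]

/-- The non-closed part of the topological term of `l`. -/
lemma total_cupOne_self : total (cupOne l.toReal (extDeriv l.toReal)) =
    uOf l + crossPairing l false - crossPairing l true := by
  have h1 : cupOne l.toReal (extDeriv l.toReal) =
      cupOne (projBdry l.toReal) (extDeriv (projBdry l.toReal)) +
      cupOne (closedPart l) (extDeriv (projBdry l.toReal)) := by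
    rw [← cupOne_add_left, ← toReal_eq_add, extDeriv_projBdry]
  rw [h1]
  erw [total_add]
  rw [pairing_true_sub_pairing_false _ _ (extDeriv_closedPart l)]
  simp only [uOf, crossPairing]
  have e1 := pairing_not true (projBdry l.toReal) (closedPart l)
  have e2 := pairing_not false (projBdry l.toReal) (closedPart l)
  simp only [Bool.not_true, Bool.not_false] at e1 e2
  rw [e1, e2]
  ring

/-- The integer is ∑ l ∪₁ dl. Hence, modulo integers, the pairings of P_∂ l with the closed part in
the two orders differ by exactly `u`, which gives the part of the framing phase proportional to q_e
q_m. -/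
lemma exists_int_crossPairing : ∃ z : ℤ,
    crossPairing l true = crossPairing l false + uOf l - z := by
  refine ⟨total (cupOne l (extDeriv l)), ?_⟩
  have h := total_cupOne_self l
  rw [extDeriv_toReal, cupOne_toReal] at h
  erw [total_toReal] at h
  rw [h]; ring

lemma pairing_self_eq (s : Bool) : pairing s l.toReal l.toReal =
    crossPairing l true + crossPairing l false + (flux l.toReal).wedge (flux l.toReal) := by
  conv_lhs => rw [toReal_eq_add]
  rw [pairing_add_left, pairing_add_right, pairing_add_right, pairing_projBdry_self,
    pairing_of_closed s _ _ (extDeriv_closedPart l) (extDeriv_closedPart l), flux_closedPart]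
  have := pairing_not s (projBdry l.toReal) (closedPart l)
  rw [← this]
  cases s <;> simp [crossPairing] <;> ring

/-- Adding the two terms of 𝔓(l) cancels one of the two cross pairings and doubles the other. This
relation supplies the sign in 𝒯 and matches the phases in 𝒫. -/
lemma vOf_eq : (vOf l : ℝ) =
    uOf l + 2 * crossPairing l false + (flux l.toReal).wedge (flux l.toReal) := by
  have h1 := total_cupOne_self l
  have h2 := pairing_self_eq l true
  rw [extDeriv_toReal, cupOne_toReal] at h1
  erw [total_toReal] at h1
  rw [pairing_toReal] at h2
  simp only [pairing, if_true] at h2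
  rw [vOf, pontryagin]
  push_cast
  erw [h1, h2]
  ring

end Decomposition
-- Action and charge of a configuration 2πq P_∂ l + f with closed f.
section Configurations

variable {N : ℕ} {L : Lattice} [NeZero N]

lemma wedge_smul_left (a : ℝ) (y z : Flux ℝ) : (a • y).wedge z = a * y.wedge z := by
  simp only [Flux.wedge, Prod.smul_fst, Prod.smul_snd, smul_eq_mul]; ring

lemma wedge_smul_right (a : ℝ) (y z : Flux ℝ) : y.wedge (a • z) = a * y.wedge z := by
  simp only [Flux.wedge, Prod.smul_fst, Prod.smul_snd, smul_eq_mul]; ring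

lemma inner_smul_smul (a b : ℝ) (y z : Flux ℝ) : (a • y).inner (b • z) = a * b * y.inner z := by
  simp only [Flux.inner, Prod.smul_fst, Prod.smul_snd, smul_eq_mul]; ring

/-- The exact part of a closed two-form. -/
def exactPart (f : Form N L 2 ℝ) : Form N L 2 ℝ := f - meanForm f

lemma eq_meanForm_add_exactPart (f : Form N L 2 ℝ) : f = meanForm f + exactPart f := by
  simp [exactPart]

lemma exists_exactPart_eq (f : Form N L 2 ℝ) (hf : extDeriv f = 0) :
    ∃ A : Form N L 1 ℝ, exactPart f = extDeriv A := by
  obtain ⟨A, hA⟩ := exists_eq_meanForm_add_extDeriv f hf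
  exact ⟨A, by rw [exactPart, sub_eq_iff_eq_add']; exact hA⟩

lemma flux_exactPart (f : Form N L 2 ℝ) (hf : extDeriv f = 0) : flux (exactPart f) = 0 := by
  obtain ⟨A, hA⟩ := exists_exactPart_eq f hf
  rw [hA, flux_extDeriv]

variable (l : Form N L 2 ℤ) (q : ℤ) (A : Form N L 1 ℝ) (f : Form N L 2 ℝ) (hf : extDeriv f = 0)
  (s : Bool)

include hf

/-- P_∂ l is orthogonal to closed forms, and constant forms are orthogonal to exact ones, so the
three parts of the field do not interact. -/
lemma dot_field_self : dot ((2 * Real.pi * q) • projBdry l.toReal + f)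
      ((2 * Real.pi * q) • projBdry l.toReal + f) =
    (2 * Real.pi * q) ^ 2 * normSq l + (flux f).inner (flux f) +
      dot (exactPart f) (exactPart f) := by
  obtain ⟨B, hB⟩ := projBdry_mem l.toReal
  have h1 : dot (projBdry l.toReal) f = 0 := by rw [hB, dot_bdry_of_closed _ _ hf]
  have h2 : dot f f = (flux f).inner (flux f) + dot (exactPart f) (exactPart f) := by
    have h3 : dot (meanForm f) (exactPart f) = 0 := by
      rw [dot_meanForm_left, flux_exactPart f hf]; simp [Flux.inner]
    conv_lhs => rw [eq_meanForm_add_exactPart f]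
    rw [dot_add_left, dot_add_right, dot_add_right, dot_comm (exactPart f) (meanForm f), h3,
      dot_meanForm_left, flux_meanForm]
    ring
  rw [dot_add_left, dot_add_right, dot_add_right, dot_comm f, dot_smul_left, dot_smul_left,
    dot_smul_right, h1, h2, normSq]
  ring

omit hf in
lemma pairing_projBdry_eq : pairing s f (projBdry l.toReal) =
    pairing s (exactPart f) (projBdry l.toReal) := by
  conv_lhs => rw [eq_meanForm_add_exactPart f]
  rw [pairing_add_left, pairing_meanForm_left, flux_projBdry]
  simp [Flux.wedge]

lemma pairing_field_toReal :
    pairing s ((2 * Real.pi * q) • projBdry l.toReal + f) l.toReal =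
      2 * Real.pi * q * crossPairing l s + pairing s (exactPart f) (projBdry l.toReal) +
        (flux f).wedge (flux l.toReal) := by
  have h := pairing_add_right s ((2 * Real.pi * q) • projBdry l.toReal + f)
    (projBdry l.toReal) (closedPart l)
  rw [← toReal_eq_add] at h
  rw [h, pairing_add_left, pairing_add_left, pairing_smul_left,
    pairing_smul_left, pairing_projBdry_self, pairing_projBdry_eq l f,
    pairing_of_closed s _ _ hf (extDeriv_closedPart l), flux_closedPart, crossPairing]
  ring

lemma pairing_field_self :
    pairing true ((2 * Real.pi * q) • projBdry l.toReal + f)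
      ((2 * Real.pi * q) • projBdry l.toReal + f) =
      2 * Real.pi * q * (pairing true (exactPart f) (projBdry l.toReal) +
        pairing false (exactPart f) (projBdry l.toReal)) + (flux f).wedge (flux f) := by
  rw [pairing_add_left, pairing_add_right, pairing_add_right, pairing_smul_left,
    pairing_smul_left, pairing_smul_right, pairing_smul_right, pairing_projBdry_self,
    pairing_of_closed true _ _ hf hf]
  have h1 := pairing_not true f (projBdry l.toReal)
  simp only [Bool.not_true] at h1
  rw [← h1, pairing_projBdry_eq l f, pairing_projBdry_eq l f]
  ring

/-- F ∪ F contributes the sum of the two orders of pairing, and the `∪₁` term contributes their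
difference times the framing sign. Together only the order `s` survives, the same one as in the
electric loop. -/
lemma framedCharge_field (n : Form N L 2 ℤ)
    (hF : fieldStrength A n = (2 * Real.pi * q) • projBdry l.toReal + f)
    (hn : extDeriv n = q • extDeriv l) :
    framedCharge s A n = (flux f).wedge (flux f) / (8 * Real.pi ^ 2) +
      framingSign s * q ^ 2 * uOf l / 2 +
      q / (2 * Real.pi) * pairing s (exactPart f) (projBdry l.toReal) := by
  have hdn : extDeriv n.toReal = (q : ℝ) • extDeriv (projBdry l.toReal) := by
    rw [extDeriv_toReal, hn, toReal_smul, extDeriv_projBdry, extDeriv_toReal]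
  have h1 : total (cupOne ((2 * Real.pi * q) • projBdry l.toReal + f)
      ((q : ℝ) • extDeriv (projBdry l.toReal))) = 
      q * (2 * Real.pi * q * uOf l + (pairing true (exactPart f) (projBdry l.toReal) -
        pairing false (exactPart f) (projBdry l.toReal))) := by
    rw [cupOne_smul_right]
    erw [total_smul]
    rw [cupOne_add_left]
    erw [total_add]
    rw [pairing_true_sub_pairing_false _ _ hf, cupOne_smul_left]
    erw [total_smul]
    rw [pairing_projBdry_eq l f, pairing_projBdry_eq l f]
    rfl
  rw [framedCharge_eq, hF, hdn, h1, pairing_field_self l q f hf]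
  have := Real.pi_ne_zero
  cases s <;> simp only [framingSign] <;> simp <;> field_simp <;> ring

end Configurations

/-! ### Integer fluxes and the Pontryagin square modulo two. -/

section IntegerForms

variable {N : ℕ} {L : Lattice} [NeZero N]

/-- The plane in the directions of `S` through the origin, as the form dual to it. -/
def planeForm (N : ℕ) (L : Lattice) (S : Finset (Fin 4)) : Form N L 2 ℤ :=
  fun c => if c.2.1 = S ∧ ∀ μ ∈ S, c.1.coord μ = 0 then 1 else 0

omit [NeZero N] in
lemma coeff_planeForm (S T : Finset (Fin 4)) (hT : T.card = 2) (x : Site N L) :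
    (planeForm N L S).coeff x T = if T = S ∧ ∀ μ ∈ S, x.coord μ = 0 then 1 else 0 := by
  rw [Form.coeff_of_card _ _ _ hT]; rfl

/-- The form depends only on the coordinates in its own directions `S`, while the derivative takes
differences transverse to `S`. -/
lemma extDeriv_planeForm (S : Finset (Fin 4)) : extDeriv (planeForm N L S) = 0 := by
  refine Form.ext_coeff fun x T hT => ?_
  rw [coeff_extDeriv _ _ _ hT, Form.coeff_zero]
  refine Finset.sum_eq_zero fun μ hμ => ?_
  have hc : (T.erase μ).card = 2 := by rw [Finset.card_erase_of_mem hμ, hT]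
  rw [coeff_planeForm _ _ hc, coeff_planeForm _ _ hc]
  have : (T.erase μ = S ∧ ∀ ν ∈ S, (x.shift (vec {μ})).coord ν = 0) ↔
      (T.erase μ = S ∧ ∀ ν ∈ S, x.coord ν = 0) := by
    refine and_congr_right fun h => forall₂_congr fun ν hν => ?_
    have : ν ≠ μ := by
      rintro rfl
      rw [← h] at hν
      exact Finset.notMem_erase _ _ hν
    simp [Site.shift, vec, this]
  rw [if_congr this rfl rfl]
  simp

lemma planeFlux_planeForm (S T : Finset (Fin 4)) (hS : S.card = 2) (hT : T.card = 2) :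
    planeFlux (planeForm N L S).toReal T = if T = S then 1 else 0 := by
  have hN : (N : ℝ) ≠ 0 := Nat.cast_ne_zero.mpr (NeZero.ne N)
  rw [planeFlux]
  simp only [Form.coeff_toReal, coeff_planeForm S T hT]
  split_ifs with h
  · subst h
    simp only [true_and]
    have : ∑ x : Site N L, (((if ∀ μ ∈ T, x.coord μ = 0 then 1 else 0 : ℤ)) : ℝ) =
        ((Finset.univ.filter fun x : Fin 4 → ZMod N => ∀ μ ∈ T, x μ = 0).card : ℝ) := by
      rw [Finset.card_filter, Nat.cast_sum]
      push_cast
      exact (Site.equivCoord N L).sum_comp fun x => if ∀ μ ∈ T, x μ = 0 then (1 : ℝ) else 0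
    rw [this]
    have h2 : (Finset.univ.filter fun x : Fin 4 → ZMod N => ∀ μ ∈ T, x μ = 0) =
        Fintype.piFinset fun μ => if μ ∈ T then {0} else Finset.univ := by
      ext x
      simp only [Finset.mem_filter, Finset.mem_univ, true_and, Fintype.mem_piFinset]
      refine forall_congr' fun μ => ?_
      by_cases h : μ ∈ T <;> simp [h]
    rw [h2, Fintype.card_piFinset]
    have h3 : ∏ μ : Fin 4, (if μ ∈ T then ({0} : Finset (ZMod N)) else Finset.univ).card =
        N ^ 2 := by
      have : ∀ μ : Fin 4, (if μ ∈ T then ({0} : Finset (ZMod N)) else Finset.univ).card =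
          if μ ∈ Tᶜ then N else 1 := by
        intro μ
        by_cases h : μ ∈ T <;> simp [h, ZMod.card]
      rw [Finset.prod_congr rfl fun μ _ => this μ, Finset.prod_ite_mem, Finset.univ_inter,
        Finset.prod_const, Finset.card_compl, hT]
      rfl
    rw [h3]
    push_cast
    field_simp
  · simp [h]

/-- A closed integer form with the given fluxes. -/
def fluxForm (N : ℕ) (L : Lattice) (m : Flux ℤ) : Form N L 2 ℤ :=
  m.1.1 • planeForm N L (cset true true false false) +
  m.1.2 • planeForm N L (cset false false true true) +
  m.2.1.1 • planeForm N L (cset true false true false) +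
  (-m.2.1.2) • planeForm N L (cset false true false true) +
  m.2.2.1 • planeForm N L (cset true false false true) +
  m.2.2.2 • planeForm N L (cset false true true false)

/-- Integer fluxes as real fluxes. -/
def Flux.toReal (m : Flux ℤ) : Flux ℝ :=
  ((m.1.1, m.1.2), (m.2.1.1, m.2.1.2), (m.2.2.1, m.2.2.2))

lemma toReal_flux_injective : Function.Injective Flux.toReal := by
  rintro ⟨⟨a, b⟩, ⟨c, d⟩, ⟨e, f⟩⟩ ⟨⟨a', b'⟩, ⟨c', d'⟩, ⟨e', f'⟩⟩ h
  simpa [Flux.toReal] using h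

lemma extDeriv_fluxForm (m : Flux ℤ) : extDeriv (fluxForm N L m) = 0 := by
  simp only [fluxForm, extDeriv_add, extDeriv_smul, extDeriv_planeForm]
  simp

lemma flux_fluxForm (m : Flux ℤ) : flux (fluxForm N L m).toReal = m.toReal := by
  have h : ∀ T, T.card = 2 → planeFlux (fluxForm N L m).toReal T = 
      (if T = cset true true false false then (m.1.1 : ℝ) else 0) +
      (if T = cset false false true true then (m.1.2 : ℝ) else 0) +
      (if T = cset true false true false then (m.2.1.1 : ℝ) else 0) +
      (if T = cset false true false true then -(m.2.1.2 : ℝ) else 0) +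
      (if T = cset true false false true then (m.2.2.1 : ℝ) else 0) +
      (if T = cset false true true false then (m.2.2.2 : ℝ) else 0) := by
    intro T hT
    simp only [fluxForm, toReal_add, toReal_smul, planeFlux_add, planeFlux_smul]
    rw [planeFlux_planeForm _ _ (by simp [card_cset]) hT,
      planeFlux_planeForm _ _ (by simp [card_cset]) hT,
      planeFlux_planeForm _ _ (by simp [card_cset]) hT,
      planeFlux_planeForm _ _ (by simp [card_cset]) hT,
      planeFlux_planeForm _ _ (by simp [card_cset]) hT,
      planeFlux_planeForm _ _ (by simp [card_cset]) hT]
    simp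
  have hne : ∀ a b c d a' b' c' d' : Bool, cset a b c d = cset a' b' c' d' ↔
      a = a' ∧ b = b' ∧ c = c' ∧ d = d' := by
    intro a b c d a' b' c' d'
    refine ⟨fun h => ?_, by rintro ⟨rfl, rfl, rfl, rfl⟩; rfl⟩
    have h0 := mem_cset_zero a b c d
    have h1 := mem_cset_one a b c d
    have h2 := mem_cset_two a b c d
    have h3 := mem_cset_three a b c d
    rw [h] at h0 h1 h2 h3
    simp only [mem_cset_zero, mem_cset_one, mem_cset_two, mem_cset_three] at h0 h1 h2 h3
    exact ⟨Bool.eq_iff_iff.mpr h0.symm, Bool.eq_iff_iff.mpr h1.symm, Bool.eq_iff_iff.mpr h2.symm,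
      Bool.eq_iff_iff.mpr h3.symm⟩
  have hm := fun T hT => h T hT
  simp only [flux, Flux.toReal]
  rw [h _ (by simp [card_cset]), h _ (by simp [card_cset]), h _ (by simp [card_cset]),
    h _ (by simp [card_cset]), h _ (by simp [card_cset]), h _ (by simp [card_cset])]
  simp [hne]

/-- Closed integer forms have integer fluxes. -/
lemma exists_flux_eq_toReal (n : Form N L 2 ℤ) (hn : extDeriv n = 0) :
    ∃ m : Flux ℤ, flux n.toReal = m.toReal := by
  have hn' : extDeriv n.toReal = 0 := by
    rw [extDeriv_toReal, hn]; funext c; simp [Form.toReal]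
  -- The wedge with any integer flux is an integer, because it is a cup product of integer forms.
  -- The unit fluxes then read off the components one by one.
  have h : ∀ m : Flux ℤ, (flux n.toReal).wedge m.toReal =
      (pairing true n (fluxForm N L m) : ℤ) := by
    intro m
    rw [← pairing_toReal, pairing_of_closed true _ _ hn' (by
      rw [extDeriv_toReal, extDeriv_fluxForm]; funext c; simp [Form.toReal]), flux_fluxForm]
  refine ⟨((pairing true n (fluxForm N L ((0, 1), (0, 0), (0, 0))),
    pairing true n (fluxForm N L ((1, 0), (0, 0), (0, 0)))),
    (pairing true n (fluxForm N L ((0, 0), (0, 1), (0, 0))),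
    pairing true n (fluxForm N L ((0, 0), (1, 0), (0, 0)))),
    (pairing true n (fluxForm N L ((0, 0), (0, 0), (0, 1))),
    pairing true n (fluxForm N L ((0, 0), (0, 0), (1, 0))))), ?_⟩
  simp only [Flux.toReal, ← h]
  simp [Flux.wedge]

/-- The Pontryagin square of `q l + n` with closed `n` is `q² 𝔓(l)` modulo two. -/
lemma pontryagin_add_closed (l n : Form N L 2 ℤ) (q : ℤ) (hn : extDeriv n = 0) :
    ∃ k : ℤ, pontryagin (q • l + n) = q ^ 2 * vOf l + 2 * k := by
  have hn' : extDeriv n.toReal = 0 := by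
    rw [extDeriv_toReal, hn]; funext c; simp [Form.toReal]
  obtain ⟨m, hm⟩ := exists_flux_eq_toReal n hn
  -- A closed integer form has even self-intersection, since each product of complementary fluxes
  -- occurs twice.
  have h1 : total (cup n n) = 2 * (m.1.1 * m.1.2 + m.2.1.1 * m.2.1.2 + m.2.2.1 * m.2.2.2) := by
    have := pairing_of_closed true _ _ hn' hn'
    rw [pairing_toReal, hm] at this
    simp only [pairing, if_true, Flux.wedge, Flux.toReal] at this
    have h2 : ((total (K := ℤ) (cup n n) : ℤ) : ℝ) =
        ((2 * (m.1.1 * m.1.2 + m.2.1.1 * m.2.1.2 + m.2.2.1 * m.2.2.2) : ℤ) : ℝ) := by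
      push_cast
      erw [this]; ring
    exact_mod_cast h2
  -- This turns the mixed terms l ∪ n + n ∪ l + n ∪₁ dl into twice n ∪ l.
  have h2 : total (cupOne n (extDeriv l)) = total (cup n l) - total (cup l n) := by
    have h := total_cupOne_extDeriv n l
    have h0 : cupOne (extDeriv n) l = 0 := by
      have := cupOne_smul_left (0 : ℤ) (0 : Form N L 3 ℤ) l
      rw [hn]; simpa using this
    rw [h0] at h
    simpa [total] using h
  refine ⟨q * total (cup n l) + (m.1.1 * m.1.2 + m.2.1.1 * m.2.1.2 + m.2.2.1 * m.2.2.2), ?_⟩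
  have hd : extDeriv (q • l + n) = q • extDeriv l := by
    rw [extDeriv_add, extDeriv_smul, hn, add_zero]
  have e1 : total (cup (q • l + n) (q • l + n)) = q ^ 2 * total (cup l l) +
      q * (total (cup l n) + total (cup n l)) + total (cup n n) := by
    have := pairing_add_left true (q • l) n (q • l + n)
    rw [pairing_add_right true (q • l), pairing_add_right true n, pairing_smul_left,
      pairing_smul_left, pairing_smul_right, pairing_smul_right] at this
    simp only [pairing, if_true] at this
    erw [this]; ring
  have e2 : total (cupOne (q • l + n) (q • extDeriv l)) =
      q ^ 2 * total (cupOne l (extDeriv l)) + q * total (cupOne n (extDeriv l)) := by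
    rw [cupOne_smul_right]
    erw [total_smul]
    rw [cupOne_add_left]
    erw [total_add]
    rw [cupOne_smul_left]
    erw [total_smul]
    ring
  rw [vOf, pontryagin, pontryagin, hd, e2, h2]
  erw [e1, h1]
  ring

end IntegerForms
/-! ### Theta functions -/

section Theta

lemma summable_exp_neg_sq {c : ℝ} (hc : 0 < c) :
    Summable fun n : ℤ => Real.exp (-c * (n : ℝ) ^ 2) := by
  refine (summable_pow_mul_jacobiTheta₂_term_bound 0 (T := c / Real.pi)
    (by have := Real.pi_pos; positivity) 0).congr fun n => ?_
  have := Real.pi_ne_zero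
  rw [pow_zero, one_mul]
  congr 1
  field_simp
  ring

/-- Completing the square gives (n + α)² ≥ n²/2 - α². -/
lemma summable_exp_neg_shift_sq {c : ℝ} (hc : 0 < c) (α : ℝ) :
    Summable fun n : ℤ => Real.exp (-c * (n + α) ^ 2) := by
  refine Summable.of_nonneg_of_le (fun n => (Real.exp_pos _).le) (fun n => ?_)
    ((summable_exp_neg_sq (c := c / 2) (by positivity)).mul_left (Real.exp (c * α ^ 2)))
  rw [← Real.exp_add, Real.exp_le_exp]
  nlinarith [mul_nonneg hc.le (sq_nonneg ((n : ℝ) + 2 * α))]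

/-- The general term of `thetaTwo`. -/
def thetaTwoTerm (β θ : ℝ) (b a : ℤ) (lam : ℝ × ℝ) (m : ℤ × ℤ) : ℂ :=
  Complex.exp (-(2 * Real.pi ^ 2 * β * ((m.1 + a * lam.1) ^ 2 + (m.2 + a * lam.2) ^ 2) : ℝ)
    - Complex.I * (θ * ((m.1 + a * lam.1) * (m.2 + a * lam.2)) +
      2 * Real.pi * b * ((m.1 + a * lam.1) * lam.2 + (m.2 + a * lam.2) * lam.1) : ℝ))

/-- The theta function of a pair of fluxes through complementary planes. -/
def thetaTwo (β θ : ℝ) (b a : ℤ) (lam : ℝ × ℝ) : ℂ := ∑' m, thetaTwoTerm β θ b a lam m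

lemma norm_thetaTwoTerm (β θ : ℝ) (b a : ℤ) (lam : ℝ × ℝ) (m : ℤ × ℤ) :
    ‖thetaTwoTerm β θ b a lam m‖ = Real.exp (-(2 * Real.pi ^ 2 * β) * (m.1 + a * lam.1) ^ 2) *
      Real.exp (-(2 * Real.pi ^ 2 * β) * (m.2 + a * lam.2) ^ 2) := by
  rw [thetaTwoTerm, Complex.norm_exp, ← Real.exp_add]
  congr 1
  rw [Complex.sub_re, Complex.neg_re, Complex.ofReal_re, Complex.I_mul_re, Complex.ofReal_im]
  ring

lemma summable_norm_thetaTwoTerm {β : ℝ} (hβ : 0 < β) (θ : ℝ) (b a : ℤ) (lam : ℝ × ℝ) :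
    Summable fun m => ‖thetaTwoTerm β θ b a lam m‖ := by
  simp only [norm_thetaTwoTerm]
  have hc : 0 < 2 * Real.pi ^ 2 * β := by have := Real.pi_pos; positivity
  exact (summable_exp_neg_shift_sq hc (a * lam.1)).mul_of_nonneg
    (summable_exp_neg_shift_sq hc (a * lam.2)) (fun _ => (Real.exp_pos _).le)
    (fun _ => (Real.exp_pos _).le)

/-- Poisson summation for a shifted Gaussian with a phase. -/
lemma tsum_shifted_gaussian {A : ℝ} (hA : 0 < A) (α η : ℝ) :
    ∑' m : ℤ, Complex.exp (-(Real.pi * A * (m + α) ^ 2 : ℝ)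
        - Complex.I * (2 * Real.pi * η * (m + α) : ℝ)) =
      1 / (A : ℂ) ^ (1 / 2 : ℂ) * ∑' k : ℤ, Complex.exp (-(Real.pi / A * (k + η) ^ 2 : ℝ)
        + Complex.I * (2 * Real.pi * α * k : ℝ)) := by
  -- The linear coefficient comes from expanding the shifted square together with the phase.
  have h := Complex.tsum_exp_neg_quadratic (a := (A : ℂ)) (by simpa using hA)
    (-(A * α : ℝ) - Complex.I * η)
  have hA' : (A : ℂ) ≠ 0 := by exact_mod_cast hA.ne'
  have e1 : ∀ m : ℤ, Complex.exp (-(Real.pi * A * (m + α) ^ 2 : ℝ)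
        - Complex.I * (2 * Real.pi * η * (m + α) : ℝ)) =
      Complex.exp (-(Real.pi * A * α ^ 2 : ℝ) - Complex.I * (2 * Real.pi * η * α : ℝ)) *
      Complex.exp (-Real.pi * A * (m : ℂ) ^ 2 +
        2 * Real.pi * (-(A * α : ℝ) - Complex.I * η) * m) := by
    intro m
    rw [← Complex.exp_add]
    congr 1
    push_cast
    ring
  have e2 : ∀ k : ℤ, Complex.exp (-(Real.pi / A * (k + η) ^ 2 : ℝ)
        + Complex.I * (2 * Real.pi * α * k : ℝ)) =
      Complex.exp (-(Real.pi * A * α ^ 2 : ℝ) - Complex.I * (2 * Real.pi * η * α : ℝ)) *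
      Complex.exp (-Real.pi / A * (k + Complex.I * (-(A * α : ℝ) - Complex.I * η)) ^ 2) := by
    intro k
    rw [← Complex.exp_add]
    congr 1
    push_cast
    field_simp
    linear_combination (-2 * k * η + 2 * η * A * α * Complex.I + η ^ 2 * (Complex.I ^ 2 - 1) +
      A ^ 2 * α ^ 2) * Complex.I_sq
  simp only [e1, e2, tsum_mul_left, h]
  ring

/-- This is the modulus of the summand after Poisson summation in only one variable; it justifies
exchanging the order of summation. Bounding k² by 2(k + By)² + 2B²y² compares the sheared quadratic
form with a diagonal one. -/
lemma summable_sheared {A : ℝ} (hA : 0 < A) (B α κ : ℝ) : Summable fun m : ℤ × ℤ =>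
    Real.exp (-(Real.pi * A * (m.1 + α) ^ 2 +
      Real.pi / A * (m.2 + (B * (m.1 + α) + κ)) ^ 2)) := by
  have hpi := Real.pi_pos
  have hD : 0 < A ^ 2 + B ^ 2 := by positivity
  have hs := (summable_exp_neg_shift_sq (c := Real.pi * (A / 2)) (by positivity) α).mul_of_nonneg
    (summable_exp_neg_shift_sq (c := Real.pi * (A / (4 * (A ^ 2 + B ^ 2)))) (by positivity) κ)
    (fun _ => (Real.exp_pos _).le) (fun _ => (Real.exp_pos _).le)
  refine Summable.of_nonneg_of_le (fun n => (Real.exp_pos _).le) (fun m => ?_) hs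
  rw [← Real.exp_add, Real.exp_le_exp]
  set y := (m.1 : ℝ) + α
  have e : (m.2 : ℝ) + (B * y + κ) = (m.2 + κ) + B * y := by ring
  rw [e]
  set k := (m.2 : ℝ) + κ
  have key : A / 2 * y ^ 2 + A / (4 * (A ^ 2 + B ^ 2)) * k ^ 2 ≤
      A * y ^ 2 + 1 / A * (k + B * y) ^ 2 := by
    rw [← sub_nonneg]
    have : A * y ^ 2 + 1 / A * (k + B * y) ^ 2 -
        (A / 2 * y ^ 2 + A / (4 * (A ^ 2 + B ^ 2)) * k ^ 2) =
        (2 * (A ^ 2 + B ^ 2) * (A ^ 2 * y ^ 2 + 2 * (k + B * y) ^ 2) - A ^ 2 * k ^ 2) /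
          (4 * A * (A ^ 2 + B ^ 2)) := by
      field_simp
      ring
    rw [this]
    apply div_nonneg _ (by positivity)
    have h1 : A ^ 2 * k ^ 2 ≤ A ^ 2 * (2 * (k + B * y) ^ 2 + 2 * B ^ 2 * y ^ 2) := by
      apply mul_le_mul_of_nonneg_left _ (sq_nonneg A)
      nlinarith [sq_nonneg (k + 2 * (B * y))]
    nlinarith [mul_nonneg (sq_nonneg A) (sq_nonneg (k + B * y)),
      mul_nonneg (sq_nonneg B) (sq_nonneg (k + B * y)),
      mul_nonneg (sq_nonneg (A ^ 2)) (sq_nonneg y)]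
  have := mul_le_mul_of_nonneg_left key hpi.le
  have e2 : Real.pi * (A * y ^ 2 + 1 / A * (k + B * y) ^ 2) =
    Real.pi * A * y ^ 2 + Real.pi / A * (k + B * y) ^ 2 := by ring
  rw [e2] at this
  linarith

/-- Poisson summation in both variables. -/
lemma tsum_gaussian_pair {A : ℝ} (hA : 0 < A) (B b l₁ l₂ α₁ α₂ : ℝ) :
    ∑' m : ℤ × ℤ, Complex.exp (-(Real.pi * A * ((m.1 + α₁) ^ 2 + (m.2 + α₂) ^ 2) : ℝ)
        - Complex.I * (2 * Real.pi * (B * ((m.1 + α₁) * (m.2 + α₂)) +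
          b * ((m.1 + α₁) * l₂ + (m.2 + α₂) * l₁)) : ℝ)) =
      1 / (A : ℂ) ^ (1 / 2 : ℂ) * (1 / (((A ^ 2 + B ^ 2) / A : ℝ) : ℂ) ^ (1 / 2 : ℂ)) *
      ∑' k : ℤ × ℤ, Complex.exp (-(Real.pi * (A / (A ^ 2 + B ^ 2)) *
          ((k.1 + b * l₂) ^ 2 + (k.2 + b * l₁) ^ 2) : ℝ)
        + Complex.I * (2 * Real.pi * (B / (A ^ 2 + B ^ 2) * ((k.1 + b * l₂) * (k.2 + b * l₁)) +
          α₁ * k.1 + α₂ * k.2) : ℝ)) := by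
  have hpi := Real.pi_pos
  have hA' : (A : ℂ) ≠ 0 := by exact_mod_cast hA.ne'
  have hD : 0 < A ^ 2 + B ^ 2 := by positivity
  have hDc : (A : ℂ) ^ 2 + (B : ℂ) ^ 2 ≠ 0 := by exact_mod_cast hD.ne'
  have hs1 : Summable fun m : ℤ × ℤ =>
      Complex.exp (-(Real.pi * A * ((m.1 + α₁) ^ 2 + (m.2 + α₂) ^ 2) : ℝ)
        - Complex.I * (2 * Real.pi * (B * ((m.1 + α₁) * (m.2 + α₂)) +
          b * ((m.1 + α₁) * l₂ + (m.2 + α₂) * l₁)) : ℝ)) := by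
    apply Summable.of_norm
    have hs := (summable_exp_neg_shift_sq (c := Real.pi * A) (by positivity) α₁).mul_of_nonneg
      (summable_exp_neg_shift_sq (c := Real.pi * A) (by positivity) α₂)
      (fun _ => (Real.exp_pos _).le) (fun _ => (Real.exp_pos _).le)
    refine hs.congr fun m => ?_
    rw [Complex.norm_exp, ← Real.exp_add]
    congr 1
    rw [Complex.sub_re, Complex.neg_re, Complex.ofReal_re, Complex.I_mul_re, Complex.ofReal_im]
    ring
  -- The first index is the untouched second variable, the second index is dual to the first
  -- variable.
  let T : ℤ × ℤ → ℂ := fun m => Complex.exp (-(Real.pi * A * (m.1 + α₂) ^ 2 : ℝ)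
      - Complex.I * (2 * Real.pi * (b * l₁) * (m.1 + α₂) : ℝ)) *
    Complex.exp (-(Real.pi / A * (m.2 + (B * (m.1 + α₂) + b * l₂)) ^ 2 : ℝ)
      + Complex.I * (2 * Real.pi * α₁ * m.2 : ℝ))
  have hT : Summable T := by
    apply Summable.of_norm
    refine (summable_sheared hA B α₂ (b * l₂)).congr fun m => ?_
    rw [norm_mul, Complex.norm_exp, Complex.norm_exp, ← Real.exp_add]
    congr 1
    rw [Complex.sub_re, Complex.add_re, Complex.neg_re, Complex.neg_re, Complex.ofReal_re,
      Complex.ofReal_re, Complex.I_mul_re, Complex.ofReal_im, Complex.I_mul_re, Complex.ofReal_im]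
    ring
  have step1 : ∑' m : ℤ × ℤ, Complex.exp (-(Real.pi * A * ((m.1 + α₁) ^ 2 + (m.2 + α₂) ^ 2) : ℝ)
        - Complex.I * (2 * Real.pi * (B * ((m.1 + α₁) * (m.2 + α₂)) +
          b * ((m.1 + α₁) * l₂ + (m.2 + α₂) * l₁)) : ℝ)) =
      1 / (A : ℂ) ^ (1 / 2 : ℂ) * ∑' m : ℤ × ℤ, T m := by
    rw [← (Equiv.prodComm ℤ ℤ).tsum_eq, hT.tsum_prod, ← tsum_mul_left]
    refine ((Equiv.prodComm ℤ ℤ).summable_iff.mpr hs1).tsum_prod.trans ?_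
    refine tsum_congr fun m₂ => ?_
    have h := tsum_shifted_gaussian hA α₁ (B * (m₂ + α₂) + b * l₂)
    simp only [T, tsum_mul_left]
    rw [mul_left_comm, ← h, ← tsum_mul_left]
    refine tsum_congr fun m₁ => ?_
    simp only [Function.comp_apply, Equiv.prodComm_apply, Prod.swap_prod_mk]
    rw [← Complex.exp_add]
    congr 1
    push_cast
    ring
  have hT2 : Summable fun k : ℤ × ℤ => T k.swap :=
    (Equiv.prodComm ℤ ℤ).summable_iff.mpr hT
  have step2 : ∀ k₁ : ℤ, ∑' m : ℤ, T (m, k₁) =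
      1 / (((A ^ 2 + B ^ 2) / A : ℝ) : ℂ) ^ (1 / 2 : ℂ) *
      ∑' k₂ : ℤ, Complex.exp (-(Real.pi * (A / (A ^ 2 + B ^ 2)) *
          ((k₁ + b * l₂) ^ 2 + (k₂ + b * l₁) ^ 2) : ℝ)
        + Complex.I * (2 * Real.pi * (B / (A ^ 2 + B ^ 2) * ((k₁ + b * l₂) * (k₂ + b * l₁)) +
          α₁ * k₁ + α₂ * k₂) : ℝ)) := by
    intro k₁
    have hDA : 0 < (A ^ 2 + B ^ 2) / A := by positivity
    set κ : ℝ := k₁ + b * l₂ with hκ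
    -- Completing the square in y = m + α₂ turns A y² + (κ + By)²/A into (A² + B²)/A times the
    -- square of y + Bκ/(A² + B²), plus Aκ²/(A² + B²).
    have h := tsum_shifted_gaussian hDA (α₂ + B * κ / (A ^ 2 + B ^ 2)) (b * l₁)
    have e1 : ∀ m : ℤ, T (m, k₁) = Complex.exp (-(Real.pi * κ ^ 2 * A / (A ^ 2 + B ^ 2) : ℝ)
        + Complex.I * (2 * Real.pi * (α₁ * k₁ + b * l₁ * B * κ / (A ^ 2 + B ^ 2)) : ℝ)) *
        Complex.exp (-(Real.pi * ((A ^ 2 + B ^ 2) / A) *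
          (m + (α₂ + B * κ / (A ^ 2 + B ^ 2))) ^ 2 : ℝ)
        - Complex.I * (2 * Real.pi * (b * l₁) * (m + (α₂ + B * κ / (A ^ 2 + B ^ 2))) : ℝ)) := by
      intro m
      have hk : (k₁ : ℝ) + (B * (m + α₂) + b * l₂) = κ + B * (m + α₂) := by rw [hκ]; ring
      simp only [T]
      rw [← Complex.exp_add, ← Complex.exp_add, hk]
      congr 1
      push_cast
      field_simp
      ring
    simp only [e1, tsum_mul_left]
    rw [h, mul_left_comm, ← tsum_mul_left]
    congr 1
    refine tsum_congr fun k₂ => ?_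
    rw [← Complex.exp_add]
    congr 1
    push_cast
    field_simp
    ring
  rw [step1, mul_assoc]
  congr 1
  have hS : Summable fun k : ℤ × ℤ => Complex.exp (-(Real.pi * (A / (A ^ 2 + B ^ 2)) *
          ((k.1 + b * l₂) ^ 2 + (k.2 + b * l₁) ^ 2) : ℝ)
        + Complex.I * (2 * Real.pi * (B / (A ^ 2 + B ^ 2) * ((k.1 + b * l₂) * (k.2 + b * l₁)) +
          α₁ * k.1 + α₂ * k.2) : ℝ)) := by
    apply Summable.of_norm
    have hs := (summable_exp_neg_shift_sq (c := Real.pi * (A / (A ^ 2 + B ^ 2))) (by positivity)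
      (b * l₂)).mul_of_nonneg (summable_exp_neg_shift_sq (c := Real.pi * (A / (A ^ 2 + B ^ 2)))
      (by positivity) (b * l₁)) (fun _ => (Real.exp_pos _).le) (fun _ => (Real.exp_pos _).le)
    refine hs.congr fun m => ?_
    rw [Complex.norm_exp, ← Real.exp_add]
    congr 1
    rw [Complex.add_re, Complex.neg_re, Complex.ofReal_re, Complex.I_mul_re, Complex.ofReal_im]
    ring
  rw [← (Equiv.prodComm ℤ ℤ).tsum_eq T, hS.tsum_prod]
  have e3 : ∑' c, T ((Equiv.prodComm ℤ ℤ) c) = ∑' k₁ : ℤ, ∑' m : ℤ, T (m, k₁) :=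
    hT2.tsum_prod
  rw [e3, ← tsum_mul_left]
  exact tsum_congr step2

/-- The factor that arises in the Poisson summation of `thetaTwo`. -/
def thetaFactor (β θ : ℝ) : ℂ :=
  1 / ((2 * Real.pi * β : ℝ) : ℂ) ^ (1 / 2 : ℂ) *
    (1 / ((((2 * Real.pi * β) ^ 2 + (θ / (2 * Real.pi)) ^ 2) / (2 * Real.pi * β) : ℝ) : ℂ) ^
      (1 / 2 : ℂ))

lemma thetaFactor_ne_zero {β : ℝ} (hβ : 0 < β) (θ : ℝ) : thetaFactor β θ ≠ 0 := by
  have hpi := Real.pi_pos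
  have h1 : 0 < 2 * Real.pi * β := by positivity
  have h2 : 0 < ((2 * Real.pi * β) ^ 2 + (θ / (2 * Real.pi)) ^ 2) / (2 * Real.pi * β) := by
    positivity
  refine mul_ne_zero (one_div_ne_zero ?_) (one_div_ne_zero ?_) <;>
  · rw [Ne, Complex.cpow_eq_zero_iff, not_and_or]
    left
    exact_mod_cast (by assumption : (0 : ℝ) < _).ne'

/-- Poisson summation with A = 2πβ and B = θ/2π, which inverts τ = B + iA to -1/τ. Shift and
character are exchanged, and this leaves the phase in `b a`. -/
lemma thetaTwo_duality {β : ℝ} (hβ : 0 < β) (θ : ℝ) (b a : ℤ) (lam : ℝ × ℝ) :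
    thetaTwo β θ b a lam = thetaFactor β θ *
      (Complex.exp (-(2 * Real.pi * Complex.I * (b * a * (2 * lam.1 * lam.2) : ℝ))) *
      thetaTwo (dualBeta β θ) (dualTheta β θ) a (-b) lam) := by
  have hpi := Real.pi_pos
  have hA : 0 < 2 * Real.pi * β := by positivity
  have hD : 0 < (2 * Real.pi * β) ^ 2 + (θ / (2 * Real.pi)) ^ 2 := by positivity
  have h := tsum_gaussian_pair hA (θ / (2 * Real.pi)) b lam.1 lam.2 (a * lam.1) (a * lam.2)
  have e1 : thetaTwo β θ b a lam = ∑' m : ℤ × ℤ, 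
      Complex.exp (-(Real.pi * (2 * Real.pi * β) *
        ((m.1 + a * lam.1) ^ 2 + (m.2 + a * lam.2) ^ 2) : ℝ)
        - Complex.I * (2 * Real.pi * (θ / (2 * Real.pi) * ((m.1 + a * lam.1) * (m.2 + a * lam.2)) +
          b * ((m.1 + a * lam.1) * lam.2 + (m.2 + a * lam.2) * lam.1)) : ℝ)) := by
    refine tsum_congr fun m => ?_
    rw [thetaTwoTerm]
    congr 3
    · push_cast; ring
    · congr 1
      field_simp
  rw [e1, h, ← thetaFactor]
  congr 1
  rw [thetaTwo, ← tsum_mul_left]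
  -- The dual shifts appear with the two complementary planes interchanged and with positive sign;
  -- this reindexing undoes both.
  let e : ℤ × ℤ ≃ ℤ × ℤ :=
    { toFun := fun m => (-m.2, -m.1)
      invFun := fun m => (-m.2, -m.1)
      left_inv := fun m => by simp
      right_inv := fun m => by simp }
  rw [← e.tsum_eq]
  refine tsum_congr fun m => ?_
  rw [thetaTwoTerm, ← Complex.exp_add]
  congr 1
  simp only [e, Equiv.coe_fn_mk, dualBeta, dualTheta]
  set D := (2 * Real.pi * β) ^ 2 + (θ / (2 * Real.pi)) ^ 2
  have hDc : (D : ℂ) ≠ 0 := by exact_mod_cast hD.ne'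
  have hpc : (Real.pi : ℂ) ≠ 0 := by exact_mod_cast hpi.ne'
  push_cast
  field_simp
  ring

/-- The general term of `thetaSix`. -/
def thetaSixTerm (β θ : ℝ) (b a : ℤ) (lam : Flux ℝ) (m : Flux ℤ) : ℂ :=
  Complex.exp (-(2 * Real.pi ^ 2 * β * (m.toReal + (a : ℝ) • lam).inner
      (m.toReal + (a : ℝ) • lam) : ℝ)
    - Complex.I * (θ / 2 * (m.toReal + (a : ℝ) • lam).wedge (m.toReal + (a : ℝ) • lam) +
      2 * Real.pi * b * (m.toReal + (a : ℝ) • lam).wedge lam : ℝ))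

/-- The sum over the fluxes. -/
def thetaSix (β θ : ℝ) (b a : ℤ) (lam : Flux ℝ) : ℂ := ∑' m, thetaSixTerm β θ b a lam m

/-- Both quadratic forms are block diagonal with respect to the three pairs of complementary planes.
-/
lemma thetaSixTerm_eq (β θ : ℝ) (b a : ℤ) (lam : Flux ℝ) (m : Flux ℤ) :
    thetaSixTerm β θ b a lam m = thetaTwoTerm β θ b a lam.1 m.1 *
      (thetaTwoTerm β θ b a lam.2.1 m.2.1 * thetaTwoTerm β θ b a lam.2.2 m.2.2) := by
  simp only [thetaSixTerm, thetaTwoTerm]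
  rw [← Complex.exp_add, ← Complex.exp_add]
  congr 1
  simp only [Flux.inner, Flux.wedge, Flux.toReal, Prod.fst_add, Prod.snd_add, Prod.smul_fst,
    Prod.smul_snd, smul_eq_mul]
  push_cast
  ring

lemma thetaSix_eq {β : ℝ} (hβ : 0 < β) (θ : ℝ) (b a : ℤ) (lam : Flux ℝ) :
    thetaSix β θ b a lam = thetaTwo β θ b a lam.1 *
      (thetaTwo β θ b a lam.2.1 * thetaTwo β θ b a lam.2.2) := by
  have h1 := summable_norm_thetaTwoTerm hβ θ b a lam.1
  have h2 := summable_norm_thetaTwoTerm hβ θ b a lam.2.1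
  have h3 := summable_norm_thetaTwoTerm hβ θ b a lam.2.2
  simp only [thetaSix, thetaSixTerm_eq, thetaTwo]
  rw [tsum_mul_tsum_of_summable_norm h2 h3, tsum_mul_tsum_of_summable_norm h1 (h2.mul_norm h3)]

lemma thetaSix_duality {β : ℝ} (hβ : 0 < β) (hβ' : 0 < dualBeta β θ) (b a : ℤ)
    (lam : Flux ℝ) : thetaSix β θ b a lam = thetaFactor β θ ^ 3 *
      (Complex.exp (-(2 * Real.pi * Complex.I * (b * a * lam.wedge lam : ℝ))) *
      thetaSix (dualBeta β θ) (dualTheta β θ) a (-b) lam) := by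
  rw [thetaSix_eq hβ, thetaSix_eq hβ', thetaTwo_duality hβ, thetaTwo_duality hβ,
    thetaTwo_duality hβ]
  have : Complex.exp (-(2 * Real.pi * Complex.I * (b * a * lam.wedge lam : ℝ))) =
      Complex.exp (-(2 * Real.pi * Complex.I * (b * a * (2 * lam.1.1 * lam.1.2) : ℝ))) *
      Complex.exp (-(2 * Real.pi * Complex.I * (b * a * (2 * lam.2.1.1 * lam.2.1.2) : ℝ))) *
      Complex.exp (-(2 * Real.pi * Complex.I * (b * a * (2 * lam.2.2.1 * lam.2.2.2) : ℝ))) := by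
    rw [← Complex.exp_add, ← Complex.exp_add]
    congr 1
    simp only [Flux.wedge]
    push_cast
    ring
  rw [this]
  ring

lemma thetaSix_neg (β θ : ℝ) (b a : ℤ) (lam : Flux ℝ) :
    thetaSix β θ (-b) (-a) lam = thetaSix β θ b a lam := by
  rw [thetaSix, ← (Equiv.neg (Flux ℤ)).tsum_eq]
  refine tsum_congr fun m => ?_
  have h : (-m).toReal + ((-a : ℤ) : ℝ) • lam = (-1 : ℝ) • (m.toReal + (a : ℝ) • lam) := by
    ext <;> simp [Flux.toReal]
  simp only [thetaSixTerm, Equiv.neg_apply]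
  rw [h, inner_smul_smul, wedge_smul_left, wedge_smul_left, wedge_smul_right]
  congr 1
  push_cast
  ring

/-- The change of the exponent depends on `m` only through -iπ m∧m. Since m∧m is even, this is
trivial, and the identity holds term by term. -/
lemma thetaSix_shift (β θ : ℝ) (b a : ℤ) (lam : Flux ℝ) :
    thetaSix β (θ + 2 * Real.pi) (b - a) a lam =
      Complex.exp (Complex.I * Real.pi * (a ^ 2 * lam.wedge lam : ℝ)) *
        thetaSix β θ b a lam := by
  rw [thetaSix, thetaSix, ← tsum_mul_left]
  refine tsum_congr fun m => ?_
  simp only [thetaSixTerm]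
  rw [← Complex.exp_add, Complex.exp_eq_exp_iff_exists_int]
  refine ⟨-(m.1.1 * m.1.2 + m.2.1.1 * m.2.1.2 + m.2.2.1 * m.2.2.2), ?_⟩
  simp only [Flux.wedge, Flux.toReal, Prod.fst_add, Prod.snd_add, Prod.smul_fst,
    Prod.smul_snd, smul_eq_mul]
  push_cast
  ring

end Theta
/-! ### Integration over compact gauge fields -/

section Torus

/-- The normalized measure on an interval of length `2π`. -/
def circleMeasure : Measure ℝ :=
  (2 * NNReal.pi)⁻¹ • volume.restrict (Set.Ico (-Real.pi) Real.pi)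

instance : IsProbabilityMeasure circleMeasure := by
  constructor
  have hpi := Real.pi_pos
  rw [circleMeasure, Measure.smul_apply, Measure.restrict_apply MeasurableSet.univ,
    Set.univ_inter, Real.volume_Ico]
  have h1 : (2 * NNReal.pi) ≠ 0 := by
    have : NNReal.pi ≠ 0 := NNReal.pi_ne_zero
    positivity
  have h2 : ENNReal.ofReal (Real.pi - -Real.pi) = ((2 * NNReal.pi : NNReal) : ENNReal) := by
    rw [← ENNReal.ofReal_coe_nnreal]
    congr 1
    push_cast [NNReal.coe_real_pi]
    ring
  rw [h2, ENNReal.smul_def, smul_eq_mul, ← ENNReal.coe_mul, inv_mul_cancel₀ h1]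
  rfl

lemma circleMeasure_ae_mem : ∀ᵐ x ∂circleMeasure, x ∈ Set.Ico (-Real.pi) Real.pi := by
  rw [circleMeasure]
  exact Measure.ae_smul_measure (ae_restrict_mem measurableSet_Ico) _

lemma integral_circleMeasure (f : ℝ → ℂ) :
    ∫ x, f x ∂circleMeasure = (2 * Real.pi : ℂ)⁻¹ * ∫ x in (-Real.pi)..Real.pi, f x := by
  have hpi := Real.pi_pos
  rw [circleMeasure, integral_smul_nnreal_measure, integral_Ico_eq_integral_Ioc,
    intervalIntegral.integral_of_le (by linarith), NNReal.smul_def]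
  simp [Complex.real_smul]

/-- Translations modulo `2π` preserve the measure. -/
lemma exists_measurePreserving_shift (b : ℝ) : ∃ f : ℝ → ℝ,
    MeasurePreserving f circleMeasure circleMeasure ∧
      ∀ x, ∃ k : ℤ, x + b = f x + 2 * Real.pi * k := by
  have : Fact (0 < 2 * Real.pi) := ⟨by have := Real.pi_pos; positivity⟩
  -- Project to the circle, rotate there, and lift back to a fundamental interval.
  have h1 := AddCircle.measurePreserving_mk (2 * Real.pi) (-Real.pi)
  have h2 := measurePreserving_add_right (volume : Measure (AddCircle (2 * Real.pi)))
    (b : AddCircle (2 * Real.pi))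
  have h3 := AddCircle.measurePreserving_equivIoc (2 * Real.pi) (a := -Real.pi)
  have h4 := measurePreserving_subtype_coe (μa := (volume : Measure ℝ))
    (measurableSet_Ioc (a := -Real.pi) (b := -Real.pi + 2 * Real.pi))
  have h5 := (h4.comp h3).comp (h2.comp h1)
  -- The lift takes values in an interval closed on the right, while the measure lives on one closed
  -- on the left; they differ by a null set.
  have hset : volume.restrict (Set.Ioc (-Real.pi) (-Real.pi + 2 * Real.pi)) =
      volume.restrict (Set.Ico (-Real.pi) Real.pi) := by
    rw [show -Real.pi + 2 * Real.pi = Real.pi by ring]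
    exact Measure.restrict_congr_set Ico_ae_eq_Ioc.symm
  refine ⟨fun x => toIocMod (Fact.out : 0 < 2 * Real.pi) (-Real.pi) (x + b), ?_, ?_⟩
  · rw [hset] at h5
    have := h5.smul_measure (2 * NNReal.pi)⁻¹
    exact this
  · intro x
    refine ⟨toIocDiv (Fact.out : 0 < 2 * Real.pi) (-Real.pi) (x + b), ?_⟩
    have := toIocMod_add_toIocDiv_zsmul (Fact.out : 0 < 2 * Real.pi) (-Real.pi) (x + b)
    rw [zsmul_eq_mul] at this
    linarith

lemma integral_circle_exp (k : ℤ) :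
    ∫ x, Complex.exp (Complex.I * (x * k : ℝ)) ∂circleMeasure = if k = 0 then 1 else 0 := by
  have hpi : (Real.pi : ℂ) ≠ 0 := by exact_mod_cast Real.pi_ne_zero
  rw [integral_circleMeasure]
  split_ifs with h
  · subst h
    simp
    field_simp
    ring
  · have hk : Complex.I * (k : ℂ) ≠ 0 := mul_ne_zero Complex.I_ne_zero (by exact_mod_cast h)
    have e : ∀ x : ℝ, Complex.exp (Complex.I * (x * k : ℝ)) =
        Complex.exp (Complex.I * k * x) := fun x => by
      congr 1; push_cast; ring
    simp only [e]
    rw [integral_exp_mul_complex hk]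
    have : Complex.exp (Complex.I * k * (Real.pi : ℝ)) =
        Complex.exp (Complex.I * k * ((-Real.pi : ℝ) : ℂ)) := by
      rw [Complex.exp_eq_exp_iff_exists_int]
      exact ⟨k, by push_cast; ring⟩
    rw [this]
    simp

variable {N : ℕ} [NeZero N] {L : Lattice} {r : ℕ}

instance : IsProbabilityMeasure (gaugeMeasure N L r) :=
  inferInstanceAs (IsProbabilityMeasure (Measure.pi fun _ : Cell N L r => circleMeasure))

lemma gaugeMeasure_eq : gaugeMeasure N L r = Measure.pi fun _ => circleMeasure := rfl

lemma gaugeMeasure_ae_mem : ∀ᵐ A ∂gaugeMeasure N L r, ∀ c, A c ∈ Set.Icc (-Real.pi) Real.pi := by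
  rw [ae_all_iff]
  intro c
  have h := (measurePreserving_eval (fun _ : Cell N L r => circleMeasure) c).quasiMeasurePreserving
  have h2 := h.ae circleMeasure_ae_mem
  filter_upwards [h2] with A hA
  exact Set.Ico_subset_Icc_self hA

/-- Orthogonality of the characters of the torus. -/
lemma integral_exp_dot (k : Form N L r ℤ) :
    ∫ A, Complex.exp (Complex.I * (dot A k.toReal : ℝ)) ∂gaugeMeasure N L r =
      if k = 0 then 1 else 0 := by
  have h1 : ∀ A : Form N L r ℝ, Complex.exp (Complex.I * (dot A k.toReal : ℝ)) =
      ∏ c, Complex.exp (Complex.I * (A c * k c : ℝ)) := by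
    intro A
    rw [← Complex.exp_sum, ← Finset.mul_sum, ← Complex.ofReal_sum]
    rfl
  simp only [h1, gaugeMeasure_eq]
  rw [integral_fintype_prod_eq_prod (𝕜 := ℂ) (E := fun _ : Cell N L r => ℝ)
    (fun c x => Complex.exp (Complex.I * (x * k c : ℝ)))]
  simp only [integral_circle_exp]
  rw [Finset.prod_ite_zero]
  simp [funext_iff]

/-- Integrals of periodic functions are invariant under translations. -/
lemma integral_gauge_shift (g : Form N L r ℝ → ℂ) (hg : StronglyMeasurable g)
    (hper : ∀ A (k : Form N L r ℤ), g (A + (2 * Real.pi) • k.toReal) = g A)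
    (b : Form N L r ℝ) :
    ∫ A, g (A + b) ∂gaugeMeasure N L r = ∫ A, g A ∂gaugeMeasure N L r := by
  choose f hf hfk using fun c => exists_measurePreserving_shift (b c)
  have hmp := measurePreserving_pi (fun _ : Cell N L r => circleMeasure)
    (fun _ => circleMeasure) hf
  rw [← gaugeMeasure_eq] at hmp
  have h1 : ∀ A : Form N L r ℝ, g (A + b) = g (fun c => f c (A c)) := by
    intro A
    choose k hk using fun c => hfk c (A c)
    rw [← hper (fun c => f c (A c)) k]
    congr 1
    funext c
    exact hk c
  simp only [h1]
  conv_rhs => rw [← hmp.map_eq]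
  rw [integral_map hmp.aemeasurable hg.aestronglyMeasurable]

lemma stronglyMeasurable_tsum {α ι : Type*} [MeasurableSpace α] [Countable ι] (Φ : ι → α → ℂ)
    (hm : ∀ i, StronglyMeasurable (Φ i)) (hs : ∀ a, Summable fun i => Φ i a) :
    StronglyMeasurable fun a => ∑' i, Φ i a := by
  refine stronglyMeasurable_of_tendsto (f := fun (s : Finset ι) a => ∑ i ∈ s, Φ i a)
    Filter.atTop (fun s => Finset.stronglyMeasurable_fun_sum s fun i _ => hm i) ?_
  rw [tendsto_pi_nhds]
  exact fun a => (hs a).hasSum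

lemma integrable_gauge (Φ : Form N L r ℝ → ℂ) (hc : Continuous Φ) (b : ℝ)
    (hb : ∀ A : Form N L r ℝ, (∀ c, A c ∈ Set.Icc (-Real.pi) Real.pi) → ‖Φ A‖ ≤ b) :
    Integrable Φ (gaugeMeasure N L r) :=
  Integrable.of_bound hc.aestronglyMeasurable b (by
    filter_upwards [gaugeMeasure_ae_mem] with A hA using hb A hA)

/-- The bound is required only on the box, where the gauge measure is concentrated; this matters
because the Gaussian terms are not uniformly summable over all fields. -/
lemma hasSum_integral_gauge {ι : Type*} [Countable ι] (Φ : ι → Form N L r ℝ → ℂ)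
    (hc : ∀ i, Continuous (Φ i)) (b : ι → ℝ) (hs : Summable b)
    (hb : ∀ A : Form N L r ℝ, (∀ c, A c ∈ Set.Icc (-Real.pi) Real.pi) → ∀ i, ‖Φ i A‖ ≤ b i) :
    HasSum (fun i => ∫ A, Φ i A ∂gaugeMeasure N L r)
      (∫ A, ∑' i, Φ i A ∂gaugeMeasure N L r) := by
  refine hasSum_integral_of_summable_integral_norm
    (fun i => integrable_gauge _ (hc i) (b i) fun A hA => hb A hA i) ?_
  refine Summable.of_nonneg_of_le (fun i => integral_nonneg fun _ => norm_nonneg _)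
    (fun i => ?_) hs
  have h := integral_mono_ae (μ := gaugeMeasure N L r)
    (integrable_gauge _ (hc i) (b i) fun A hA => hb A hA i).norm
    (integrable_const (b i)) (by
      filter_upwards [gaugeMeasure_ae_mem] with A hA using hb A hA i)
  simpa using h

end Torus

/-! ### Gaussian sums over integer forms -/

section GaussianSums

/-- Every finite set of integer points lies in a finite box, over which the sum factorizes. -/
lemma summable_pi_prod {ι : Type*} [Fintype ι] {f : ℤ → ℝ} (hf : Summable f)
    (h0 : ∀ n, 0 ≤ f n) : Summable fun n : ι → ℤ => ∏ i, f (n i) := by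
  classical
  refine summable_of_sum_le (c := ∏ _i : ι, ∑' n, f n)
    (fun n => Finset.prod_nonneg fun i _ => h0 _) fun s => ?_
  calc ∑ n ∈ s, ∏ i, f (n i)
      ≤ ∑ n ∈ Fintype.piFinset (fun i => s.image fun n => n i), ∏ i, f (n i) := by
        refine Finset.sum_le_sum_of_subset_of_nonneg (fun n hn => ?_)
          fun n _ _ => Finset.prod_nonneg fun i _ => h0 _
        rw [Fintype.mem_piFinset]
        exact fun i => Finset.mem_image_of_mem (fun n : ι → ℤ => n i) hn
    _ = ∏ i, ∑ k ∈ s.image (fun n => n i), f k := by rw [Finset.prod_univ_sum]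
    _ ≤ ∏ _i : ι, ∑' n, f n := Finset.prod_le_prod
        (fun i _ => Finset.sum_nonneg fun k _ => h0 k)
        fun i _ => hf.sum_le_tsum (s.image fun n => n i) fun k _ => h0 k

variable {N : ℕ} [NeZero N] {L : Lattice}

lemma summable_exp_neg_dot {c : ℝ} (hc : 0 < c) :
    Summable fun n : Form N L 2 ℤ => Real.exp (-c * dot n.toReal n.toReal) := by
  have h := summable_pi_prod (ι := Cell N L 2)
    (f := fun n : ℤ => Real.exp (-c * (n : ℝ) ^ 2)) (summable_exp_neg_sq hc)
    fun n => (Real.exp_pos _).le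
  have e : (fun n : Form N L 2 ℤ => Real.exp (-c * dot n.toReal n.toReal)) =
      fun n : Cell N L 2 → ℤ => ∏ i, Real.exp (-c * (n i : ℝ) ^ 2) := by
    funext n
    rw [← Real.exp_sum, dot, Finset.mul_sum]
    congr 1
    exact Finset.sum_congr rfl fun i _ => by rw [Form.toReal]; ring
  rw [e]
  exact h

lemma continuous_dot {α : Type*} [TopologicalSpace α] {r : ℕ} {f g : α → Form N L r ℝ}
    (hf : Continuous f) (hg : Continuous g) : Continuous fun a => dot (f a) (g a) := by
  unfold dot
  exact continuous_finsetSum _ fun c _ =>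
    ((continuous_apply c).comp hf).mul ((continuous_apply c).comp hg)

lemma continuous_extDeriv (r : ℕ) : Continuous (extDeriv : Form N L r ℝ → Form N L (r + 1) ℝ) :=
  (extDerivₗ N L r ℝ).continuous_of_finiteDimensional

/-- Half the square of 2E + 2πn is nonnegative. -/
lemma neg_dot_add_le (E : Form N L 2 ℝ) (n : Form N L 2 ℤ) :
    -dot (E + (2 * Real.pi) • n.toReal) (E + (2 * Real.pi) • n.toReal) ≤
      dot E E - 2 * Real.pi ^ 2 * dot n.toReal n.toReal := by
  have h := dot_self_nonneg ((2 : ℝ) • E + (2 * Real.pi) • n.toReal)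
  simp only [dot_add_left, dot_add_right, dot_smul_left, dot_smul_right] at h ⊢
  rw [dot_comm n.toReal E] at h ⊢
  nlinarith

/-- A continuous function on two-forms which is bounded by a Gaussian. -/
structure GaussianBounded (g : Form N L 2 ℝ → ℂ) : Prop where
  continuous : Continuous g
  bound : ∃ C κ : ℝ, 0 < κ ∧ ∀ E, ‖g E‖ ≤ C * Real.exp (-κ * dot E E)

variable {g : Form N L 2 ℝ → ℂ} (hg : GaussianBounded g)

include hg

lemma GaussianBounded.exists_summable_bound (s : Set (Form N L 1 ℝ)) (hs : IsCompact s) :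
    ∃ b : Form N L 2 ℤ → ℝ, Summable b ∧
      ∀ A ∈ s, ∀ n, ‖g (extDeriv A + (2 * Real.pi) • n.toReal)‖ ≤ b n := by
  obtain ⟨C, κ, hκ, hC⟩ := hg.bound
  have hpi := Real.pi_pos
  obtain ⟨D, hD⟩ := hs.exists_bound_of_continuousOn
    (continuous_dot (continuous_extDeriv (N := N) (L := L) 1) (continuous_extDeriv 1)).continuousOn
  have hC0 : 0 ≤ C := by
    have := (norm_nonneg _).trans (hC 0)
    exact nonneg_of_mul_nonneg_left this (Real.exp_pos _)
  refine ⟨fun n => (C * Real.exp (κ * D)) *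
    Real.exp (-(κ * (2 * Real.pi ^ 2)) * dot n.toReal n.toReal),
    (summable_exp_neg_dot (by positivity)).mul_left _, fun A hA n => (hC _).trans ?_⟩
  beta_reduce
  rw [mul_assoc, ← Real.exp_add]
  refine mul_le_mul_of_nonneg_left (Real.exp_le_exp.mpr ?_) hC0
  have h1 := neg_dot_add_le (extDeriv A) n
  have h2 := (le_abs_self _).trans (hD A hA)
  have h3 := mul_le_mul_of_nonneg_left h1 hκ.le
  have h4 := mul_le_mul_of_nonneg_left h2 hκ.le
  linarith

lemma GaussianBounded.exists_box_bound : ∃ b : Form N L 2 ℤ → ℝ, Summable b ∧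
    ∀ A : Form N L 1 ℝ, (∀ c, A c ∈ Set.Icc (-Real.pi) Real.pi) →
      ∀ n, ‖g (extDeriv A + (2 * Real.pi) • n.toReal)‖ ≤ b n := by
  obtain ⟨b, hb, h⟩ := hg.exists_summable_bound
    (Set.pi Set.univ fun _ => Set.Icc (-Real.pi) Real.pi)
    (isCompact_univ_pi fun _ => isCompact_Icc)
  exact ⟨b, hb, fun A hA => h A fun c _ => hA c⟩

lemma GaussianBounded.summable (A : Form N L 1 ℝ) :
    Summable fun n : Form N L 2 ℤ => ‖g (extDeriv A + (2 * Real.pi) • n.toReal)‖ := by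
  obtain ⟨b, hb, h⟩ := hg.exists_summable_bound {A} isCompact_singleton
  exact Summable.of_nonneg_of_le (fun _ => norm_nonneg _) (h A rfl) hb

omit hg

/-- The closed integer forms without flux. -/
def fluxless (N : ℕ) [NeZero N] (L : Lattice) : AddSubgroup (Form N L 2 ℤ) where
  carrier := {e | extDeriv e = 0 ∧ flux e.toReal = 0}
  zero_mem' := ⟨(extDerivₗ N L 2 ℤ).map_zero, by
    have := flux_smul (N := N) (L := L) 0 0
    have h0 : (0 : Form N L 2 ℤ).toReal = (0 : ℝ) • (0 : Form N L 2 ℝ) := by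
      funext c; simp [Form.toReal]
    rw [h0, this, zero_smul]⟩
  add_mem' := fun {a b} ha hb => ⟨by rw [extDeriv_add, ha.1, hb.1, add_zero], by
    rw [toReal_add, flux_add, ha.2, hb.2, add_zero]⟩
  neg_mem' := fun {a} ha => by
    have h1 : -a = (-1 : ℤ) • a := by simp
    refine ⟨by rw [h1, extDeriv_smul, ha.1, smul_zero], ?_⟩
    rw [h1, toReal_smul, flux_smul, ha.2, smul_zero]

/-- The sum of a function over the class of `dA` modulo fluxless forms. -/
def sectorSum (g : Form N L 2 ℝ → ℂ) (A : Form N L 1 ℝ) : ℂ :=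
  ∑' e : fluxless N L, g (extDeriv A + (2 * Real.pi) • e.1.toReal)

include hg

lemma GaussianBounded.continuous_term (n : Form N L 2 ℤ) :
    Continuous fun A : Form N L 1 ℝ => g (extDeriv A + (2 * Real.pi) • n.toReal) :=
  hg.continuous.comp ((continuous_extDeriv 1).add continuous_const)

lemma GaussianBounded.stronglyMeasurable_sectorSum : StronglyMeasurable (sectorSum g) :=
  stronglyMeasurable_tsum _ (fun e => (hg.continuous_term e.1).stronglyMeasurable)
    fun A => (hg.summable A).of_norm.subtype _

-- Adding 2πk to the field is absorbed by translating the fluxless form by dk. The sum over the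
-- sector, unlike its terms, therefore lives on the torus.
omit hg in
lemma sectorSum_periodic (A : Form N L 1 ℝ) (k : Form N L 1 ℤ) :
    sectorSum g (A + (2 * Real.pi) • k.toReal) = sectorSum g A := by
  have hk : extDeriv k ∈ fluxless N L := by
    refine ⟨extDeriv_extDeriv k, ?_⟩
    rw [← extDeriv_toReal, flux_extDeriv]
  rw [sectorSum, sectorSum, ← (Equiv.addRight (⟨extDeriv k, hk⟩ : fluxless N L)).tsum_eq
    fun e => g (extDeriv A + (2 * Real.pi) • e.1.toReal)]
  refine tsum_congr fun e => ?_
  congr 1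
  rw [extDeriv_add, extDeriv_smul, extDeriv_toReal, Equiv.coe_addRight, AddSubgroup.coe_add,
    toReal_add, smul_add]
  abel

lemma GaussianBounded.integral_sectorSum_shift (b : Form N L 1 ℝ) :
    ∫ A, sectorSum g (A + b) ∂gaugeMeasure N L 1 = ∫ A, sectorSum g A ∂gaugeMeasure N L 1 :=
  integral_gauge_shift _ hg.stronglyMeasurable_sectorSum sectorSum_periodic b

lemma GaussianBounded.hasSum_integral_sectorSum :
    HasSum (fun e : fluxless N L =>
      ∫ A, g (extDeriv A + (2 * Real.pi) • e.1.toReal) ∂gaugeMeasure N L 1)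
      (∫ A, sectorSum g A ∂gaugeMeasure N L 1) := by
  obtain ⟨b, hb, h⟩ := hg.exists_box_bound
  exact hasSum_integral_gauge _ (fun e => hg.continuous_term e.1) (fun e => b e.1)
    (hb.subtype _) fun A hA e => h A hA e.1

end GaussianSums
/-! ### The Gaussian sector with a source -/

section Gaussian

variable {N : ℕ} [NeZero N] {L : Lattice}

/-- The Gaussian weight with a source `J`. -/
def gaussWeight (β : ℝ) (J : Form N L 2 ℝ) (z : ℂ) (E : Form N L 2 ℝ) : ℂ :=
  Complex.exp (-(β / 2 * dot E E : ℝ) + z * (dot E J : ℝ))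

lemma norm_gaussWeight (β : ℝ) (J : Form N L 2 ℝ) (z : ℂ) (E : Form N L 2 ℝ) :
    ‖gaussWeight β J z E‖ = Real.exp (-(β / 2 * dot E E) + z.re * dot E J) := by
  rw [gaussWeight, Complex.norm_exp]
  congr 1
  simp

lemma continuous_gaussWeight (β : ℝ) (J : Form N L 2 ℝ) (z : ℂ) :
    Continuous (gaussWeight β J z) := by
  have h1 : Continuous fun E : Form N L 2 ℝ => dot E E := continuous_dot continuous_id continuous_id
  have h2 : Continuous fun E : Form N L 2 ℝ => dot E J := continuous_dot continuous_id continuous_const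
  unfold gaussWeight
  fun_prop

lemma gaussianBounded_gaussWeight {β : ℝ} (hβ : 0 < β) (J : Form N L 2 ℝ) (z : ℂ) :
    GaussianBounded (gaussWeight β J z) := by
  refine ⟨continuous_gaussWeight β J z, Real.exp (z.re ^ 2 / β * dot J J), β / 4, by positivity,
    fun E => ?_⟩
  rw [norm_gaussWeight, ← Real.exp_add]
  refine Real.exp_le_exp.mpr ?_
  -- Half of the Gaussian decay is spent on completing the square with the real part of the source.
  have h := dot_self_nonneg (β • E + (-2 * z.re) • J)
  simp only [dot_add_left, dot_add_right, dot_smul_left, dot_smul_right] at h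
  rw [dot_comm J E] at h
  have h2 : 0 ≤ (1 / (4 * β)) * (β * (β * dot E E) + -2 * z.re * (β * dot E J) +
      (β * (-2 * z.re * dot E J) + -2 * z.re * (-2 * z.re * dot J J))) :=
    mul_nonneg (by positivity) (by linarith)
  have h3 : (1 / (4 * β)) * (β * (β * dot E E) + -2 * z.re * (β * dot E J) +
      (β * (-2 * z.re * dot E J) + -2 * z.re * (-2 * z.re * dot J J))) =
      β / 4 * dot E E - z.re * dot E J + z.re ^ 2 / β * dot J J := by
    field_simp
    ring
  linarith

/-- The distribution of the source term. -/
def sourceLaw (β : ℝ) (J : Form N L 2 ℝ) : Measure ℝ :=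
  Measure.sum fun e : fluxless N L =>
    ((gaugeMeasure N L 1).withDensity fun A => ENNReal.ofReal (Real.exp
      (-(β / 2 * dot (extDeriv A + (2 * Real.pi) • e.1.toReal)
        (extDeriv A + (2 * Real.pi) • e.1.toReal))))).map
      fun A => dot (extDeriv A + (2 * Real.pi) • e.1.toReal) J

/-- The sector integral becomes the complex moment generating function of a positive measure, finite
for every `z`, so that real sources determine complex ones. -/
lemma hasSum_sourceLaw {β : ℝ} (hβ : 0 < β) (J : Form N L 2 ℝ) (z : ℂ) :
    Integrable (fun x : ℝ => Complex.exp (z * x)) (sourceLaw β J) ∧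
      ∫ x, Complex.exp (z * x) ∂sourceLaw β J =
        ∫ A, sectorSum (gaussWeight β J z) A ∂gaugeMeasure N L 1 := by
  have hE : ∀ e : fluxless N L, Continuous fun A : Form N L 1 ℝ =>
      extDeriv A + (2 * Real.pi) • e.1.toReal := fun e =>
    (continuous_extDeriv 1).add continuous_const
  have hX : ∀ e : fluxless N L, Continuous fun A : Form N L 1 ℝ =>
      dot (extDeriv A + (2 * Real.pi) • e.1.toReal) J := fun e =>
    continuous_dot (hE e) continuous_const
  have hW : ∀ e : fluxless N L, Measurable fun A : Form N L 1 ℝ => ENNReal.ofReal (Real.exp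
      (-(β / 2 * dot (extDeriv A + (2 * Real.pi) • e.1.toReal)
        (extDeriv A + (2 * Real.pi) • e.1.toReal)))) := fun e => by
    have := continuous_dot (hE e) (hE e)
    exact (ENNReal.continuous_ofReal.comp (by fun_prop)).measurable
  have hprod : ∀ (z : ℂ) (e : fluxless N L) (A : Form N L 1 ℝ),
      (ENNReal.ofReal (Real.exp (-(β / 2 * dot (extDeriv A + (2 * Real.pi) • e.1.toReal)
        (extDeriv A + (2 * Real.pi) • e.1.toReal))))).toReal •
        Complex.exp (z * (dot (extDeriv A + (2 * Real.pi) • e.1.toReal) J : ℝ)) =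
      gaussWeight β J z (extDeriv A + (2 * Real.pi) • e.1.toReal) := by
    intro z e A
    rw [ENNReal.toReal_ofReal (Real.exp_pos _).le, gaussWeight, Complex.real_smul,
      Complex.ofReal_exp, ← Complex.exp_add]
    congr 2
    push_cast
    ring
  have hm : ∀ z : ℂ, Continuous fun x : ℝ => Complex.exp (z * x) := fun z => by fun_prop
  have hint : ∀ (z : ℂ) (e : fluxless N L), Integrable (fun A : Form N L 1 ℝ =>
      gaussWeight β J z (extDeriv A + (2 * Real.pi) • e.1.toReal)) (gaugeMeasure N L 1) := by
    intro z e
    have hg := gaussianBounded_gaussWeight hβ J z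
    obtain ⟨b, hb, h⟩ := hg.exists_box_bound
    exact integrable_gauge _ (hg.continuous_term e.1) (b e.1) fun A hA => h A hA e.1
  have hI : ∀ (z : ℂ) (e : fluxless N L), ∫ x, Complex.exp (z * x)
      ∂((gaugeMeasure N L 1).withDensity fun A => ENNReal.ofReal (Real.exp
        (-(β / 2 * dot (extDeriv A + (2 * Real.pi) • e.1.toReal)
          (extDeriv A + (2 * Real.pi) • e.1.toReal))))).map
        (fun A => dot (extDeriv A + (2 * Real.pi) • e.1.toReal) J) =
      ∫ A, gaussWeight β J z (extDeriv A + (2 * Real.pi) • e.1.toReal)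
        ∂gaugeMeasure N L 1 := by
    intro z e
    rw [integral_map (hX e).measurable.aemeasurable (hm z).aestronglyMeasurable,
      integral_withDensity_eq_integral_toReal_smul (hW e)
        (Filter.Eventually.of_forall fun _ => ENNReal.ofReal_lt_top)]
    simp only [hprod]
  have hsum := fun z => (gaussianBounded_gaussWeight hβ J z).hasSum_integral_sectorSum
  have hnorm : ∀ x : ℝ, ((‖Complex.exp (z * x)‖ : ℝ) : ℂ) = Complex.exp ((z.re : ℂ) * x) := by
    intro x
    rw [Complex.norm_exp, Complex.ofReal_exp]
    simp
  have hintsum : Integrable (fun x : ℝ => Complex.exp (z * x)) (sourceLaw β J) := by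
    rw [sourceLaw, integrable_sum_measure_iff]
    constructor
    · intro e
      rw [integrable_map_measure (hm z).aestronglyMeasurable (hX e).measurable.aemeasurable,
        integrable_withDensity_iff_integrable_smul' (hW e)
          (Filter.Eventually.of_forall fun _ => ENNReal.ofReal_lt_top)]
      simp only [Function.comp_def, hprod]
      exact hint z e
    · rw [← Complex.summable_ofReal]
      refine (hsum z.re).summable.congr fun e => ?_
      rw [← hI, ← integral_complex_ofReal]
      simp only [hnorm]
  refine ⟨hintsum, ?_⟩
  have h1 := hasSum_integral_measure (hintsum)
  rw [← (hsum z).tsum_eq, sourceLaw, integral_sum_measure hintsum]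
  exact tsum_congr fun e => hI z e

/-- A real exact source is removed by the translation A ↦ A + (t/β)a, which completes the square. -/
lemma integral_gaussWeight_real {β : ℝ} (hβ : 0 < β) (a : Form N L 1 ℝ) (t : ℝ) :
    ∫ A, sectorSum (gaussWeight β (extDeriv a) t) A ∂gaugeMeasure N L 1 =
      Complex.exp ((t ^ 2 * dot (extDeriv a) (extDeriv a) / (2 * β) : ℝ)) *
        ∫ A, sectorSum (gaussWeight β (extDeriv a) 0) A ∂gaugeMeasure N L 1 := by
  rw [← (gaussianBounded_gaussWeight hβ (extDeriv a) t).integral_sectorSum_shift ((t / β) • a),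
    ← integral_const_mul]
  congr 1
  funext A
  rw [sectorSum, sectorSum, ← tsum_mul_left]
  refine tsum_congr fun e => ?_
  rw [gaussWeight, gaussWeight, ← Complex.exp_add, extDeriv_add, extDeriv_smul]
  congr 1
  have h : extDeriv A + (t / β) • extDeriv a + (2 * Real.pi) • e.1.toReal =
    (extDeriv A + (2 * Real.pi) • e.1.toReal) + (t / β) • extDeriv a := by abel
  rw [h]
  generalize extDeriv A + (2 * Real.pi) • e.1.toReal = E
  simp only [dot_add_left, dot_add_right, dot_smul_left, dot_smul_right]
  rw [dot_comm (extDeriv a) E]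
  have : (β : ℂ) ≠ 0 := by exact_mod_cast hβ.ne'
  push_cast
  field_simp
  ring

lemma exists_integral_sectorSum_pos {β : ℝ} (hβ : 0 < β) (J : Form N L 2 ℝ) : ∃ M : ℝ, 0 < M ∧
    ∫ A, sectorSum (gaussWeight β J 0) A ∂gaugeMeasure N L 1 = M := by
  have hg := gaussianBounded_gaussWeight hβ J 0
  have hsum := hg.hasSum_integral_sectorSum
  have hreal : ∀ E : Form N L 2 ℝ, gaussWeight β J 0 E = (Real.exp (-(β / 2 * dot E E)) : ℝ) := by
    intro E
    rw [gaussWeight, Complex.ofReal_exp]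
    simp
  simp only [hreal, integral_complex_ofReal] at hsum
  have hs := Complex.summable_ofReal.mp hsum.summable
  rw [← hsum.tsum_eq, ← Complex.ofReal_tsum]
  refine ⟨_, ?_, rfl⟩
  refine hs.tsum_pos (fun e => integral_nonneg fun A => (Real.exp_pos _).le) 0 ?_
  refine integral_exp_pos ?_
  obtain ⟨b, hb, h⟩ := hg.exists_box_bound
  have hi := (integrable_gauge _ (hg.continuous_term 0) (b 0) fun A hA => h A hA 0).re
  simp only [hreal, RCLike.re_eq_complex_re, Complex.ofReal_re] at hi
  exact hi

/-- No real translation removes an imaginary source. The formula for real sources is instead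
continued analytically, as an equality of moment generating functions. -/
lemma integral_gaussWeight_imag {β : ℝ} (hβ : 0 < β) (a : Form N L 1 ℝ) (c : ℝ) :
    ∫ A, sectorSum (gaussWeight β (extDeriv a) (c * Complex.I)) A ∂gaugeMeasure N L 1 =
      Complex.exp ((-(c ^ 2 * dot (extDeriv a) (extDeriv a) / (2 * β)) : ℝ)) *
        ∫ A, sectorSum (gaussWeight β (extDeriv a) 0) A ∂gaugeMeasure N L 1 := by
  obtain ⟨M, hM, hMe⟩ := exists_integral_sectorSum_pos hβ (extDeriv a)
  have hR := dot_self_nonneg (extDeriv a)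
  set R := dot (extDeriv a) (extDeriv a) with hRdef
  -- The real formula is the moment generating function of a centred Gaussian law with variance R/β
  -- and total mass M.
  set v : NNReal := ⟨R / β, div_nonneg hR hβ.le⟩ with hv
  set ν : Measure ℝ := M.toNNReal • ProbabilityTheory.gaussianReal 0 v with hν
  have hvc : (v : ℂ) = (R / β : ℝ) := rfl
  have h1 : ∀ z : ℂ, ProbabilityTheory.complexMGF id (sourceLaw β (extDeriv a)) z =
      ∫ A, sectorSum (gaussWeight β (extDeriv a) z) A ∂gaugeMeasure N L 1 := fun z =>
    (hasSum_sourceLaw hβ _ z).2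
  have h2 : ∀ z : ℂ, ProbabilityTheory.complexMGF id ν z =
      M * Complex.exp (v * z ^ 2 / 2) := fun z => by
    have := ProbabilityTheory.complexMGF_gaussianReal (p := ProbabilityTheory.gaussianReal 0 v)
      (X := id) (μ := 0) (v := v) (by simp) z
    rw [ProbabilityTheory.complexMGF] at this ⊢
    rw [hν, integral_smul_nnreal_measure, this, NNReal.smul_def, Complex.real_smul,
      Real.coe_toNNReal M hM.le]
    simp
  have hmgf : ProbabilityTheory.mgf id (sourceLaw β (extDeriv a)) = ProbabilityTheory.mgf id ν := by
    funext t
    have : ((ProbabilityTheory.mgf id (sourceLaw β (extDeriv a)) t : ℝ) : ℂ) =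
        (ProbabilityTheory.mgf id ν t : ℝ) := by
      rw [← ProbabilityTheory.complexMGF_ofReal, ← ProbabilityTheory.complexMGF_ofReal, h1, h2,
        integral_gaussWeight_real hβ, hMe, mul_comm, hvc]
      congr 2
      push_cast
      field_simp
      rw [hRdef]
    exact_mod_cast this
  -- `ProbabilityTheory.eqOn_complexMGF_of_mgf'` needs the two measures to vanish simultaneously;
  -- here both have positive mass.
  have hz : sourceLaw β (extDeriv a) = 0 ↔ ν = 0 := by
    have e1 : sourceLaw β (extDeriv a) ≠ 0 := by
      intro h
      have := h1 0
      rw [h, hMe] at this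
      simp [ProbabilityTheory.complexMGF] at this
      exact hM.ne (by exact_mod_cast this)
    have e2 : ν ≠ 0 := by
      intro h
      have := h2 0
      rw [h] at this
      simp [ProbabilityTheory.complexMGF] at this
      exact hM.ne (by exact_mod_cast this)
    exact ⟨fun h => absurd h e1, fun h => absurd h e2⟩
  have hset : ProbabilityTheory.integrableExpSet id (sourceLaw β (extDeriv a)) = Set.univ := by
    ext t
    simp only [Set.mem_univ, iff_true]
    have h := (hasSum_sourceLaw hβ (extDeriv a) t).1.norm
    refine h.congr (Filter.Eventually.of_forall fun x => ?_)
    simp [Complex.norm_exp]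
  have key := ProbabilityTheory.eqOn_complexMGF_of_mgf' hmgf hz
    (show (c * Complex.I : ℂ) ∈ _ by simp [hset])
  rw [h1, h2] at key
  rw [key, hMe, mul_comm, hvc]
  congr 2
  rw [mul_pow, Complex.I_sq]
  push_cast
  field_simp

end Gaussian
/-! ### Wilson loops as sums over the lattice -/

section Loops

variable {N : ℕ} [NeZero N] {L : Lattice} {K : Type} [CommRing K]

lemma total_cup_one_three (A : Form N L 1 K) (g : Form N L 3 K) :
    total (cup A g) = ∑ x, ∑ μ, shuffleSign K {μ} {μ}ᶜ *
      (A.coeff x {μ} * g.coeff (x.shift (vec {μ})) {μ}ᶜ) := by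
  have h := total_cup_eq (p := 1) (q := 3) rfl A g
  simp only at h
  rw [h]
  refine Finset.sum_congr rfl fun x _ => ?_
  rw [sum_powersetCard_one_cset, Fin.sum_univ_four]
  simp

lemma total_cup_three_one (g : Form N L 3 K) (A : Form N L 1 K) :
    total (cup g A) = ∑ x, ∑ μ, shuffleSign K {μ}ᶜ {μ} *
      (g.coeff (x.shift (-vec {μ}ᶜ)) {μ}ᶜ * A.coeff x {μ}) := by
  have h := total_cup_eq (p := 3) (q := 1) rfl g A
  simp only at h
  rw [h]
  have h2 : ∀ x : Site N L, ∑ T ∈ (cset true true true true).powersetCard 3,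
      shuffleSign K T (cset true true true true \ T) *
        (g.coeff x T * A.coeff (x.shift (vec T)) (cset true true true true \ T)) =
      ∑ μ, shuffleSign K {μ}ᶜ {μ} * (g.coeff x {μ}ᶜ * A.coeff (x.shift (vec {μ}ᶜ)) {μ}) := by
    intro x
    rw [sum_powersetCard_three_cset, Fin.sum_univ_four]
    simp
    ring
  simp only [h2]
  rw [Finset.sum_comm, Finset.sum_comm (s := (Finset.univ : Finset (Site N L)))]
  refine Finset.sum_congr rfl fun μ _ => ?_
  rw [← sum_shift (fun x => shuffleSign K {μ}ᶜ {μ} *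
    (g.coeff (x.shift (-vec {μ}ᶜ)) {μ}ᶜ * A.coeff x {μ})) (vec {μ}ᶜ)]
  simp

lemma dot_three (f g : Form N L 3 K) :
    dot f g = ∑ x, ∑ μ, f.coeff x {μ}ᶜ * g.coeff x {μ}ᶜ := by
  rw [dot_eq]
  refine Finset.sum_congr rfl fun x _ => ?_
  rw [show Finset.powersetCard 3 (Finset.univ : Finset (Fin 4)) =
    (cset true true true true).powersetCard 3 by rw [univ_eq_cset],
    sum_powersetCard_three_cset, Fin.sum_univ_four]
  simp
  ring

/-- The value of a function of links on an oriented link. -/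
def loopValue (φ : Site N L → Fin 4 → ℝ) (b : OrientedLink N L) : ℝ :=
  if b.positive then φ b.site b.dir else -φ (b.site.shift (-vec {b.dir})) b.dir

lemma sum_loopValue (φ : Site N L → Fin 4 → ℝ) (γ : Contour N L) :
    (γ.map (loopValue φ)).sum = ∑ x, ∑ μ, (γ.tangent x μ : ℝ) * φ x μ := by
  induction γ with
  | nil => simp [Contour.tangent]
  | cons b γ ih =>
    rw [List.map_cons, List.sum_cons, ih]
    have h1 : ∀ x μ, ((Contour.tangent (b :: γ) x μ : ℤ) : ℝ) * φ x μ =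
        (Contour.tangent γ x μ : ℝ) * φ x μ + ((if b = ⟨x, μ, true⟩ then φ x μ else 0) -
          if b = ⟨x.shift (vec {μ}), μ, false⟩ then φ x μ else 0) := by
      intro x μ
      simp only [Contour.tangent, List.count_cons, beq_iff_eq]
      split_ifs <;> push_cast <;> ring
    simp only [h1, Finset.sum_add_distrib]
    rw [add_comm]
    congr 1
    obtain ⟨y, ν, s⟩ := b
    have h2 : ∀ (x : Site N L) (μ : Fin 4), y = x.shift (vec {μ}) ↔ x = y.shift (-vec {μ}) := by
      intro x μ
      constructor <;> rintro rfl <;> simp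
    cases s
    · have h3 : ∀ x μ, (if (⟨y, ν, false⟩ : OrientedLink N L) = ⟨x.shift (vec {μ}), μ, false⟩
          then φ x μ else 0) = if x = y.shift (-vec {ν}) then (if ν = μ then φ x ν else 0)
            else 0 := by
        intro x μ
        simp only [OrientedLink.mk.injEq, and_true]
        by_cases h : ν = μ
        · subst h; simp [h2]
        · simp [h]
      simp only [h3, Finset.sum_sub_distrib]
      simp [loopValue]
    · have h3 : ∀ x μ, (if (⟨y, ν, true⟩ : OrientedLink N L) = ⟨x, μ, true⟩
          then φ x μ else 0) = if y = x then (if ν = μ then φ x μ else 0) else 0 := by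
        intro x μ
        simp only [OrientedLink.mk.injEq, and_true, ite_and]
      simp only [h3, Finset.sum_sub_distrib]
      simp [loopValue]

lemma wilson_eq_exp_sum (q : ℤ) (A : Form N L 1 ℝ) (γ : Contour N L) : wilson q A γ =
    Complex.exp (Complex.I * q * ((γ.map (linkValue A)).sum : ℝ)) := by
  induction γ with
  | nil => simp [wilson]
  | cons b γ ih =>
    rw [wilson, List.map_cons, List.prod_cons, List.map_cons, List.sum_cons]
    rw [wilson] at ih
    rw [ih, ← Complex.exp_add]
    congr 1
    push_cast
    ring

/-- The contour `γ` bounds a surface to which `l` is dual: with the framing that corresponds to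
`F` (`s = true`) or to `F̃` (`s = false`). -/
def Bounds (s : Bool) (l : Form N L 2 ℤ) (γ : Contour N L) : Prop :=
  ∀ x μ, γ.tangent x μ = if s then
    -(shuffleSign ℤ {μ} {μ}ᶜ * (extDeriv l).coeff (x.shift (vec {μ})) {μ}ᶜ)
    else shuffleSign ℤ {μ}ᶜ {μ} * (extDeriv l).coeff (x.shift (-vec {μ}ᶜ)) {μ}ᶜ

lemma shuffleSign_cast (S T : Finset (Fin 4)) :
    ((shuffleSign ℤ S T : ℤ) : ℝ) = shuffleSign ℝ S T := by
  simp [shuffleSign]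

variable {s : Bool} {l : Form N L 2 ℤ} {γ : Contour N L}

/-- Stokes' theorem: the tangent is dual to dl, and summation by parts moves the derivative to `A`.
The framing decides on which side of the cup product `l` stands. -/
lemma Bounds.wilson_electric (h : Bounds s l γ) (q : ℤ) (A : Form N L 1 ℝ) : wilson q A γ =
    Complex.exp (-(Complex.I * q * (pairing s (extDeriv A) l.toReal : ℝ))) := by
  have h1 : (γ.map (linkValue A)).sum = -pairing s (extDeriv A) l.toReal := by
    have := sum_loopValue (fun x μ => A.coeff x {μ}) γ
    refine this.trans ?_
    cases s
    · simp only [pairing, Bool.false_eq_true, if_false]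
      rw [total_cup_extDeriv_right, neg_neg, total_cup_three_one]
      refine Finset.sum_congr rfl fun x _ => Finset.sum_congr rfl fun μ _ => ?_
      rw [h x μ]
      simp only [Bool.false_eq_true, if_false, extDeriv_toReal, Form.coeff_toReal]
      push_cast [shuffleSign_cast]
      ring
    · simp only [pairing, if_true]
      rw [total_cup_extDeriv_left, total_cup_one_three, ← Finset.sum_neg_distrib]
      refine Finset.sum_congr rfl fun x _ => ?_
      rw [← Finset.sum_neg_distrib]
      refine Finset.sum_congr rfl fun μ _ => ?_
      rw [h x μ]
      simp only [if_true, extDeriv_toReal, Form.coeff_toReal]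
      push_cast [shuffleSign_cast]
      ring
  rw [wilson_eq_exp_sum, h1]
  push_cast
  ring_nf

/-- The displaced contour runs through precisely the dual links on which dl is supported, so the
magnetic loop couples to dl as the action couples to dn. -/
lemma Bounds.wilson_magnetic (h : Bounds s l γ) (q : ℤ) (Am : Form N L 3 ℝ) :
    wilson q (magneticField Am) (if s then γ.F else γ.Ft) =
    Complex.exp (Complex.I * q * (dot Am (extDeriv l).toReal : ℝ)) := by
  have h0 : ∀ (y : Site N L.flip) (μ : Fin 4), (magneticField Am).coeff y {μ} =
      shuffleSign ℝ {μ}ᶜ {μ} * Am.coeff ((Site.F.symm y).shift (vec {μ})) {μ}ᶜ := by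
    intro y μ
    rw [Form.coeff_of_card _ _ _ (by simp), magneticField, Finset.sum_singleton]
  -- Moving one direction past three others gives an odd permutation.
  have hsgn : ∀ μ : Fin 4, shuffleSign ℝ {μ} {μ}ᶜ * shuffleSign ℝ {μ}ᶜ {μ} = -1 := by
    intro μ
    fin_cases μ <;> simp [shuffleSign_cset, pow_succ]
  have hsq : ∀ μ : Fin 4, shuffleSign ℝ {μ}ᶜ {μ} * shuffleSign ℝ {μ}ᶜ {μ} = 1 := by
    intro μ
    rw [shuffleSign, ← mul_pow]; simp
  have hvec : ∀ μ : Fin 4, (-vec Finset.univ + vec {μ} : Fin 4 → ZMod N) = -vec {μ}ᶜ := by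
    intro μ
    funext ν
    by_cases hν : ν = μ <;> simp [vec, hν]
  have hF : ∀ (x : Site N L) (v : Fin 4 → ZMod N), (x.shift v).F = x.F.shift v := by
    intro x v
    ext; simp [Site.F, Site.shift]; ring
  have h1 : (((if s then γ.F else γ.Ft) : Contour N L.flip).map
      (linkValue (magneticField Am))).sum = dot Am (extDeriv l).toReal := by
    rw [dot_three]
    cases s
    · simp only [Bool.false_eq_true, if_false, Contour.Ft, List.map_map]
      have hc : (linkValue (magneticField Am) ∘ fun b : OrientedLink N L =>
          (⟨b.site.Ft, b.dir, b.positive⟩ : OrientedLink N L.flip)) =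
          loopValue fun x μ => (magneticField Am).coeff x.Ft {μ} := by
        funext b
        simp only [Function.comp_apply, linkValue, loopValue, Site.Ft, ← hF, Site.shift_shift,
          add_comm]
      rw [hc, sum_loopValue, Finset.sum_comm,
        Finset.sum_comm (s := (Finset.univ : Finset (Site N L)))]
      refine Finset.sum_congr rfl fun μ _ => ?_
      rw [← sum_shift (fun x => Am.coeff x {μ}ᶜ * (extDeriv l).toReal.coeff x {μ}ᶜ)
        (-vec {μ}ᶜ)]
      refine Finset.sum_congr rfl fun x _ => ?_
      rw [h x μ, h0, Site.Ft, Equiv.symm_apply_apply, Site.shift_shift, hvec]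
      simp only [Bool.false_eq_true, if_false, Form.coeff_toReal]
      push_cast [shuffleSign_cast]
      linear_combination (Am.coeff (x.shift (-vec {μ}ᶜ)) {μ}ᶜ *
        ((extDeriv l).coeff (x.shift (-vec {μ}ᶜ)) {μ}ᶜ : ℝ)) * hsq μ
    · simp only [if_true, Contour.F, List.map_map]
      have hc : (linkValue (magneticField Am) ∘ fun b : OrientedLink N L =>
          (⟨b.site.F, b.dir, b.positive⟩ : OrientedLink N L.flip)) =
          loopValue fun x μ => (magneticField Am).coeff x.F {μ} := by
        funext b
        simp only [Function.comp_apply, linkValue, loopValue, ← hF]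
      rw [hc, sum_loopValue, Finset.sum_comm,
        Finset.sum_comm (s := (Finset.univ : Finset (Site N L)))]
      refine Finset.sum_congr rfl fun μ _ => ?_
      rw [← sum_shift (fun x => Am.coeff x {μ}ᶜ * (extDeriv l).toReal.coeff x {μ}ᶜ)
        (vec {μ})]
      refine Finset.sum_congr rfl fun x _ => ?_
      rw [h x μ, h0, Equiv.symm_apply_apply]
      simp only [if_true, Form.coeff_toReal]
      push_cast [shuffleSign_cast]
      linear_combination -(Am.coeff (x.shift (vec {μ})) {μ}ᶜ *
        ((extDeriv l).coeff (x.shift (vec {μ})) {μ}ᶜ : ℝ)) * hsgn μ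
  rw [wilson_eq_exp_sum, h1]

omit [NeZero N] in
lemma IsSeifert.bounds (h : IsSeifert l γ) : Bounds true l γ := by
  intro x μ
  simp only [if_true]
  rw [h x μ, neg_neg]

omit [NeZero N] in
/-- The dual form of the same surface for the contour on the dual lattice. -/
lemma IsSeifert.bounds_F {γ : Contour N Lattice.primal} {l : Form N Lattice.primal 2 ℤ}
    (h : IsSeifert l γ) : Bounds false (transport (vec Finset.univ) Lattice.primal.flip l) γ.F := by
  intro x μ
  have ht : γ.F.tangent x μ = γ.tangent ⟨x.coord⟩ μ := by
    have hinj : Function.Injective fun b : OrientedLink N Lattice.primal =>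
        (⟨b.site.F, b.dir, b.positive⟩ : OrientedLink N Lattice.primal.flip) := by
      rintro ⟨a, b, c⟩ ⟨a', b', c'⟩ hab
      simpa using hab
    have h1 : ∀ (y : Site N Lattice.primal) (s : Bool),
        γ.F.count ⟨y.F, μ, s⟩ = γ.count ⟨y, μ, s⟩ := fun y s =>
      List.count_map_of_injective γ _ hinj ⟨y, μ, s⟩
    have h2 : ∀ v : Fin 4 → ZMod N, x.shift v =
        ((⟨x.coord⟩ : Site N Lattice.primal).shift v).F := by
      intro v
      ext; simp [Site.F, Site.shift, halfCarry]
    have h3 : x = (⟨x.coord⟩ : Site N Lattice.primal).F := by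
      ext; simp [Site.F, halfCarry]
    simp only [Contour.tangent]
    rw [← h1, ← h1, ← h2, ← h3]
  have hsgn : shuffleSign ℤ {μ} {μ}ᶜ = -shuffleSign ℤ {μ}ᶜ {μ} := by
    fin_cases μ <;> simp [shuffleSign_cset, pow_succ]
  -- The translation by ŝ carries the base point used in the opposite framing to the one in the
  -- monopole equation.
  have hvec : (-vec {μ}ᶜ + vec Finset.univ : Fin 4 → ZMod N) = vec {μ} := by
    funext ν
    by_cases hν : ν = μ <;> simp [vec, hν]
  have hs := h ⟨x.coord⟩ μ
  simp only [Bool.false_eq_true, if_false]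
  rw [ht, extDeriv_transport, coeff_transport]
  have he : (⟨(x.shift (-vec {μ}ᶜ)).coord + vec Finset.univ⟩ : Site N Lattice.primal) =
      (⟨x.coord⟩ : Site N Lattice.primal).shift (vec {μ}) := by
    simp only [Site.shift, add_assoc, hvec]
  rw [he]
  rw [hsgn] at hs
  linarith

end Loops
/-! ### Integration over the magnetic gauge field -/

section MagneticIntegral

variable {N : ℕ} [NeZero N] {L : Lattice} (s : Bool) (β θ : ℝ) (p qe qm : ℤ)

/-- The expectation value of a dyonic loop with either framing. -/
def framedEv (γ : Contour N L) : ℂ :=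
  (∫ Ae, ∫ Am, ∑' n : Form N L 2 ℤ,
    boltzmann β θ p (framedCharge s Ae n) Ae Am n *
      (wilson qe Ae γ * wilson qm (magneticField Am) (if s then γ.F else γ.Ft))
      ∂(gaugeMeasure N L 3) ∂(gaugeMeasure N L 1)) / partitionFunction N L β θ

lemma framedEv_true (γ : Contour N L) : framedEv true β θ p qe qm γ = evDyonic β θ p qe qm γ :=
  rfl

lemma framedEv_false (γ : Contour N L) :
    framedEv false β θ p qe qm γ = evDualDyonic β θ p qe qm γ :=
  rfl

variable (l : Form N L 2 ℤ)

/-- The weight of an integer form without the monopole constraint. -/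
def electricWeight (A : Form N L 1 ℝ) (n : Form N L 2 ℤ) : ℂ :=
  Complex.exp (-(β / 2 * dot (fieldStrength A n) (fieldStrength A n) : ℝ) -
    Complex.I * (θ * framedCharge s A n + p * Real.pi * (pontryagin n : ℤ) +
      qe * pairing s (extDeriv A) l.toReal : ℝ))

lemma norm_electricWeight (A : Form N L 1 ℝ) (n : Form N L 2 ℤ) :
    ‖electricWeight s β θ p qe l A n‖ =
      ‖gaussWeight β 0 0 (extDeriv A + (2 * Real.pi) • n.toReal)‖ := by
  rw [norm_gaussWeight, electricWeight, Complex.norm_exp, fieldStrength_eq]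
  congr 1
  simp

/-- The electric part of the integrand, for which the monopole world lines are fixed. -/
def electricTerm (A : Form N L 1 ℝ) (n : Form N L 2 ℤ) : ℂ :=
  open Classical in
  if extDeriv n = qm • extDeriv l then electricWeight s β θ p qe l A n else 0

/-- The electric integral. -/
def electricIntegral : ℂ :=
  ∫ A, ∑' n : Form N L 2 ℤ, electricTerm s β θ p qe qm l A n ∂gaugeMeasure N L 1

variable {s β l}

lemma dot_bdry_fieldStrength (A : Form N L 1 ℝ) (Am : Form N L 3 ℝ) (n : Form N L 2 ℤ) :
    dot (bdry Am) (fieldStrength A n) = -(2 * Real.pi * dot Am (extDeriv n).toReal) := by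
  rw [dot_bdry_two, fieldStrength_eq, extDeriv_add, extDeriv_extDeriv, zero_add, extDeriv_smul,
    extDeriv_toReal, dot_smul_right]

/-- The magnetic field is a Lagrange multiplier: it enters through the character with integer charge
q_m dl - dn, whose torus integral vanishes unless that charge is zero. -/
lemma integral_magnetic (hβ : 0 < β) {γ : Contour N L} (h : Bounds s l γ) (A : Form N L 1 ℝ) :
    ∫ Am, ∑' n : Form N L 2 ℤ, boltzmann β θ p (framedCharge s A n) A Am n *
      (wilson qe A γ * wilson qm (magneticField Am) (if s then γ.F else γ.Ft))
      ∂(gaugeMeasure N L 3) = ∑' n : Form N L 2 ℤ, electricTerm s β θ p qe qm l A n := by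
  have h1 : ∀ (Am : Form N L 3 ℝ) (n : Form N L 2 ℤ),
      boltzmann β θ p (framedCharge s A n) A Am n *
        (wilson qe A γ * wilson qm (magneticField Am) (if s then γ.F else γ.Ft)) =
      electricWeight s β θ p qe l A n *
        Complex.exp (Complex.I * (dot Am (qm • extDeriv l - extDeriv n).toReal : ℝ)) := by
    intro Am n
    have hk : (qm • extDeriv l - extDeriv n).toReal =
        (qm : ℝ) • (extDeriv l).toReal + (-1 : ℝ) • (extDeriv n).toReal := by
      funext c
      simp [Form.toReal]
      ring
    rw [h.wilson_electric, h.wilson_magnetic, boltzmann, electricWeight, ← Complex.exp_add,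
      ← Complex.exp_add, ← Complex.exp_add, dot_bdry_fieldStrength, hk, dot_add_right,
      dot_smul_right, dot_smul_right]
    congr 1
    have : (Real.pi : ℂ) ≠ 0 := by exact_mod_cast Real.pi_ne_zero
    push_cast
    field_simp
    ring
  simp only [h1]
  have hsum := hasSum_integral_gauge (N := N) (L := L) (r := 3)
    (fun (n : Form N L 2 ℤ) (Am : Form N L 3 ℝ) => electricWeight s β θ p qe l A n *
      Complex.exp (Complex.I * (dot Am (qm • extDeriv l - extDeriv n).toReal : ℝ)))
    (fun n => by
      have : Continuous fun Am : Form N L 3 ℝ => dot Am (qm • extDeriv l - extDeriv n).toReal :=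
        continuous_dot continuous_id continuous_const
      fun_prop)
    _ ((gaussianBounded_gaussWeight hβ (0 : Form N L 2 ℝ) 0).summable A)
    (fun Am _ n => by
      rw [norm_mul, norm_electricWeight, Complex.norm_exp]
      simp)
  rw [← hsum.tsum_eq]
  refine tsum_congr fun n => ?_
  rw [integral_const_mul, integral_exp_dot, electricTerm]
  simp only [sub_eq_zero, eq_comm (a := qm • extDeriv l)]
  split_ifs <;> simp

/-- For zero charges the constraint is dn = 0. The `∪₁` term then drops out, so all versions of the
charge agree, and `s` and `l` may be chosen freely. -/
lemma partitionFunction_eq : partitionFunction N L β θ = electricIntegral s β θ 0 0 0 l := by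
  rw [partitionFunction, electricIntegral]
  congr 1
  funext A
  refine tsum_congr fun n => ?_
  rw [electricTerm]
  simp only [zero_smul]
  refine if_ctx_congr Iff.rfl (fun hn => ?_) fun _ => rfl
  have hQ : framedCharge s A n = chargeZero (fieldStrength A n) := by
    have h0 : extDeriv n.toReal = (0 : ℝ) • (0 : Form N L 3 ℝ) := by
      rw [extDeriv_toReal, hn]; funext c; simp [Form.toReal]
    rw [framedCharge_eq, chargeZero, h0, cupOne_smul_right]
    erw [total_smul]
    simp [pairing]
  rw [electricWeight, hQ]
  congr 1
  push_cast
  ring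

lemma framedEv_eq (hβ : 0 < β) {γ : Contour N L} (h : Bounds s l γ) :
    framedEv s β θ p qe qm γ =
      electricIntegral s β θ p qe qm l / electricIntegral s β θ 0 0 0 l := by
  rw [framedEv, partitionFunction_eq (s := s) (l := l), electricIntegral, electricIntegral]
  simp only [integral_magnetic θ p qe qm hβ h]

end MagneticIntegral

/-! ### Evaluation of the electric integral -/

section Evaluation

variable {N : ℕ} [NeZero N] {L : Lattice} {s : Bool} {β : ℝ} (θ : ℝ) (p qe qm : ℤ)
  (l : Form N L 2 ℤ)

lemma GaussianBounded.comp_add {g : Form N L 2 ℝ → ℂ} (hg : GaussianBounded g)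
    (D : Form N L 2 ℝ) : GaussianBounded fun E => g (E + D) := by
  obtain ⟨C, κ, hκ, hC⟩ := hg.bound
  have hC0 : 0 ≤ C := nonneg_of_mul_nonneg_left ((norm_nonneg _).trans (hC 0)) (Real.exp_pos _)
  refine ⟨hg.continuous.comp (continuous_id.add continuous_const),
    C * Real.exp (κ * dot D D), κ / 2, by positivity, fun E => (hC _).trans ?_⟩
  rw [mul_assoc, ← Real.exp_add]
  refine mul_le_mul_of_nonneg_left (Real.exp_le_exp.mpr ?_) hC0
  have h := dot_self_nonneg (E + (2 : ℝ) • D)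
  simp only [dot_add_left, dot_add_right, dot_smul_left, dot_smul_right] at h ⊢
  rw [dot_comm D E] at h ⊢
  have := mul_nonneg hκ.le h
  nlinarith

/-- The individual terms are not periodic; the shift can be removed only after summing over the
fluxless forms. -/
lemma GaussianBounded.tsum_integral_shift {g : Form N L 2 ℝ → ℂ} (hg : GaussianBounded g)
    (b : Form N L 1 ℝ) :
    ∑' e : fluxless N L, ∫ A, g (extDeriv (A + b) + (2 * Real.pi) • e.1.toReal)
      ∂gaugeMeasure N L 1 = ∫ A, sectorSum g A ∂gaugeMeasure N L 1 := by
  rw [← hg.integral_sectorSum_shift b]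
  have h := (hg.comp_add (extDeriv b)).hasSum_integral_sectorSum
  have e1 : ∀ (A : Form N L 1 ℝ) (n : Form N L 2 ℤ),
      extDeriv A + (2 * Real.pi) • n.toReal + extDeriv b =
        extDeriv (A + b) + (2 * Real.pi) • n.toReal := by
    intro A n
    rw [extDeriv_add]; abel
  simp only [sectorSum, e1] at h ⊢
  exact h.tsum_eq

lemma exactPart_add (f g : Form N L 2 ℝ) : exactPart (f + g) = exactPart f + exactPart g := by
  have : meanForm (f + g) = meanForm f + meanForm g := by
    funext c
    simp [meanForm, Finset.sum_add_distrib, mul_add]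
  rw [exactPart, exactPart, exactPart, this]
  abel

lemma exactPart_of_flux_eq_zero (f : Form N L 2 ℝ) (hf : flux f = 0) : exactPart f = f := by
  have h : meanForm f = 0 := by
    apply eq_zero_of_dot_self
    rw [dot_meanForm_left, flux_meanForm, hf]
    simp [Flux.inner]
  rw [exactPart, h, sub_zero]

/-- The solutions of the monopole constraint. -/
def monopoleConfig (x : Flux ℤ × fluxless N L) : Form N L 2 ℤ :=
  qm • l + fluxForm N L x.1 + x.2.1

lemma extDeriv_monopoleConfig (x : Flux ℤ × fluxless N L) :
    extDeriv (monopoleConfig qm l x) = qm • extDeriv l := by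
  rw [monopoleConfig, extDeriv_add, extDeriv_add, extDeriv_smul, extDeriv_fluxForm, x.2.2.1]
  simp

lemma monopoleConfig_injective : Function.Injective (monopoleConfig qm l) := by
  intro x y h
  simp only [monopoleConfig, add_assoc, add_right_inj] at h
  have h1 : x.1 = y.1 := by
    have h2 := congrArg (fun n => flux (Form.toReal n)) h
    simp only [toReal_add, flux_add, flux_fluxForm, x.2.2.2, y.2.2.2, add_zero] at h2
    exact toReal_flux_injective h2
  rw [h1, add_right_inj] at h
  exact Prod.ext h1 (Subtype.ext h)

/-- The difference of `n` and q_m l is closed, so its fluxes are integral; subtracting the standard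
form with these fluxes leaves a fluxless one. -/
lemma exists_monopoleConfig_eq (n : Form N L 2 ℤ) (hn : extDeriv n = qm • extDeriv l) :
    ∃ x, monopoleConfig qm l x = n := by
  have hd : extDeriv (n - qm • l) = 0 := by
    rw [extDeriv_sub, extDeriv_smul, hn, sub_self]
  obtain ⟨m, hm⟩ := exists_flux_eq_toReal _ hd
  have he : n - qm • l - fluxForm N L m ∈ fluxless N L := by
    refine ⟨by rw [extDeriv_sub, hd, extDeriv_fluxForm, sub_zero], ?_⟩
    have h1 : (n - qm • l - fluxForm N L m).toReal =
        (n - qm • l).toReal + (-1 : ℝ) • (fluxForm N L m).toReal := by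
      funext c
      simp [Form.toReal]
      ring
    rw [h1, flux_add, flux_smul, hm, flux_fluxForm]
    simp
  exact ⟨(m, ⟨_, he⟩), by simp [monopoleConfig]⟩

/-- The prefactor of the sum over the fluxes. -/
def prefactor (s : Bool) (β θ : ℝ) (p qe qm : ℤ) (l : Form N L 2 ℤ) : ℂ :=
  Complex.exp (-(β / 2 * ((2 * Real.pi * qm) ^ 2 * normSq l) : ℝ) -
    Complex.I * (θ * (framingSign s * qm ^ 2 * uOf l / 2) + p * Real.pi * (qm ^ 2 * vOf l) +
      2 * Real.pi * qe * qm * crossPairing l s : ℝ))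

/-- The weight factorizes into the contributions of P_∂ l, of the fluxes and of the exact part. The
loop couples the exact part to `J` with strength q_e, and the θ-term adds θ q_m/2π (Witten effect).
The exact part due to `closedPart l` and the flux form becomes a shift `b` of the gauge field. -/
lemma electricWeight_monopoleConfig (J : Form N L 2 ℝ)
    (hJ : ∀ f, pairing s f (projBdry l.toReal) = dot f J) (A b : Form N L 1 ℝ)
    (x : Flux ℤ × fluxless N L)
    (hb : exactPart ((2 * Real.pi) • ((qm : ℝ) • closedPart l + (fluxForm N L x.1).toReal)) =
      extDeriv b) :
    electricWeight s β θ p qe l A (monopoleConfig qm l x) =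
      prefactor s β θ p qe qm l * thetaSixTerm β θ qe qm (flux l.toReal) x.1 *
        gaussWeight β J (((-(qe + θ * qm / (2 * Real.pi)) : ℝ) : ℂ) * Complex.I)
          (extDeriv (A + b) + (2 * Real.pi) • x.2.1.toReal) := by
  have hpi := Real.pi_ne_zero
  set n := monopoleConfig qm l x with hn
  have hdn : extDeriv n = qm • extDeriv l := extDeriv_monopoleConfig qm l x
  set f : Form N L 2 ℝ := (2 * Real.pi) • ((qm : ℝ) • closedPart l + (fluxForm N L x.1).toReal) +
    (extDeriv A + (2 * Real.pi) • x.2.1.toReal) with hfdef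
  have hzero : ∀ k : Form N L 2 ℤ, extDeriv k = 0 → extDeriv k.toReal = 0 := by
    intro k hk
    rw [extDeriv_toReal, hk]; funext c; simp [Form.toReal]
  have hf : extDeriv f = 0 := by
    rw [hfdef, extDeriv_add, extDeriv_add, extDeriv_smul, extDeriv_smul, extDeriv_add,
      extDeriv_smul, extDeriv_closedPart, extDeriv_extDeriv, hzero _ (extDeriv_fluxForm _),
      hzero _ x.2.2.1]
    simp
  have hF : fieldStrength A n = (2 * Real.pi * qm) • projBdry l.toReal + f := by
    rw [fieldStrength_eq, hn, monopoleConfig, toReal_add, toReal_add, toReal_smul, hfdef]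
    conv_lhs => rw [toReal_eq_add l]
    module
  have hflux : flux f = (2 * Real.pi) • (x.1.toReal + (qm : ℝ) • flux l.toReal) := by
    rw [hfdef, flux_add, flux_add, flux_smul, flux_smul, flux_add, flux_smul, flux_closedPart,
      flux_fluxForm, flux_extDeriv, x.2.2.2]
    module
  have hE : exactPart f = extDeriv (A + b) + (2 * Real.pi) • x.2.1.toReal := by
    rw [hfdef, exactPart_add, hb, exactPart_of_flux_eq_zero _ (by
      rw [flux_add, flux_extDeriv, flux_smul, x.2.2.2]; simp), extDeriv_add]
    abel
  have hdot := dot_field_self l qm f hf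
  have hQ := framedCharge_field l qm A f hf s n hF hdn
  have hP := pairing_field_toReal l qm f hf s
  rw [← hF] at hdot hP
  rw [hJ] at hQ hP
  obtain ⟨k, hk⟩ := pontryagin_add_closed l (fluxForm N L x.1 + x.2.1) qm (by
    rw [extDeriv_add, extDeriv_fluxForm, x.2.2.1, add_zero])
  rw [← add_assoc] at hk
  change pontryagin n = _ at hk
  -- Replacing dA by the full field strength costs only 2π times an integer, which the integral
  -- charge q_e makes invisible.
  have hA : pairing s (extDeriv A) l.toReal =
      pairing s (fieldStrength A n) l.toReal - 2 * Real.pi * (pairing s n l : ℤ) := by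
    rw [fieldStrength_eq, pairing_add_left, pairing_smul_left, pairing_toReal]
    ring
  rw [hE] at hdot hQ hP
  rw [hflux, inner_smul_smul] at hdot
  rw [hflux, wedge_smul_left, wedge_smul_right] at hQ
  rw [hflux, wedge_smul_left] at hP
  rw [electricWeight, hA, hP, hQ, hk, hdot, prefactor, thetaSixTerm, gaussWeight,
    ← Complex.exp_add, ← Complex.exp_add, Complex.exp_eq_exp_iff_exists_int]
  -- The first term comes from replacing dA by F, the second from 𝔓(n) ≡ q_m² v modulo two.
  refine ⟨qe * pairing s n l - p * k, ?_⟩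
  have hpic : (Real.pi : ℂ) ≠ 0 := by exact_mod_cast hpi
  push_cast
  field_simp
  ring

lemma gaussWeight_zero (J : Form N L 2 ℝ) : gaussWeight β J 0 = gaussWeight β 0 0 := by
  funext E
  simp [gaussWeight]

/-- The sum over the fluxless sector without sources. -/
def sectorIntegral (N : ℕ) [NeZero N] (L : Lattice) (β : ℝ) : ℂ :=
  ∫ A, sectorSum (gaussWeight β (0 : Form N L 2 ℝ) 0) A ∂gaugeMeasure N L 1

lemma sectorIntegral_ne_zero (hβ : 0 < β) : sectorIntegral N L β ≠ 0 := by
  obtain ⟨M, hM, h⟩ := exists_integral_sectorSum_pos (N := N) (L := L) hβ 0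
  rw [sectorIntegral, h]
  exact_mod_cast hM.ne'

lemma continuous_coeff {r : ℕ} (x : Site N L) (S : Finset (Fin 4)) :
    Continuous fun f : Form N L r ℝ => f.coeff x S := by
  unfold Form.coeff
  split_ifs
  · exact continuous_apply _
  · exact continuous_const

lemma continuous_rightStar : Continuous (rightStar : Form N L 2 ℝ → Form N L 2 ℝ) :=
  continuous_pi fun _ => continuous_const.mul (continuous_coeff _ _)

lemma continuous_pairing {f g : Form N L 1 ℝ → Form N L 2 ℝ} (hf : Continuous f)
    (hg : Continuous g) : Continuous fun A => pairing s (f A) (g A) := by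
  have h : ∀ {f g : Form N L 1 ℝ → Form N L 2 ℝ}, Continuous f → Continuous g →
      Continuous fun A => pairing true (f A) (g A) := by
    intro f g hf hg
    simp only [pairing_eq_dot, if_true]
    exact continuous_dot hf (continuous_rightStar.comp hg)
  cases s
  · have e : (fun A => pairing false (f A) (g A)) = fun A => pairing true (g A) (f A) := by
      funext A
      exact pairing_not true (f A) (g A)
    rw [e]
    exact h hg hf
  · exact h hf hg

lemma continuous_total_cupOne (h : Form N L 3 ℝ) :
    Continuous fun f : Form N L 2 ℝ => total (cupOne f h) := by
  let T : Form N L 2 ℝ →ₗ[ℝ] ℝ :=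
    { toFun := fun f => total (cupOne f h)
      map_add' := fun f f' => by
        rw [cupOne_add_left]
        exact total_add _ _
      map_smul' := fun a f => by
        rw [cupOne_smul_left]
        exact total_smul _ _ }
  exact T.continuous_of_finiteDimensional

lemma continuous_electricWeight (n : Form N L 2 ℤ) :
    Continuous fun A : Form N L 1 ℝ => electricWeight s β θ p qe l A n := by
  have hd := continuous_extDeriv (N := N) (L := L) 1
  have hF : Continuous fun A : Form N L 1 ℝ => fieldStrength A n :=
    hd.add continuous_const
  have h1 := continuous_dot hF hF
  have h2 := continuous_pairing (s := true) hF hF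
  have h3 := (continuous_total_cupOne (extDeriv n.toReal)).comp hF
  have h4 := continuous_pairing (s := s) hd (continuous_const (y := l.toReal))
  unfold electricWeight
  simp only [framedCharge_eq]
  simp only [Function.comp_def] at h3
  fun_prop

/-- Parametrize the allowed `n` by a flux and a fluxless form. The shift `b` varies with the flux
but disappears under the torus integral, so every flux sector carries the same Gaussian factor. -/
lemma electricIntegral_eq (hβ : 0 < β) : electricIntegral s β θ p qe qm l =
    prefactor s β θ p qe qm l * thetaSix β θ qe qm (flux l.toReal) *
      Complex.exp (-((qe + θ * qm / (2 * Real.pi)) ^ 2 * normSq l / (2 * β)) : ℝ) *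
        sectorIntegral N L β := by
  obtain ⟨B, hB⟩ := projBdry_mem l.toReal
  obtain ⟨a, ha, haa⟩ := exists_source s B
  rw [← hB] at ha haa
  have hR : dot (extDeriv a) (extDeriv a) = normSq l := haa
  set c : ℝ := -(qe + θ * qm / (2 * Real.pi)) with hc
  have hg := gaussianBounded_gaussWeight hβ (extDeriv a) ((c : ℂ) * Complex.I)
  have hcont : ∀ n : Form N L 2 ℤ, Continuous fun A => electricTerm s β θ p qe qm l A n := by
    intro n
    unfold electricTerm
    split_ifs
    · exact continuous_electricWeight θ p qe l n
    · exact continuous_const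
  -- Charge, Pontryagin and Wilson terms are pure phases, so the Gaussian without source dominates.
  obtain ⟨bd, hbd, hbd'⟩ :=
    (gaussianBounded_gaussWeight hβ (0 : Form N L 2 ℝ) 0).exists_box_bound
  have hsum := hasSum_integral_gauge (fun (n : Form N L 2 ℤ) A => electricTerm s β θ p qe qm l A n)
    hcont bd hbd (fun A hA n => by
      refine le_trans ?_ (hbd' A hA n)
      rw [electricTerm]
      split_ifs
      · rw [norm_electricWeight]
      · simp)
  choose b hb using fun m : Flux ℤ => exists_exactPart_eq
    ((2 * Real.pi) • ((qm : ℝ) • closedPart l + (fluxForm N L m).toReal)) (by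
      rw [extDeriv_smul, extDeriv_add, extDeriv_smul, extDeriv_closedPart, extDeriv_toReal,
        extDeriv_fluxForm]
      funext c; simp [Form.toReal])
  have hterm : ∀ (x : Flux ℤ × fluxless N L) (A : Form N L 1 ℝ),
      electricTerm s β θ p qe qm l A (monopoleConfig qm l x) =
      prefactor s β θ p qe qm l * thetaSixTerm β θ qe qm (flux l.toReal) x.1 *
        gaussWeight β (extDeriv a) ((c : ℂ) * Complex.I)
          (extDeriv (A + b x.1) + (2 * Real.pi) • x.2.1.toReal) := by
    intro x A
    rw [electricTerm, if_pos (extDeriv_monopoleConfig qm l x),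
      electricWeight_monopoleConfig θ p qe qm l (extDeriv a) ha A (b x.1) x (hb x.1)]
  have hsupp : Function.support (fun n : Form N L 2 ℤ =>
      ∫ A, electricTerm s β θ p qe qm l A n ∂gaugeMeasure N L 1) ⊆
      Set.range (monopoleConfig qm l) := by
    intro n hn
    by_contra hx
    refine hn ?_
    have : ¬ extDeriv n = qm • extDeriv l := fun h =>
      hx (exists_monopoleConfig_eq qm l n h)
    simp only [electricTerm, if_neg this, integral_zero]
  have hinj := monopoleConfig_injective qm l
  have hs2 := (hinj.summable_iff (f := fun n : Form N L 2 ℤ =>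
      ∫ A, electricTerm s β θ p qe qm l A n ∂gaugeMeasure N L 1)
      fun n hn => by_contra fun h => hn (hsupp h)).mpr hsum.summable
  rw [electricIntegral, ← hsum.tsum_eq, ← hinj.tsum_eq hsupp]
  refine hs2.tsum_prod.trans ?_
  simp only [Function.comp_apply, hterm, integral_const_mul, tsum_mul_left]
  simp only [hg.tsum_integral_shift, integral_gaussWeight_imag hβ, tsum_mul_right]
  rw [gaussWeight_zero, thetaSix, sectorIntegral, hR, hc, tsum_mul_left, neg_sq]
  ring

end Evaluation
/-! ### The transformations of the expectation values -/

section Duality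

variable {N : ℕ} [NeZero N] {L : Lattice}

/-- The closed form of the expectation value of a dyonic loop. -/
def loopFormula (s : Bool) (β θ : ℝ) (p qe qm : ℤ) (l : Form N L 2 ℤ) : ℂ :=
  prefactor s β θ p qe qm l *
    Complex.exp (-((qe + θ * qm / (2 * Real.pi)) ^ 2 * normSq l / (2 * β)) : ℝ) *
      (thetaSix β θ qe qm (flux l.toReal) / thetaSix β θ 0 0 (flux l.toReal))

lemma framedEv_eq_loopFormula {s : Bool} {β : ℝ} (hβ : 0 < β) (θ : ℝ) (p qe qm : ℤ)
    {l : Form N L 2 ℤ} {γ : Contour N L} (h : Bounds s l γ) :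
    framedEv s β θ p qe qm γ = loopFormula s β θ p qe qm l := by
  have h0 : prefactor s β θ 0 0 0 l = 1 := by simp [prefactor]
  rw [framedEv_eq θ p qe qm hβ h, electricIntegral_eq θ p qe qm l hβ,
    electricIntegral_eq θ 0 0 0 l hβ, h0, mul_div_mul_right _ _ (sectorIntegral_ne_zero hβ),
    loopFormula]
  simp
  ring

lemma normSq_transport (v : Fin 4 → ZMod N) (L' : Lattice) (l : Form N L 2 ℤ) :
    normSq (transport v L' l) = normSq l := by
  rw [normSq, toReal_transport, projBdry_transport, dot_transport, normSq]

lemma total_cup_transport {K : Type} [CommRing K] (v : Fin 4 → ZMod N) (L' : Lattice)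
    (f g : Form N L 2 K) : total (cup (transport v L' f) (transport v L' g)) =
      total (cup f g) := by
  rw [cup_transport]
  exact total_transport v _

lemma crossPairing_transport (s : Bool) (v : Fin 4 → ZMod N) (L' : Lattice)
    (l : Form N L 2 ℤ) : crossPairing (transport v L' l) s = crossPairing l s := by
  simp only [crossPairing, closedPart, toReal_transport, projBdry_transport]
  cases s <;> simp only [pairing, Bool.false_eq_true, if_false, if_true, ← transport_sub,
    total_cup_transport]

lemma vOf_transport (v : Fin 4 → ZMod N) (L' : Lattice) (l : Form N L 2 ℤ) :
    vOf (transport v L' l) = vOf l := by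
  have h : total (cupOne (transport v L' l) (transport v L' (extDeriv l))) =
      total (cupOne l (extDeriv l)) := by
    rw [cupOne_transport]
    exact total_transport v _
  rw [vOf, vOf, pontryagin, pontryagin, extDeriv_transport, h]
  exact congrArg (· + _) (total_cup_transport v L' l l)

lemma loopFormula_transport (s : Bool) (β θ : ℝ) (p qe qm : ℤ) (v : Fin 4 → ZMod N)
    (L' : Lattice) (l : Form N L 2 ℤ) :
    loopFormula s β θ p qe qm (transport v L' l) = loopFormula s β θ p qe qm l := by
  rw [loopFormula, loopFormula, prefactor, prefactor, normSq_transport, crossPairing_transport,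
    vOf_transport, uOf_transport, toReal_transport, flux_transport]

variable (l : Form N L 2 ℤ)

/-- Only the prefactor knows the framing. Its sign of `u` gives the part with θ q_m², and the cross
pairing gives the part with q_e q_m. -/
lemma loopFormula_false (β θ : ℝ) (p qe qm : ℤ) : loopFormula false β θ p qe qm l =
    loopFormula true β θ p qe qm l *
      Complex.exp (2 * Real.pi * Complex.I * uOf l * (qe + θ / (2 * Real.pi) * qm) * qm) := by
  have h : prefactor false β θ p qe qm l = prefactor true β θ p qe qm l *
      Complex.exp (2 * Real.pi * Complex.I * uOf l * (qe + θ / (2 * Real.pi) * qm) * qm) := by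
    obtain ⟨z, hz⟩ := exists_int_crossPairing l
    have hpi : (Real.pi : ℂ) ≠ 0 := by exact_mod_cast Real.pi_ne_zero
    rw [prefactor, prefactor, ← Complex.exp_add, Complex.exp_eq_exp_iff_exists_int, hz]
    refine ⟨-(qe * qm * z), ?_⟩
    simp only [framingSign, Bool.false_eq_true, if_false, if_true]
    push_cast
    field_simp
    ring
  rw [loopFormula, loopFormula, h]
  ring

lemma neg_one_zpow_eq_exp (k : ℤ) :
    (-1 : ℂ) ^ k = Complex.exp (Complex.I * Real.pi * k) := by
  rw [← Complex.exp_pi_mul_I, ← Complex.exp_int_mul]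
  congr 1
  ring

/-- Invariance under `θ → θ + 2π`. -/
lemma loopFormula_shiftTheta (s : Bool) (β θ : ℝ) (p qe qm : ℤ) :
    (-1) ^ (qm ^ 2 * vOf l) * loopFormula s β (θ + 2 * Real.pi) p (qe - qm) qm l =
      loopFormula s β θ p qe qm l := by
  have hpi' := Real.pi_ne_zero
  have hpi : (Real.pi : ℂ) ≠ 0 := by exact_mod_cast hpi'
  have h0 : thetaSix β (θ + 2 * Real.pi) 0 0 (flux l.toReal) =
      thetaSix β θ 0 0 (flux l.toReal) := by
    have := thetaSix_shift β θ 0 0 (flux l.toReal)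
    simpa using this
  -- The effective electric charge is unchanged, and with it the Gaussian factor.
  have h1 : (((qe - qm : ℤ) : ℝ) + (θ + 2 * Real.pi) * qm / (2 * Real.pi)) =
      qe + θ * qm / (2 * Real.pi) := by
    push_cast
    field_simp
    ring
  have h2 : Complex.exp (Complex.I * Real.pi * ((qm ^ 2 * vOf l : ℤ) : ℂ)) *
      prefactor s β (θ + 2 * Real.pi) p (qe - qm) qm l *
      Complex.exp (Complex.I * Real.pi *
        (qm ^ 2 * (flux l.toReal).wedge (flux l.toReal) : ℝ)) =
      prefactor s β θ p qe qm l := by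
    obtain ⟨z, hz⟩ := exists_int_crossPairing l
    have hv := vOf_eq l
    -- Eliminating λ∧λ in favour of `v`, `u` and the cross pairing leaves only integer multiples of
    -- 2πi.
    have hw : (flux l.toReal).wedge (flux l.toReal) =
        vOf l - uOf l - 2 * crossPairing l false := by linarith
    rw [prefactor, prefactor, ← Complex.exp_add, ← Complex.exp_add,
      Complex.exp_eq_exp_iff_exists_int, hw]
    cases s
    · refine ⟨qm ^ 2 * vOf l, ?_⟩
      simp only [framingSign, Bool.false_eq_true, if_false, if_true]
      push_cast
      ring
    · refine ⟨qm ^ 2 * vOf l - qm ^ 2 * z, ?_⟩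
      rw [hz]
      simp only [framingSign, Bool.false_eq_true, if_false, if_true]
      push_cast
      ring
  rw [loopFormula, loopFormula, h0, h1, thetaSix_shift, neg_one_zpow_eq_exp, ← h2]
  ring

lemma dualBeta_pos {β : ℝ} (hβ : 0 < β) (θ : ℝ) : 0 < dualBeta β θ := by
  have := Real.pi_pos
  rw [dualBeta]
  positivity

/-- Invariance under Poisson summation. -/
lemma loopFormula_poisson (s : Bool) {β : ℝ} (hβ : 0 < β) (θ : ℝ) (p qe qm : ℤ) :
    Complex.exp ((if s then -1 else 1) * (Complex.I * θ * uOf l * qm ^ 2 / 2 +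
        Complex.I * dualTheta β θ * uOf l * qe ^ 2 / 2)
      - Complex.I * p * Real.pi * vOf l * (qm ^ 2 + qe ^ 2)) *
      loopFormula (!s) (dualBeta β θ) (dualTheta β θ) p qm (-qe) l =
      loopFormula s β θ p qe qm l := by
  have hpi := Real.pi_pos
  have hβ' := dualBeta_pos hβ θ
  have hD : 0 < (2 * Real.pi * β) ^ 2 + (θ / (2 * Real.pi)) ^ 2 := by positivity
  have hfac := pow_ne_zero 3 (thetaFactor_ne_zero hβ θ)
  have h0 : thetaSix β θ 0 0 (flux l.toReal) = thetaFactor β θ ^ 3 *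
      thetaSix (dualBeta β θ) (dualTheta β θ) 0 0 (flux l.toReal) := by
    have := thetaSix_duality hβ hβ' 0 0 (flux l.toReal)
    simpa using this
  -- Both sides equal |P_∂ l|² |q_e + τ q_m|²/2β, which is invariant under τ ↦ -1/τ combined with
  -- the exchange of charges.
  have hR : β / 2 * ((2 * Real.pi * qm) ^ 2 * normSq l) +
      (qe + θ * qm / (2 * Real.pi)) ^ 2 * normSq l / (2 * β) =
      dualBeta β θ / 2 * ((2 * Real.pi * ((-qe : ℤ) : ℝ)) ^ 2 * normSq l) +
      (qm + dualTheta β θ * ((-qe : ℤ) : ℝ) / (2 * Real.pi)) ^ 2 * normSq l /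
        (2 * dualBeta β θ) := by
    rw [dualBeta, dualTheta]
    set D := (2 * Real.pi * β) ^ 2 + (θ / (2 * Real.pi)) ^ 2 with hDdef
    have hθ : θ ^ 2 = 4 * Real.pi ^ 2 * (D - 4 * Real.pi ^ 2 * β ^ 2) := by
      rw [hDdef]; field_simp; ring
    push_cast
    field_simp
    ring_nf
    simp only [hθ]
    ring
  have hexp : Complex.exp ((if s then -1 else 1) * (Complex.I * θ * uOf l * qm ^ 2 / 2 +
        Complex.I * dualTheta β θ * uOf l * qe ^ 2 / 2)
      - Complex.I * p * Real.pi * vOf l * (qm ^ 2 + qe ^ 2)) *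
      (prefactor (!s) (dualBeta β θ) (dualTheta β θ) p qm (-qe) l *
      Complex.exp (-((qm + dualTheta β θ * ((-qe : ℤ) : ℝ) / (2 * Real.pi)) ^ 2 * normSq l /
        (2 * dualBeta β θ)) : ℝ)) =
      prefactor s β θ p qe qm l *
      Complex.exp (-((qe + θ * qm / (2 * Real.pi)) ^ 2 * normSq l / (2 * β)) : ℝ) *
      Complex.exp (-(2 * Real.pi * Complex.I *
        (qe * qm * (flux l.toReal).wedge (flux l.toReal) : ℝ))) := by
    obtain ⟨z, hz⟩ := exists_int_crossPairing l
    have hv := vOf_eq l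
    have hw : (flux l.toReal).wedge (flux l.toReal) =
        vOf l - uOf l - 2 * crossPairing l false := by linarith
    have hRc := congrArg (fun x : ℝ => (x : ℂ)) hR
    rw [prefactor, prefactor, ← Complex.exp_add, ← Complex.exp_add, ← Complex.exp_add,
      ← Complex.exp_add, Complex.exp_eq_exp_iff_exists_int, hw]
    -- Phases of λ∧λ and of the two orders of the cross pairing give the first term; the second
    -- appears because the p-phase of q_e² enters twice.
    refine ⟨qe * qm * (vOf l - z) - p * qe ^ 2 * vOf l, ?_⟩
    cases s
    · simp only [framingSign, Bool.false_eq_true, if_false, if_true, Bool.not_false]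
      rw [hz]
      push_cast at hRc ⊢
      linear_combination hRc
    · simp only [framingSign, Bool.false_eq_true, if_false, if_true, Bool.not_true]
      rw [hz]
      push_cast at hRc ⊢
      linear_combination hRc
  rw [loopFormula, loopFormula, h0, thetaSix_duality hβ hβ', mul_div_mul_left _ _ hfac,
    ← mul_assoc, hexp]
  ring

lemma loopFormula_neg (s : Bool) (β θ : ℝ) (p qe qm : ℤ) :
    loopFormula s β θ p (-qe) (-qm) l = loopFormula s β θ p qe qm l := by
  rw [loopFormula, loopFormula, prefactor, prefactor, thetaSix_neg]
  congr 3 <;> congr 1 <;> push_cast <;> ring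

end Duality

/-! ### The two framings on the common form l, and the order of the modular transformation. -/

section LoopExpressions

variable {N : ℕ} [NeZero N] {γ : Contour N Lattice.primal} {l : Form N Lattice.primal 2 ℤ}

lemma IsSeifert.evDyonic_eq (h : IsSeifert l γ) {β : ℝ} (hβ : 0 < β) (θ : ℝ) (p qe qm : ℤ) :
    evDyonic β θ p qe qm γ = loopFormula true β θ p qe qm l := by
  rw [← framedEv_true, framedEv_eq_loopFormula hβ θ p qe qm h.bounds]

lemma IsSeifert.evDualDyonic_eq (h : IsSeifert l γ) {β : ℝ} (hβ : 0 < β) (θ : ℝ)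
    (p qe qm : ℤ) : evDualDyonic β θ p qe qm γ.F = loopFormula false β θ p qe qm l := by
  rw [← framedEv_false, framedEv_eq_loopFormula hβ θ p qe qm h.bounds_F, loopFormula_transport]

lemma IsSeifert.value_eq (h : IsSeifert l γ) (p : ℤ) {s : LoopExpr} (hs : 0 < s.β) :
    s.value γ p = s.c * loopFormula s.framed s.β s.θ p s.qe s.qm l := by
  rw [LoopExpr.value]
  split_ifs with hf
  · rw [h.evDyonic_eq hs, hf]
  · rw [h.evDualDyonic_eq hs, Bool.eq_false_iff.mpr hf]

lemma IsSeifert.value_poisson (h : IsSeifert l γ) (p : ℤ) {s : LoopExpr} (hs : 0 < s.β) :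
    (s.poisson (uOf l) (vOf l) p).value γ p = s.value γ p := by
  rw [h.value_eq p hs, h.value_eq p (show 0 < (s.poisson (uOf l) (vOf l) p).β from
    dualBeta_pos hs s.θ), ← loopFormula_poisson l s.framed hs, ← mul_assoc]
  rfl

lemma IsSeifert.value_shiftTheta (h : IsSeifert l γ) (p : ℤ) {s : LoopExpr} (hs : 0 < s.β) :
    (s.shiftTheta (vOf l)).value γ p = s.value γ p := by
  rw [h.value_eq p hs, h.value_eq p (show 0 < (s.shiftTheta (vOf l)).β from hs),
    ← loopFormula_shiftTheta l s.framed, ← mul_assoc]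
  rfl

/-- In terms of τ = x + iy this says that τ ↦ 1 - 1/τ has order three; the last translation by 2π is
not yet applied. -/
lemma dual_dual_dual {β : ℝ} (hβ : 0 < β) (θ : ℝ) :
    let β₁ := dualBeta β θ
    let θ₁ := dualTheta β θ
    let β₂ := dualBeta β₁ (θ₁ + 2 * Real.pi)
    let θ₂ := dualTheta β₁ (θ₁ + 2 * Real.pi)
    dualBeta β₂ (θ₂ + 2 * Real.pi) = β ∧ dualTheta β₂ (θ₂ + 2 * Real.pi) = θ - 2 * Real.pi := by
  intro β₁ θ₁ β₂ θ₂
  have hpi := Real.pi_pos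
  set x := θ / (2 * Real.pi) with hx
  set y := 2 * Real.pi * β with hy
  have hy0 : 0 < y := by positivity
  have hθ : θ = 2 * Real.pi * x := by rw [hx]; field_simp
  have hβy : β = y / (2 * Real.pi) := by rw [hy]; field_simp
  have hD : 0 < y ^ 2 + x ^ 2 := by positivity
  have hD' : 0 < y ^ 2 + (1 - x) ^ 2 := by positivity
  have e1 : β₁ = y / (2 * Real.pi) / (y ^ 2 + x ^ 2) := by
    rw [← hβy]; rfl
  have e2 : θ₁ = -(2 * Real.pi * x) / (y ^ 2 + x ^ 2) := by
    rw [← hθ]; rfl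
  have e3 : (2 * Real.pi * β₁) ^ 2 + ((θ₁ + 2 * Real.pi) / (2 * Real.pi)) ^ 2 =
      (y ^ 2 + (1 - x) ^ 2) / (y ^ 2 + x ^ 2) := by
    rw [e1, e2]; field_simp; ring
  have e4 : β₂ = y / (2 * Real.pi) / (y ^ 2 + (1 - x) ^ 2) := by
    simp only [β₂]
    rw [dualBeta, e3, e1]; field_simp
  have e5 : θ₂ + 2 * Real.pi = 2 * Real.pi * (1 - x) / (y ^ 2 + (1 - x) ^ 2) := by
    simp only [θ₂]
    rw [dualTheta, e3, e2]; field_simp; ring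
  have e6 : (2 * Real.pi * β₂) ^ 2 + ((θ₂ + 2 * Real.pi) / (2 * Real.pi)) ^ 2 =
      1 / (y ^ 2 + (1 - x) ^ 2) := by
    rw [e4, e5]; field_simp
  constructor
  · rw [dualBeta, e6, e4, hβy]; field_simp
  · rw [dualTheta, e6, e5, hθ]; field_simp; ring

end LoopExpressions
end LatticeMaxwell
end

open LatticeMaxwell
theorem mainTheorem5 (N : ℕ) [NeZero N] (β θ : ℝ) (hβ : 0 < β) (p qe qm : ℤ)
    (γ : Contour N Lattice.primal) (l : Form N Lattice.primal 2 ℤ) (hl : IsSeifert l γ) :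
    -- the relation between the two framings
    evDualDyonic β θ p qe qm γ.F =
      evDyonic β θ p qe qm γ *
        Complex.exp (2 * Real.pi * Complex.I * uOf l * (qe + θ / (2 * Real.pi) * qm) * qm) ∧
    -- it is obtained by alternating Poisson summation and the theta-shift three times
    (let P : LoopExpr → LoopExpr := LoopExpr.poisson (uOf l) (vOf l) p
     let T : LoopExpr → LoopExpr := LoopExpr.shiftTheta (vOf l)
     let s₀ : LoopExpr := ⟨true, qe, qm, β, θ, 1⟩
     (∀ j < 3, ((P ((T ∘ P)^[j] s₀)).value γ p = ((T ∘ P)^[j] s₀).value γ p ∧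
        (T (P ((T ∘ P)^[j] s₀))).value γ p = (P ((T ∘ P)^[j] s₀)).value γ p)) ∧
     (T ∘ P)^[3] s₀ = ⟨false, -qe, -qm, β, θ,
        Complex.exp (-(2 * Real.pi * Complex.I * uOf l * (qe + θ / (2 * Real.pi) * qm) * qm))⟩ ∧
     evDualDyonic β θ p (-qe) (-qm) γ.F = evDualDyonic β θ p qe qm γ.F) := by
  refine ⟨?_, ?_, ?_, ?_⟩
  · rw [hl.evDyonic_eq hβ, hl.evDualDyonic_eq hβ, loopFormula_false]
  -- Every step needs a positive coupling; duality preserves positivity and the θ-shift leaves β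
  -- alone.
  · have hpos : ∀ j, 0 < ((LoopExpr.shiftTheta (vOf l) ∘ LoopExpr.poisson (uOf l) (vOf l) p)^[j]
        ⟨true, qe, qm, β, θ, 1⟩).β := by
      intro j
      induction j with
      | zero => exact hβ
      | succ j ih =>
        rw [Function.iterate_succ_apply']
        exact dualBeta_pos ih _
    intro j _
    exact ⟨hl.value_poisson p (hpos j), hl.value_shiftTheta p (dualBeta_pos (hpos j) _)⟩
  · obtain ⟨h1, h2⟩ := dual_dual_dual hβ θ
    simp only [Function.iterate_succ, Function.iterate_zero, Function.comp_apply, id_eq]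
    ext1
    · rfl
    · simp [LoopExpr.shiftTheta, LoopExpr.poisson]
    · simp [LoopExpr.shiftTheta, LoopExpr.poisson]
    · simpa [LoopExpr.shiftTheta, LoopExpr.poisson] using h1
    · simp only [LoopExpr.shiftTheta, LoopExpr.poisson, h2]
      ring
    · simp only [LoopExpr.shiftTheta, LoopExpr.poisson, h2, Bool.not_true, Bool.not_false, if_true,
        Bool.false_eq_true, if_false, neg_one_zpow_eq_exp, ← Complex.exp_add, one_mul]
      rw [Complex.exp_eq_exp_iff_exists_int]
      -- The squared magnetic charges at the three θ-shifts are q_e², (q_e + q_m)² and q_m², with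
      -- sum 2(q_e² + q_m² + q_e q_m). The p-phases of the three Poisson steps involve twice that
      -- sum.
      refine ⟨vOf l * (qm ^ 2 + qe ^ 2 + qm * qe) - 2 * p * vOf l * (qm ^ 2 + qe ^ 2 + qm * qe), ?_⟩
      have hpi : (Real.pi : ℂ) ≠ 0 := by exact_mod_cast Real.pi_ne_zero
      push_cast
      field_simp
      ring
  · rw [hl.evDualDyonic_eq hβ, hl.evDualDyonic_eq hβ, loopFormula_neg]
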